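/- We work in the CONGEST model: the vertices of a connected graph $G=(V,E)$ with $n=|V|$ vertices and hop-diameter $D$ communicate in synchronous rounds, all running the same program with private random bits; in each round every vertex may send one message of $O(1)$ words through each of its ports, local computation is free, and outputs are irrevocable. A word has $O(\log n)$ bits. The vertices have distinct names of one word each, and the edges incident to a vertex $v$ are attached, in an arbitrary way, to the ports $0,\dots,\deg(v)-1$ of $v$. Let $T$ be a tree that is a subgraph of $G$, rooted at one of its vertices. Initially a vertex knows only its own name, whether it belongs to $T$, and, for each of its ports, the name of the neighbour there and whether the edge leads to its parent in $T$, leads to one of its children in $T$, or is not an edge of $T$. (In particular $n$ and $D$ are not known.) A routing scheme for $T$ assigns to every vertex of $T$ a table and a label, so that a packet with destination $v$ can be delivered by local decisions: a vertex $x$ that holds the packet decides, by a fixed function of the table of $x$ and the label of $v$ only, either that the packet has arrived or through which port to forward it. The packet must travel from any vertex $u$ of $T$ to any vertex $v$ of $T$ along edges of $T$, and be declared to have arrived exactly when it reaches $v$. The scheme has stretch $1$ with respect to positive integer edge weights if the weight of the walk of every packet from $u$ to $v$ is at most the distance between $u$ and $v$ in $T$. **Theorem.** There is an exponent $k$ such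 that for all constants $\kappa$ and $c$ there are a randomized CONGEST algorithm, a decision function and a constant $C$, with the following property. For every connected graph $G$ with $n\ge 1$ vertices, hop-diameter $D$ and arbitrary positive integer edge weights, every assignment of distinct names of $\kappa(\lfloor\log_2 n\rfloor+1)$ bits to its vertices, every port numbering, and every rooted tree $T$ that is a subgraph of $G$: with probability at least $1-n^{-c}$, within $$\left\lceil C\,(\sqrt n+D)\,(\lfloor\log_2 n\rfloor+1)^k\right\rceil=\tilde O(\sqrt n+D)$$ rounds every vertex of $T$ has output a table of at most $C(\lfloor\log_2 n\rfloor+1)=O(\log n)$ words and a label of at most $C(\lfloor\log_2 n\rfloor+1)^2=O(\log^2 n)$ words, and these form, with the decision function, a routing scheme for $T$ with stretch $1$. Every message that is ever sent, whatever the random bits are, consists of at most $C$ words. Here a word in messages, tables and labels has $C(\lfloor\log_2 n\rfloor+1)$ bits. -/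

import Mathlib

open MeasureTheory
open scoped ENNReal

namespace TreeRouting

/-! ### Words -/

/-- The number of binary digits of `n`, that is `⌊log₂ n⌋ + 1` for `n ≥ 1`.  It plays the role of
`log n` and, unlike `log n`, does not vanish at `n = 1`. -/
def lg (n : ℕ) : ℕ := Nat.log 2 n + 1

/-- `x` fits into `C * lg n` bits, that is, into one word of `O(log n)` bits. -/
def IsWord (C n x : ℕ) : Prop := x < 2 ^ (C * lg n)

/-! ### The CONGEST model -/

/-- The edges incident to a vertex `v` are attached to ports `0, …, deg v - 1` of `v`.  The two ends
of an edge are numbered independently of each other. -/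
structure PortNumbering {V : Type} [Fintype V] (G : SimpleGraph V) [DecidableRel G.Adj] where
  nbr : (v : V) → Fin (G.degree v) ≃ G.neighborSet v

/-- The port of `v` that leads to its neighbour `u`. -/
def PortNumbering.port {V : Type} [Fintype V] {G : SimpleGraph V} [DecidableRel G.Adj]
    (P : PortNumbering G) (v u : V) (h : G.Adj v u) : Fin (G.degree v) :=
  (P.nbr v).symm ⟨u, h⟩

/-- A synchronous message passing algorithm, with local inputs in `I` and local outputs in `O`.  All
vertices run the same program.  A vertex starts from its local input and its private random tape.
In each round it sends one message, a list of numbers, through each of its ports (the empty list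
stands for silence), receives the messages of its neighbours, and changes its state.  Local
computation is free.  An output, once produced, is irrevocable. -/
structure Algorithm (I O : Type) where
  State : Type
  init : I → (ℕ → Bool) → State
  send : State → ℕ → List ℕ
  recv : State → (ℕ → List ℕ) → State
  output : State → Option O
  output_recv : ∀ (s : State) (inbox : ℕ → List ℕ) (o : O),
    output s = some o → output (recv s inbox) = some o

section Execution

variable {V I O : Type} [Fintype V] {G : SimpleGraph V} [DecidableRel G.Adj]

/-- What `v` receives, port by port, when the current states of all the vertices are `σ`. -/
def Algorithm.inbox (A : Algorithm I O) (P : PortNumbering G) (σ : V → A.State) (v : V) (i : ℕ) :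
    List ℕ :=
  if h : i < G.degree v then
    A.send (σ (P.nbr v ⟨i, h⟩)) (P.port (P.nbr v ⟨i, h⟩) v (P.nbr v ⟨i, h⟩).2.symm)
  else []

/-- The state of every vertex after `t` rounds, for local inputs `inp` and random tapes `ω`. -/
def Algorithm.run (A : Algorithm I O) (P : PortNumbering G) (inp : V → I) (ω : V → ℕ → Bool) :
    ℕ → V → A.State
  | 0, v => A.init (inp v) (ω v)
  | t + 1, v => A.recv (A.run P inp ω t v) (A.inbox P (A.run P inp ω t) v)

/-- The bandwidth restriction of the CONGEST model: on these inputs, whatever the coin tosses are,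
every message ever sent consists of at most `C` words of `C * lg n` bits each. -/
def Algorithm.SmallMessages (A : Algorithm I O) (P : PortNumbering G) (inp : V → I) (C : ℕ) :
    Prop :=
  ∀ (ω : V → ℕ → Bool) (t : ℕ) (v : V) (i : Fin (G.degree v)),
    (A.send (A.run P inp ω t v) i).length ≤ C ∧
      ∀ x ∈ A.send (A.run P inp ω t v) i, IsWord C (Fintype.card V) x

end Execution

/-- A fair coin. -/
noncomputable def coin : Measure Bool := (PMF.uniformOfFintype Bool).toMeasure

/-- The law of the random tapes: all bits of all the vertices are independent fair coins. -/
noncomputable def tapes (V : Type) [Fintype V] : Measure (V → ℕ → Bool) :=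
  Measure.pi fun _ : V => Measure.infinitePi fun _ : ℕ => coin

/-! ### The local view of a rooted tree -/

/-- How a vertex sees one of its incident edges. -/
inductive EdgeRole where
  | nonTree
  | toParent
  | toChild

/-- What a vertex knows initially: its name, whether it belongs to the tree, and, for each of its
ports in turn, the name of the neighbour there and the role of the edge in the rooted tree. -/
structure LocalInput where
  name : ℕ
  inTree : Bool
  ports : List (ℕ × EdgeRole)

section Tree

variable {V : Type} [Fintype V] {G : SimpleGraph V} [DecidableRel G.Adj]

open Classical in
/-- The role, from the point of view of `v`, of the edge from `v` to `u`, for the tree `T` rooted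
at `z`. -/
noncomputable def edgeRole (T : G.Subgraph) (z v u : V) : EdgeRole :=
  if T.Adj v u then
    if T.spanningCoe.dist z u < T.spanningCoe.dist z v then .toParent else .toChild
  else .nonTree

open Classical in
/-- The initial knowledge of `v`. -/
noncomputable def localInput (P : PortNumbering G) (name : V → ℕ) (T : G.Subgraph) (z v : V) :
    LocalInput where
  name := name v
  inTree := decide (v ∈ T.verts)
  ports := List.ofFn fun i : Fin (G.degree v) =>
    (name (P.nbr v i), edgeRole T z v (P.nbr v i))

end Tree

/-! ### Routing schemes -/

section Routing

variable {V : Type}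

/-- The weighted length of a walk. -/
def walkWeight {H : SimpleGraph V} (w : Sym2 V → ℕ) {u v : V} (p : H.Walk u v) : ℕ :=
  (p.edges.map w).sum

/-- The weighted distance in `H` (for `u` and `v` in the same component of `H`). -/
noncomputable def wdist (H : SimpleGraph V) (w : Sym2 V → ℕ) (u v : V) : ℕ :=
  ⨅ p : H.Walk u v, walkWeight w p

variable [Fintype V] {G : SimpleGraph V} [DecidableRel G.Adj]

/-- A packet that is handled at each vertex `x` according to `dec x` travels along the walk `p`, and
is declared to have arrived exactly at its end.  Here `dec x = some i` means that `x` forwards the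
packet through its port `i`, and `dec x = none` means that `x` declares that it has arrived. -/
def Follows {H : SimpleGraph V} (hH : H ≤ G) (P : PortNumbering G) (dec : V → Option ℕ) :
    ∀ {u v : V}, H.Walk u v → Prop
  | u, _, .nil => dec u = none
  | u, _, .cons (v := x) h p =>
      dec u = some (P.port u x (hH h) : ℕ) ∧ Follows hH P dec p

/-- The tables and labels, read by the decision function `route`, form a routing scheme with stretch
at most `s` for the tree `T`.  A vertex decides what to do with a packet from its own table and the
label of the destination (the header of the packet) only, and for any source `u` and destination `v`
in `T`, the packet travels along edges of `T` from `u` to `v`, on a walk whose weight is at most `s`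
times the distance in `T`. -/
def IsRoutingScheme (P : PortNumbering G) (T : G.Subgraph) (w : Sym2 V → ℕ)
    (route : List ℕ → List ℕ → Option ℕ) (table label : V → List ℕ) (s : ℝ) : Prop :=
  ∀ u ∈ T.verts, ∀ v ∈ T.verts, ∃ p : T.spanningCoe.Walk u v,
    Follows T.spanningCoe_le P (fun x => route (table x) (label v)) p ∧
      (walkWeight w p : ℝ) ≤ s * wdist T.spanningCoe w u v

/-- A list of at most `m` words, of `C * lg n` bits each. -/
def HasSize (C n m : ℕ) (l : List ℕ) : Prop :=
  l.length ≤ m ∧ ∀ x ∈ l, IsWord C n x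

/-- With random tapes `ω`, after `R` rounds all the vertices of `T` have produced their tables, of at
most `C * lg n` words, and their labels, of at most `C * (lg n) ^ 2` words, and these form a routing
scheme for `T` with stretch at most `s`. -/
def Succeeds (A : Algorithm LocalInput (List ℕ × List ℕ)) (route : List ℕ → List ℕ → Option ℕ)
    (P : PortNumbering G) (name : V → ℕ) (T : G.Subgraph) (z : V) (w : Sym2 V → ℕ) (s : ℝ)
    (C R : ℕ) (ω : V → ℕ → Bool) : Prop :=
  ∃ table label : V → List ℕ,
    (∀ v ∈ T.verts,
      A.output (A.run P (localInput P name T z) ω R v) = some (table v, label v) ∧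
      HasSize C (Fintype.card V) (C * lg (Fintype.card V)) (table v) ∧
      HasSize C (Fintype.card V) (C * lg (Fintype.card V) ^ 2) (label v)) ∧
    IsRoutingScheme P T w route table label s

end Routing

end TreeRouting

/-! Routing follows heavy paths. Mark at every vertex one child as heavy, and let the address of `v`
list the steps from the root to `v`, each either "heavy" or an explicit port. Ancestors of the
destination are exactly the vertices whose address is a prefix of its address, so `route` climbs
until this holds and then reads off the next step. The resulting walk is simple (`exists_walk`), and
in a forest a simple walk is lightest for all weights at once (`walkWeight_le`). Run-length encoding
spends two words per light step, so everything rests on having only logarithmically many light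
steps.

Subtree sizes are not needed for that. If `f` satisfies `1 + ∑ f(children) ≤ f(v)` and heavy
children maximise `f`, every light step at least halves `f`, which bounds the light steps by `log₂`
of the value at the root (`two_pow_lightCount_mul_le`). To obtain such an `f` quickly, tree vertices
are sampled with probability `2 ^ (-j)`, and the tree is cut above them into fragments. The tree of
fragments is broadcast to everybody, so all vertices pick the same superadditive `s` on it (counting
fragments below shows that one exists). Put `f = M * s` at fragment roots, with `M ≥ n`, and count
additively inside fragments. This is superadditive at fragment roots too: below a root there are
fewer than `M` other vertices to count, and the child fragments contribute `M` times their weights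
(`one_add_sum_children_le`). Since `f ≤ M ^ 2`, there are at most `2 * log₂ M` light steps.
Addresses relative to fragment roots flow down inside fragments, the pieces that join consecutive
fragment roots are broadcast, and every vertex concatenates. Broadcasting `K` tokens over distance
`R` takes `K + R` repetitions by pipelining (`broadcast_progress`).

As `n` and `D` are unknown, phases with radius `2 ^ j` are tried in turn. Vertices compare the
largest names in their balls. A single vertex that hears of no disagreement within twice the radius
certifies that all distances are at most `2 * 2 ^ j` and that everybody knows the largest name
(`of_agreement`), whose length replaces `log n`. The number of fragments is then checked by a
broadcast. Both verdicts are unanimous, so the network stays in lockstep.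

The depth of fragments is not checked. It is controlled by a union bound over all phases up to the
first `J` with `2 ^ J > D + √n`: a path of `2 ^ j * a` vertices is missed with probability at most
`2 ^ (-a)` (`tapes_none_hit`). Markov's inequality for `2 ^ X`, with `X` the number of sampled
vertices (`tapes_many_hits`), shows that phase `J` passes. The time is a geometric sum dominated by
`2 ^ J`. Messages are small for all coin tosses, because after the agreement every word is truncated
by `clip`, and some phase passes surely (`exists_first_pass`). -/

namespace TreeRouting

/-! ### Programs that run in lockstep -/

/-- What a vertex receives in a round, port by port. -/
abbrev Inbox := ℕ → List ℕ

/-- A local program: it sends messages through the ports, and continues in a way that depends on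
the messages that it receives. -/
inductive Prog (α : Type) : Type
  | ret (a : α)
  | step (out : ℕ → List ℕ) (next : Inbox → Prog α)

/-- Sequential composition. -/
def Prog.bind {α β : Type} : Prog α → (α → Prog β) → Prog β
  | .ret a, f => f a
  | .step out k, f => .step out fun x => (k x).bind f

section Lockstep

variable {V : Type} [Fintype V] {G : SimpleGraph V} [DecidableRel G.Adj]

/-- What `v` receives through port `i`, if every vertex `u` sends `out u`. -/
def deliver (P : PortNumbering G) (out : V → ℕ → List ℕ) (v : V) (i : ℕ) : List ℕ :=
  if h : i < G.degree v then
    out (P.nbr v ⟨i, h⟩) (P.port (P.nbr v ⟨i, h⟩) v (P.nbr v ⟨i, h⟩).2.symm)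
  else []

/-- When the vertices `v` run the programs `p v`, they all finish after exactly `T` rounds, with the
results `a v`, and all messages on the way consist of at most `C` words. -/
inductive Exec (P : PortNumbering G) (C : ℕ) {α : Type} : (V → Prog α) → ℕ → (V → α) → Prop
  | ret (a : V → α) : Exec P C (fun v => .ret (a v)) 0 a
  | step (out : V → ℕ → List ℕ) (k : V → Inbox → Prog α) {T : ℕ} {b : V → α}
      (hs : ∀ v i, (out v i).length ≤ C ∧ ∀ x ∈ out v i, IsWord C (Fintype.card V) x)
      (h : Exec P C (fun v => k v (deliver P out v)) T b) :
      Exec P C (fun v => .step (out v) (k v)) (T + 1) b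

/-- All vertices leave the first program in the same round, so the continuations start
simultaneously. -/
theorem Exec.bind {P : PortNumbering G} {C : ℕ} {α β : Type} {p : V → Prog α} {T : ℕ} {a : V → α}
    (h : Exec P C p T a) {f : V → α → Prog β} {T' : ℕ} {b : V → β}
    (h' : Exec P C (fun v => f v (a v)) T' b) :
    Exec P C (fun v => (p v).bind (f v)) (T + T') b := by
  induction h with
  | ret a => simpa [Prog.bind] using h'
  | step out k hs h ih =>
    have := Exec.step (C := C) (P := P) out (fun v x => (k v x).bind (f v)) hs (ih h')
    rw [Nat.add_right_comm]
    simpa only [Prog.bind] using this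

/-! ### The algorithm that runs phase after phase until one of them produces an output -/

/-- The state of a vertex in the middle of a phase. -/
structure LoopState (I O : Type) where
  input : I
  tape : ℕ → Bool
  phase : ℕ
  prog : Prog (Option O)

/-- Run `body 0`, `body 1`, … until one of these programs returns an output. -/
def loopAlg {I O : Type} (body : I → (ℕ → Bool) → ℕ → Prog (Option O)) : Algorithm I O where
  State := LoopState I O
  init i b := ⟨i, b, 0, body i b 0⟩
  send s := match s.prog with
    | .step out _ => out
    | .ret _ => fun _ => []
  recv s x := match s.prog with
    | .step _ k => ⟨s.input, s.tape, s.phase, k x⟩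
    | .ret none => ⟨s.input, s.tape, s.phase + 1, body s.input s.tape (s.phase + 1)⟩
    | .ret (some _) => s
  output s := match s.prog with
    | .ret (some o) => some o
    | _ => none
  output_recv := by
    rintro ⟨i, b, j, p⟩ x o h
    match p, h with
    | .ret (some _), h => exact h

variable {I O : Type} {body : I → (ℕ → Bool) → ℕ → Prog (Option O)} {P : PortNumbering G}
  {inp : V → I} {ω : V → ℕ → Bool} {C : ℕ}

/-- The messages of round `t` are small. -/
def SmallAt (A : Algorithm I O) (P : PortNumbering G) (inp : V → I) (ω : V → ℕ → Bool) (C t : ℕ) :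
    Prop :=
  ∀ v i, (A.send (A.run P inp ω t v) i).length ≤ C ∧
    ∀ x ∈ A.send (A.run P inp ω t v) i, IsWord C (Fintype.card V) x

/-- The loop executes the current program verbatim, so an execution of it embeds into the run from
round `t` on. -/
theorem run_of_exec {p : V → Prog (Option O)} {T : ℕ} {a : V → Option O} (h : Exec P C p T a)
    {t j : ℕ} (ht : ∀ v, (loopAlg body).run P inp ω t v = ⟨inp v, ω v, j, p v⟩) :
    (∀ v, (loopAlg body).run P inp ω (t + T) v = ⟨inp v, ω v, j, .ret (a v)⟩) ∧
      ∀ s, t ≤ s → s ≤ t + T → SmallAt (loopAlg body) P inp ω C s := by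
  induction h generalizing t with
  | ret a =>
    refine ⟨ht, fun s h1 h2 v i => ?_⟩
    obtain rfl : s = t := by omega
    rw [ht]
    simp [loopAlg]
  | @step out k T b hs h ih =>
    have hnext : ∀ v, (loopAlg body).run P inp ω (t + 1) v =
        ⟨inp v, ω v, j, k v (deliver P out v)⟩ := by
      intro v
      have hin : (loopAlg body).inbox P ((loopAlg body).run P inp ω t) v = deliver P out v := by
        funext i
        unfold Algorithm.inbox deliver
        split_ifs
        · rw [ht]; rfl
        · rfl
      change (loopAlg body).recv _ _ = _
      rw [hin, ht]
      rfl
    obtain ⟨h1, h2⟩ := ih hnext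
    refine ⟨fun v => by rw [← h1 v, Nat.add_right_comm, Nat.add_assoc], fun s hs1 hs2 => ?_⟩
    rcases Nat.eq_or_lt_of_le hs1 with rfl | hlt
    · intro v i
      rw [ht]
      exact hs v i
    · exact h2 s hlt (by omega)

/-- The extra round per phase is the silent one in which `.ret none` is replaced by the next
program. -/
theorem run_start {J : ℕ} {T : ℕ → ℕ}
    (hfail : ∀ j < J, Exec P C (fun v => body (inp v) (ω v) j) (T j) fun _ => none) :
    (∀ v, (loopAlg body).run P inp ω (∑ j ∈ Finset.range J, (T j + 1)) v =
      ⟨inp v, ω v, J, body (inp v) (ω v) J⟩) ∧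
      ∀ s < ∑ j ∈ Finset.range J, (T j + 1), SmallAt (loopAlg body) P inp ω C s := by
  induction J with
  | zero => exact ⟨fun v => rfl, by simp⟩
  | succ J ih =>
    obtain ⟨h1, h2⟩ := ih fun j hj => hfail j (by omega)
    obtain ⟨h3, h4⟩ := run_of_exec (hfail J (by omega)) h1
    rw [Finset.sum_range_succ]
    refine ⟨fun v => ?_, fun s hs => ?_⟩
    · rw [← Nat.add_assoc]
      change (loopAlg body).recv _ _ = _
      rw [h3]
      rfl
    · by_cases hlt : s < ∑ j ∈ Finset.range J, (T j + 1)
      · exact h2 s hlt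
      · exact h4 s (by omega) (by omega)

/-- A state with an output is silent and fixed by `recv`, so after phase `J` there is nothing left
to control. -/
theorem loopAlg_spec {J : ℕ} {T : ℕ → ℕ} {o : V → O}
    (hfail : ∀ j < J, Exec P C (fun v => body (inp v) (ω v) j) (T j) fun _ => none)
    (hlast : Exec P C (fun v => body (inp v) (ω v) J) (T J) fun v => some (o v)) :
    (∀ t, ∑ j ∈ Finset.range (J + 1), (T j + 1) ≤ t → ∀ v,
      (loopAlg body).output ((loopAlg body).run P inp ω t v) = some (o v)) ∧
      ∀ s, SmallAt (loopAlg body) P inp ω C s := by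
  obtain ⟨h1, h2⟩ := run_start hfail
  obtain ⟨h3, h4⟩ := run_of_exec hlast h1
  rw [Finset.sum_range_succ]
  set t₀ := ∑ j ∈ Finset.range J, (T j + 1) + T J with ht₀
  have h5 : ∀ k v, (loopAlg body).run P inp ω (t₀ + k) v = ⟨inp v, ω v, J, .ret (some (o v))⟩ := by
    intro k
    induction k with
    | zero => exact h3
    | succ k ih =>
      intro v
      change (loopAlg body).recv ((loopAlg body).run P inp ω (t₀ + k) v) _ = _
      rw [ih]
      rfl
  refine ⟨fun t ht v => ?_, fun s => ?_⟩
  · obtain ⟨k, rfl⟩ := Nat.exists_eq_add_of_le (show t₀ ≤ t by omega)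
    rw [h5]
    rfl
  · by_cases hs : s < ∑ j ∈ Finset.range J, (T j + 1)
    · exact h2 s hs
    by_cases hs' : s ≤ t₀
    · exact h4 s (by omega) hs'
    · obtain ⟨k, rfl⟩ := Nat.exists_eq_add_of_le (show t₀ ≤ s by omega)
      intro v i
      rw [h5]
      simp [loopAlg]

/-! ### Exchanging long messages, and iterating such exchanges -/

/-- Send the first `m` words of every message, each of them modified by `f`, one word per round. -/
def xchg (f : ℕ → ℕ) : ℕ → (ℕ → List ℕ) → Prog Inbox
  | 0, _ => .ret fun _ => []
  | m + 1, out => .step (fun i => ((out i).take 1).map f) fun x =>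
      (xchg f m fun i => (out i).drop 1).bind fun y => .ret fun i => x i ++ y i

/-- What is received in `xchg f m`. -/
def recvd (P : PortNumbering G) (f : ℕ → ℕ) (m : ℕ) (out : V → ℕ → List ℕ) (v : V) (i : ℕ) :
    List ℕ :=
  ((deliver P out v i).take m).map f

theorem deliver_map (P : PortNumbering G) (out : V → ℕ → List ℕ) (g : List ℕ → List ℕ)
    (hg : g [] = []) (v : V) (i : ℕ) :
    deliver P (fun u k => g (out u k)) v i = g (deliver P out v i) := by
  unfold deliver
  split_ifs <;> simp [hg]

theorem exec_xchg (hC : 1 ≤ C) (f : ℕ → ℕ) (m : ℕ) (out : V → ℕ → List ℕ)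
    (hf : ∀ v i, ∀ x ∈ out v i, IsWord C (Fintype.card V) (f x)) :
    Exec P C (fun v => xchg f m (out v)) m (recvd P f m out) := by
  induction m generalizing out with
  | zero =>
    have : recvd P f 0 out = fun _ _ => [] := by
      funext v i; simp [recvd]
    rw [this]
    exact Exec.ret _
  | succ m ih =>
    have hd := ih (fun v i => (out v i).drop 1) fun v i x hx => hf v i x (List.mem_of_mem_drop hx)
    have hb := hd.bind (f := fun v y => .ret fun i =>
      deliver P (fun v i => ((out v i).take 1).map f) v i ++ y i) (Exec.ret _)
    have hr : recvd P f (m + 1) out = fun v i =>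
        deliver P (fun v i => ((out v i).take 1).map f) v i ++
          recvd P f m (fun v i => (out v i).drop 1) v i := by
      funext v i
      rw [deliver_map P out (fun l => (l.take 1).map f) (by simp), recvd, recvd,
        deliver_map P out (fun l => l.drop 1) (by simp)]
      rw [← List.map_append]
      congr 1
      cases deliver P out v i <;> simp
    rw [hr]
    refine Exec.step (fun v i => ((out v i).take 1).map f) (fun v x =>
      (xchg f m fun i => (out v i).drop 1).bind fun y => .ret fun i => x i ++ y i) ?_ hb
    intro v i
    refine ⟨by simp; omega, fun x hx => ?_⟩
    obtain ⟨y, hy, rfl⟩ := List.mem_map.1 hx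
    exact hf v i y (List.mem_of_mem_take hy)

/-- Repeat `N` times: send messages that depend on the state, and update the state. -/
def iter {X : Type} (f : ℕ → ℕ) (m : ℕ) (out : X → ℕ → List ℕ) (upd : X → Inbox → X) :
    ℕ → X → Prog X
  | 0, x => .ret x
  | N + 1, x => (xchg f m (out x)).bind fun y => iter f m out upd N (upd x y)

/-- The effect of one repetition in `iter` on the states of all vertices. -/
def stepAll {X : Type} (P : PortNumbering G) (f : ℕ → ℕ) (m : ℕ) (out : V → X → ℕ → List ℕ)
    (upd : V → X → Inbox → X) (x : V → X) (v : V) : X :=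
  upd v (x v) (recvd P f m (fun u => out u (x u)) v)

/-- Only states that really occur have to send small words. `maxFlood` sends unmodified words and
needs this, while the token floods and relays satisfy it for free through a truncating `f`. -/
theorem exec_iter {X : Type} (hC : 1 ≤ C) (f : ℕ → ℕ) (m : ℕ) (out : V → X → ℕ → List ℕ)
    (upd : V → X → Inbox → X) (N : ℕ) (x : V → X)
    (hf : ∀ t v i, ∀ y ∈ out v ((stepAll P f m out upd)^[t] x v) i,
      IsWord C (Fintype.card V) (f y)) :
    Exec P C (fun v => iter f m (out v) (upd v) N (x v)) (N * m)
      ((stepAll P f m out upd)^[N] x) := by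
  induction N generalizing x with
  | zero => simpa [iter] using Exec.ret (P := P) (C := C) x
  | succ N ih =>
    have h1 := exec_xchg (P := P) hC f m (fun v => out v (x v)) fun v i y hy => hf 0 v i y hy
    have h2 := ih (stepAll P f m out upd x) fun t v i y hy => hf (t + 1) v i y hy
    rw [Nat.succ_mul, Nat.add_comm (N * m)]
    exact h1.bind (f := fun v y => iter f m (out v) (upd v) N (upd v (x v) y)) h2

end Lockstep

/-! ### Flooding: maxima in balls, and pipelined broadcast. -/

section Flooding

theorem exists_adj_dist_le {V : Type} {G : SimpleGraph V} (hG : G.Connected) {u v : V} {d : ℕ} (h : G.dist v u ≤ d + 1)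
    (hne : v ≠ u) : ∃ w, G.Adj v w ∧ G.dist w u ≤ d := by
  obtain ⟨p, hp⟩ := hG.exists_walk_length_eq_dist v u
  cases p with
  | nil => exact absurd rfl hne
  | cons hadj q =>
    refine ⟨_, hadj, (SimpleGraph.dist_le q).trans ?_⟩
    rw [SimpleGraph.Walk.length_cons] at hp
    omega

theorem dist_le_succ_of_adj {V : Type} {G : SimpleGraph V} (hG : G.Connected) {u v w : V} {d : ℕ} (h : G.Adj v w)
    (hd : G.dist w u ≤ d) : G.dist v u ≤ d + 1 := by
  have h1 := hG.dist_triangle (u := v) (v := w) (w := u)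
  rw [SimpleGraph.dist_eq_one_iff_adj.2 h] at h1
  omega

variable {V : Type} [Fintype V] {G : SimpleGraph V} [DecidableRel G.Adj]

theorem recvd_nbr (P : PortNumbering G) (f : ℕ → ℕ) (m : ℕ) (out : V → ℕ → List ℕ) (v : V)
    (i : Fin (G.degree v)) :
    recvd P f m out v i =
      ((out (P.nbr v i) (P.port (P.nbr v i) v (P.nbr v i).2.symm)).take m).map f := by
  unfold recvd deliver
  rw [dif_pos i.2]

theorem recvd_port (P : PortNumbering G) (f : ℕ → ℕ) (m : ℕ) (out : V → ℕ → List ℕ) {v u : V}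
    (h : G.Adj v u) :
    recvd P f m out v (P.port v u h) = ((out u (P.port u v h.symm)).take m).map f := by
  have hu : P.nbr v (P.port v u h) = ⟨u, h⟩ := by simp [PortNumbering.port]
  have key : ∀ x : G.neighborSet v, x = ⟨u, h⟩ →
      out x (P.port x v x.2.symm) = out u (P.port u v h.symm) := by
    rintro _ rfl
    rfl
  rw [recvd_nbr, key _ hu]

/-! ### The maximum in a ball -/

/-- The largest of the numbers received through the first `d` ports. -/
def inboxSup (d : ℕ) (y : Inbox) : ℕ := (Finset.range d).sup fun i => (y i).headI

/-- Compute the maximum of the values `x` in the ball of radius `r`. -/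
def maxFlood (d r x : ℕ) : Prog ℕ :=
  iter id 1 (fun a _ => [a]) (fun a y => max a (inboxSup d y)) r x

/-- The results of `maxFlood`. -/
def maxAll (P : PortNumbering G) (r : ℕ) (x : V → ℕ) : V → ℕ :=
  (stepAll P id 1 (fun _ a _ => [a]) fun v a y => max a (inboxSup (G.degree v) y))^[r] x

theorem maxAll_succ (P : PortNumbering G) (r : ℕ) (x : V → ℕ) (v : V) :
    maxAll P (r + 1) x v = max (maxAll P r x v)
      ((Finset.range (G.degree v)).sup fun i =>
        (recvd P id 1 (fun u _ => [maxAll P r x u]) v i).headI) := by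
  unfold maxAll
  rw [Function.iterate_succ_apply']
  rfl

theorem le_maxAll (hG : G.Connected) (P : PortNumbering G) (r : ℕ) (x : V → ℕ) (v u : V)
    (h : G.dist v u ≤ r) : x u ≤ maxAll P r x v := by
  induction r generalizing v with
  | zero =>
    obtain rfl : v = u := hG.dist_eq_zero_iff.1 (by omega)
    exact le_rfl
  | succ r ih =>
    rw [maxAll_succ]
    by_cases hne : v = u
    · subst hne
      exact le_max_of_le_left (ih v (by simp))
    · obtain ⟨w, hw, hd⟩ := exists_adj_dist_le hG h hne
      refine le_max_of_le_right ((ih w hd).trans ?_)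
      have := Finset.le_sup (f := fun i =>
        (recvd P id 1 (fun u _ => [maxAll P r x u]) v i).headI)
        (Finset.mem_range.2 (P.port v w hw).2)
      simpa [recvd_port] using this

/-- No new values arise. This bounds the messages and, for distinct names, locates a vertex within
distance `r` that holds the maximum. -/
theorem maxAll_eq (hG : G.Connected) (P : PortNumbering G) (r : ℕ) (x : V → ℕ) (v : V) :
    ∃ u, G.dist v u ≤ r ∧ maxAll P r x v = x u := by
  induction r generalizing v with
  | zero => exact ⟨v, by simp, rfl⟩
  | succ r ih =>
    rw [maxAll_succ]
    obtain ⟨u, hu, he⟩ := ih v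
    rcases le_total ((Finset.range (G.degree v)).sup fun i =>
        (recvd P id 1 (fun u _ => [maxAll P r x u]) v i).headI) (maxAll P r x v) with h | h
    · exact ⟨u, by omega, by rw [max_eq_left h, he]⟩
    · rw [max_eq_right h]
      by_cases hd : (Finset.range (G.degree v)).Nonempty
      · obtain ⟨i, hi, hie⟩ := Finset.exists_mem_eq_sup _ hd fun i =>
          (recvd P id 1 (fun u _ => [maxAll P r x u]) v i).headI
        have hi' := Finset.mem_range.1 hi
        have hr := recvd_nbr P id 1 (fun u _ => [maxAll P r x u]) v ⟨i, hi'⟩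
        simp only [List.take_succ_cons, List.take_zero, List.map_cons, id, List.map_nil] at hr
        obtain ⟨w, hw, hwe⟩ := ih (P.nbr v ⟨i, hi'⟩)
        refine ⟨w, dist_le_succ_of_adj hG (P.nbr v ⟨i, hi'⟩).2 hw, ?_⟩
        rw [hie, hr, List.headI_cons, hwe]
      -- Without ports the supremum is `0`; being at least the value already held, it equals that
      -- value.
      · rw [Finset.not_nonempty_iff_eq_empty] at hd
        rw [hd, Finset.sup_empty] at h ⊢
        exact ⟨u, by omega, (le_bot_iff.1 h).symm.trans he⟩

theorem exec_maxFlood (hG : G.Connected) (P : PortNumbering G) {C : ℕ} (hC : 1 ≤ C) (r : ℕ)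
    (x : V → ℕ) (hx : ∀ v, IsWord C (Fintype.card V) (x v)) :
    Exec P C (fun v => maxFlood (G.degree v) r (x v)) r (maxAll P r x) := by
  have := exec_iter (P := P) hC id 1 (fun _ a _ => [a])
    (fun v a y => max a (inboxSup (G.degree v) y)) r x ?_
  · rw [mul_one] at this
    exact this
  · intro t v i y hy
    obtain ⟨u, -, hu⟩ := maxAll_eq hG P t x v
    rw [List.mem_singleton.1 hy]
    change IsWord C _ (maxAll P t x v)
    rw [hu]
    exact hx u

/-! ### Broadcasting a set of tokens -/

open Classical in
/-- A token that is known but has not been sent, or `[]` if there is none. -/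
noncomputable def nextToken (s : Finset (List ℕ) × Finset (List ℕ)) : List ℕ :=
  if h : (s.1 \ s.2).Nonempty then h.choose else []

/-- Update the sets of the known tokens and of those that have been sent. -/
noncomputable def tokenUpd (d : ℕ) (s : Finset (List ℕ) × Finset (List ℕ)) (y : Inbox) :
    Finset (List ℕ) × Finset (List ℕ) :=
  (s.1 ∪ ((Finset.range d).image y).erase [], (insert (nextToken s) s.2).erase [])

/-- Every vertex sends, in each of `N` repetitions, some token that it knows and has not sent. -/
noncomputable def tokenFlood (f : ℕ → ℕ) (m d N : ℕ) (init : Finset (List ℕ)) :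
    Prog (Finset (List ℕ)) :=
  (iter f m (fun s _ => nextToken s) (tokenUpd d) N (init, ∅)).bind fun s => .ret s.1

/-- The states of all vertices in the course of `tokenFlood`. -/
noncomputable def tokenState (P : PortNumbering G) (f : ℕ → ℕ) (m : ℕ)
    (init : V → Finset (List ℕ)) (t : ℕ) : V → Finset (List ℕ) × Finset (List ℕ) :=
  (stepAll P f m (fun _ s _ => nextToken s) fun v => tokenUpd (G.degree v))^[t]
    fun v => (init v, ∅)

theorem exec_tokenFlood (P : PortNumbering G) {C : ℕ} (hC : 1 ≤ C) {f : ℕ → ℕ}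
    (hf : ∀ x, IsWord C (Fintype.card V) (f x)) (m N : ℕ) (init : V → Finset (List ℕ)) :
    Exec P C (fun v => tokenFlood f m (G.degree v) N (init v)) (N * m)
      fun v => (tokenState P f m init N v).1 := by
  have h := exec_iter (P := P) hC f m (fun _ s _ => nextToken s)
    (fun v => tokenUpd (G.degree v)) N (fun v => (init v, ∅)) fun _ _ _ _ _ => hf _
  exact h.bind (f := fun _ s => .ret s.1) (Exec.ret _)

theorem nextToken_mem {s : Finset (List ℕ) × Finset (List ℕ)} (h : (s.1 \ s.2).Nonempty) :
    nextToken s ∈ s.1 \ s.2 := by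
  unfold nextToken
  rw [dif_pos h]
  exact h.choose_spec

theorem nextToken_eq_nil {s : Finset (List ℕ) × Finset (List ℕ)} (h : ¬ (s.1 \ s.2).Nonempty) :
    nextToken s = [] := by
  unfold nextToken
  rw [dif_neg h]

section Broadcast

variable {P : PortNumbering G} {f : ℕ → ℕ} {m : ℕ} {init : V → Finset (List ℕ)}

theorem tokenState_succ (t : ℕ) (v : V) :
    tokenState P f m init (t + 1) v = tokenUpd (G.degree v) (tokenState P f m init t v)
      (recvd P f m (fun u _ => nextToken (tokenState P f m init t u)) v) := by
  unfold tokenState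
  rw [Function.iterate_succ_apply']
  rfl

/-- All tokens are nonempty messages that are transmitted faithfully. -/
def GoodTokens (f : ℕ → ℕ) (m : ℕ) (init : V → Finset (List ℕ)) : Prop :=
  ∀ v, ∀ q ∈ init v, q ≠ [] ∧ (q.take m).map f = q

theorem known_mono (t : ℕ) (v : V) :
    (tokenState P f m init t v).1 ⊆ (tokenState P f m init (t + 1) v).1 := by
  rw [tokenState_succ]
  exact Finset.subset_union_left

theorem init_subset_known (t : ℕ) (v : V) : init v ⊆ (tokenState P f m init t v).1 := by
  induction t with
  | zero => exact Finset.Subset.refl _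
  | succ t ih => exact ih.trans (known_mono t v)

/-- Tokens are transmitted faithfully, and the empty list, which stands for silence, is erased on
arrival, so nothing is corrupted or invented. -/
theorem known_subset (hg : GoodTokens f m init) (t : ℕ) (v : V) :
    (∀ q ∈ (tokenState P f m init t v).1, ∃ u, q ∈ init u) ∧
      (tokenState P f m init t v).2 ⊆ (tokenState P f m init t v).1 := by
  induction t generalizing v with
  | zero => exact ⟨fun q hq => ⟨v, hq⟩, Finset.empty_subset _⟩
  | succ t ih =>
    rw [tokenState_succ]
    constructor
    · intro q hq
      rcases Finset.mem_union.1 hq with hq | hq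
      · exact (ih v).1 q hq
      · obtain ⟨hq0, hq⟩ := Finset.mem_erase.1 hq
        obtain ⟨i, hi, rfl⟩ := Finset.mem_image.1 hq
        have hr := recvd_nbr P f m (fun u _ => nextToken (tokenState P f m init t u)) v
          ⟨i, Finset.mem_range.1 hi⟩
        set u := (P.nbr v ⟨i, Finset.mem_range.1 hi⟩ : V)
        by_cases hne : ((tokenState P f m init t u).1 \ (tokenState P f m init t u).2).Nonempty
        · obtain ⟨w, hw⟩ := (ih u).1 _ (Finset.mem_sdiff.1 (nextToken_mem hne)).1
          refine ⟨w, ?_⟩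
          rw [hr, (hg w _ hw).2]
          exact hw
        · rw [hr, nextToken_eq_nil hne] at hq0
          simp at hq0
    · intro q hq
      obtain ⟨hq0, hq⟩ := Finset.mem_erase.1 hq
      refine Finset.mem_union_left _ ?_
      rcases Finset.mem_insert.1 hq with rfl | hq
      · by_cases hne : ((tokenState P f m init t v).1 \ (tokenState P f m init t v).2).Nonempty
        · exact (Finset.mem_sdiff.1 (nextToken_mem hne)).1
        · exact absurd (nextToken_eq_nil hne) hq0
      · exact (ih v).2 hq

theorem nil_notMem_known (hg : GoodTokens f m init) (t : ℕ) (v : V) :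
    [] ∉ (tokenState P f m init t v).1 := fun h => by
  obtain ⟨u, hu⟩ := (known_subset hg t v).1 _ h
  exact (hg u _ hu).1 rfl

theorem sent_mono (hg : GoodTokens f m init) (t : ℕ) (v : V) :
    (tokenState P f m init t v).2 ⊆ (tokenState P f m init (t + 1) v).2 := by
  intro q hq
  rw [tokenState_succ]
  refine Finset.mem_erase.2 ⟨fun h => ?_, Finset.mem_insert_of_mem hq⟩
  subst h
  exact nil_notMem_known hg t v ((known_subset hg t v).2 hq)

theorem sent_subset_known (hg : GoodTokens f m init) (t : ℕ) {v u : V} (h : G.Adj v u) :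
    (tokenState P f m init t u).2 ⊆ (tokenState P f m init t v).1 := by
  induction t with
  | zero => exact Finset.empty_subset _
  | succ t ih =>
    intro q hq
    rw [tokenState_succ] at hq
    obtain ⟨hq0, hq⟩ := Finset.mem_erase.1 hq
    rcases Finset.mem_insert.1 hq with rfl | hq
    · rw [tokenState_succ]
      refine Finset.mem_union_right _ (Finset.mem_erase.2 ⟨hq0, Finset.mem_image.2
        ⟨P.port v u h, Finset.mem_range.2 (P.port v u h).2, ?_⟩⟩)
      rw [recvd_port]
      by_cases hne : ((tokenState P f m init t u).1 \ (tokenState P f m init t u).2).Nonempty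
      · obtain ⟨w, hw⟩ := (known_subset hg t u).1 _ (Finset.mem_sdiff.1 (nextToken_mem hne)).1
        exact (hg w _ hw).2
      · exact absurd (nextToken_eq_nil hne) hq0
    · exact known_mono t v (ih hq)

theorem card_sent_succ (hg : GoodTokens f m init) (t : ℕ) (v : V)
    (hne : ((tokenState P f m init t v).1 \ (tokenState P f m init t v).2).Nonempty) :
    (tokenState P f m init (t + 1) v).2.card = (tokenState P f m init t v).2.card + 1 := by
  have hmem := Finset.mem_sdiff.1 (nextToken_mem hne)
  have hnil : [] ∉ insert (nextToken (tokenState P f m init t v))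
      (tokenState P f m init t v).2 := by
    intro h
    refine nil_notMem_known hg t v (P := P) ?_
    rcases Finset.mem_insert.1 h with h | h
    · rw [h]
      exact hmem.1
    · exact (known_subset hg t v).2 h
  rw [tokenState_succ]
  change ((insert (nextToken (tokenState P f m init t v))
      (tokenState P f m init t v).2).erase []).card = _
  rw [Finset.erase_eq_of_notMem hnil, Finset.card_insert_of_notMem hmem.2]

/-- The pipelining argument: tokens at distance `d` can be delayed beyond `d` repetitions only by
other tokens, each of which costs one repetition and becomes known in passing. -/
theorem broadcast_progress (hG : G.Connected) (hg : GoodTokens f m init) (d t : ℕ) (v : V)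
    (hdt : d ≤ t) :
    t + 1 ≤ d + (tokenState P f m init t v).1.card ∨
      ∀ u, G.dist v u ≤ d → init u ⊆ (tokenState P f m init t v).1 := by
  induction d generalizing t v with
  | zero =>
    refine Or.inr fun u hu => ?_
    obtain rfl : v = u := hG.dist_eq_zero_iff.1 (by omega)
    exact init_subset_known t v
  | succ d ih =>
    -- The same dichotomy for the tokens already sent. As long as `u` has an unsent token, its count
    -- grows with `t`; otherwise sent and known tokens coincide and the induction hypothesis
    -- applies.
    have key : ∀ u t, d ≤ t → t ≤ d + (tokenState P f m init t u).2.card ∨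
        ∀ w, G.dist u w ≤ d → init w ⊆ (tokenState P f m init t u).2 := by
      intro u t ht
      induction t, ht using Nat.le_induction with
      | base => exact Or.inl (by omega)
      | succ t ht iht =>
        have hmono := sent_mono (P := P) hg t u
        by_cases hne : ((tokenState P f m init t u).1 \ (tokenState P f m init t u).2).Nonempty
        · rcases iht with h | h
          · left
            rw [card_sent_succ hg t u hne]
            omega
          · exact Or.inr fun w hw => (h w hw).trans hmono
        · have hsub : (tokenState P f m init t u).1 ⊆ (tokenState P f m init t u).2 := by
            rwa [Finset.not_nonempty_iff_eq_empty, Finset.sdiff_eq_empty_iff_subset] at hne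
          rcases ih t u ht with h | h
          · left
            have := Finset.card_le_card (hsub.trans hmono)
            omega
          · exact Or.inr fun w hw => (h w hw).trans (hsub.trans hmono)
    -- One busy neighbour supplies enough tokens; if there is none, every neighbour has already sent
    -- everything from its ball of radius `d`.
    by_cases hex : ∃ u, G.Adj v u ∧ t ≤ d + (tokenState P f m init t u).2.card
    · obtain ⟨u, hu, hcard⟩ := hex
      left
      have := Finset.card_le_card (sent_subset_known (P := P) hg t hu)
      omega
    · push Not at hex
      refine Or.inr fun u hu => ?_
      by_cases hne : v = u
      · subst hne
        exact init_subset_known t v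
      · obtain ⟨w, hw, hd⟩ := exists_adj_dist_le hG hu hne
        rcases key w t (by omega) with h | h
        · exact absurd h (by have := hex w hw; omega)
        · exact (h u hd).trans (sent_subset_known hg t hw)

/-- After `K + R` repetitions, where `R` bounds all distances, a vertex knows all tokens, unless it
knows more than `K` of them. -/
theorem broadcast_complete (hG : G.Connected) (hg : GoodTokens f m init) {K R : ℕ}
    (hR : ∀ u v, G.dist u v ≤ R) (v : V) :
    K < (tokenState P f m init (K + R) v).1.card ∨
      (tokenState P f m init (K + R) v).1 = Finset.univ.biUnion init := by
  have hsub : (tokenState P f m init (K + R) v).1 ⊆ Finset.univ.biUnion init := fun q hq => by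
    obtain ⟨u, hu⟩ := (known_subset hg _ v).1 q hq
    exact Finset.mem_biUnion.2 ⟨u, Finset.mem_univ u, hu⟩
  rcases broadcast_progress (P := P) hG hg R (K + R) v (by omega) with h | h
  · left; omega
  · exact Or.inr (hsub.antisymm (Finset.biUnion_subset.2 fun u _ => h u (hR v u)))

end Broadcast

end Flooding

/-! ### Rooted subtrees of a graph -/

section RootedTree

variable {V : Type} {G : SimpleGraph V} {T : G.Subgraph} {z : V}

/-- Vertices outside `T` are isolated here, so a cycle stays inside `T.verts` and restricts to
`T.coe`. -/
theorem isAcyclic_spanningCoe (hT : T.coe.IsAcyclic) : T.spanningCoe.IsAcyclic := by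
  intro v w hw
  have hv : ∀ x ∈ w.support, x ∈ T.verts := by
    intro x hx
    obtain ⟨e, he, hxe⟩ := (SimpleGraph.Walk.mem_support_iff_exists_mem_edges_of_not_nil
      hw.not_nil).1 hx
    have := w.edges_subset_edgeSet he
    induction e with
    | _ a b =>
      have hab : T.Adj a b := this
      rcases Sym2.mem_iff.1 hxe with rfl | rfl
      · exact T.edge_vert hab
      · exact T.edge_vert hab.symm
  have hle : T.spanningCoe.induce T.verts = T.coe := by
    ext a b
    simp
  have hc : (w.induce T.verts hv).IsCycle := by
    rw [← SimpleGraph.Walk.isCycle_map_iff_of_injective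
      (f := (SimpleGraph.Embedding.induce (G := T.spanningCoe) T.verts).toHom)
      (SimpleGraph.Embedding.induce (G := T.spanningCoe) T.verts).injective]
    rwa [SimpleGraph.Walk.map_induce]
  rw [← hle] at hT
  exact hT _ hc

theorem reachable_spanningCoe (hT : T.coe.IsTree) {u v : V} (hu : u ∈ T.verts) (hv : v ∈ T.verts) :
    T.spanningCoe.Reachable u v :=
  (hT.connected.preconnected ⟨u, hu⟩ ⟨v, hv⟩).map T.coeEmbeddingSpanningCoe.toHom

/-- The distance from the root. -/
noncomputable def depth (T : G.Subgraph) (z v : V) : ℕ := T.spanningCoe.dist z v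

open Classical in
/-- The parent of `v` in the tree `T` rooted at `z`, or `v` itself if there is none. -/
noncomputable def par (T : G.Subgraph) (z v : V) : V :=
  if h : ∃ u, T.Adj v u ∧ depth T z u < depth T z v then h.choose else v

theorem par_root : par T z z = z := by
  unfold par
  rw [dif_neg]
  rintro ⟨u, -, hu⟩
  simp [depth] at hu

theorem par_of_notMem {v : V} (hv : v ∉ T.verts) : par T z v = v := by
  unfold par
  rw [dif_neg]
  rintro ⟨u, hu, -⟩
  exact hv (T.edge_vert hu)

theorem depth_eq_zero (hT : T.coe.IsTree) (hz : z ∈ T.verts) {v : V} (hv : v ∈ T.verts) :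
    depth T z v = 0 ↔ v = z := by
  unfold depth
  rw [(reachable_spanningCoe hT hz hv).dist_eq_zero_iff, eq_comm]

theorem par_spec (hT : T.coe.IsTree) (hz : z ∈ T.verts) {v : V} (hv : v ∈ T.verts) (hne : v ≠ z) :
    T.Adj v (par T z v) ∧ depth T z v = depth T z (par T z v) + 1 := by
  have hex : ∃ u, T.Adj v u ∧ depth T z u < depth T z v := by
    obtain ⟨p, hp⟩ := (reachable_spanningCoe hT hv hz).exists_walk_length_eq_dist
    cases p with
    | nil => exact absurd rfl hne
    | cons h q =>
      refine ⟨_, h, ?_⟩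
      unfold depth
      rw [SimpleGraph.dist_comm, SimpleGraph.dist_comm (u := z), ← hp]
      exact Nat.lt_succ_of_le (SimpleGraph.dist_le q)
  have hpar : par T z v = hex.choose := by
    unfold par
    rw [dif_pos hex]
  have h := hex.choose_spec
  rw [← hpar] at h
  refine ⟨h.1, ?_⟩
  rcases (isAcyclic_spanningCoe hT.isAcyclic).dist_eq_dist_add_one_of_adj_of_reachable z
    (show T.spanningCoe.Adj v (par T z v) from h.1) (reachable_spanningCoe hT hz hv) with h1 | h1
  · exact h1
  · have := h.2
    unfold depth at this
    omega

/-- Any neighbour of `v` closer to the root is the last but one vertex of the unique path from the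
root to `v`. -/
theorem eq_par (hT : T.coe.IsTree) (hz : z ∈ T.verts) {u v : V} (h : T.Adj v u)
    (hd : depth T z u < depth T z v) : u = par T z v := by
  have hv := T.edge_vert h
  have hne : v ≠ z := by
    rintro rfl
    simp [depth] at hd
  obtain ⟨h1, h2⟩ := par_spec hT hz hv hne
  have hac := isAcyclic_spanningCoe hT.isAcyclic
  obtain ⟨p, hp, hpl⟩ := (reachable_spanningCoe hT hz hv).exists_path_of_dist
  have key : ∀ w, T.Adj v w → depth T z w < depth T z v → w = p.penultimate := by
    intro w hw hwd
    obtain ⟨q, hq, hql⟩ := (reachable_spanningCoe hT hz (T.edge_vert hw.symm)).exists_path_of_dist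
    refine hac.eq_penultimate_of_adj_end hp hw
      (hac.mem_support_of_ne_mem_support_of_adj_of_isPath hp hq hw fun hmem => ?_)
    have hq' := congrArg SimpleGraph.Walk.length (hac.path_concat hp hq hw hmem)
    have hq'' := hq'.trans (p.length_concat (show T.spanningCoe.Adj v w from hw))
    unfold depth at hwd
    omega
  rw [key u h hd, key _ h1 (by omega)]

theorem par_mem (hT : T.coe.IsTree) (hz : z ∈ T.verts) {v : V} (hv : v ∈ T.verts) :
    par T z v ∈ T.verts := by
  by_cases h : v = z
  · subst h
    rwa [par_root]
  · exact T.edge_vert (par_spec hT hz hv h).1.symm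

theorem par_ne (hT : T.coe.IsTree) (hz : z ∈ T.verts) {v : V} :
    par T z v ≠ v ↔ v ∈ T.verts ∧ v ≠ z := by
  constructor
  · intro h
    refine ⟨?_, ?_⟩
    · by_contra h'
      exact h (par_of_notMem h')
    · rintro rfl
      exact h par_root
  · rintro ⟨hv, hne⟩
    exact (T.adj_sub (par_spec hT hz hv hne).1).ne'

theorem edgeRole_eq_toParent {v u : V} :
    edgeRole T z v u = .toParent ↔ T.Adj v u ∧ depth T z u < depth T z v := by
  unfold edgeRole depth
  split_ifs with h1 h2
  · simp [h1, h2]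
  · simp [h1, h2]
  · simp [h1]

theorem edgeRole_eq_toChild (hT : T.coe.IsTree) (hz : z ∈ T.verts) {v u : V} :
    edgeRole T z v u = .toChild ↔ T.Adj v u ∧ depth T z v < depth T z u := by
  by_cases h1 : T.Adj v u
  · have hne : depth T z v ≠ depth T z u :=
      (isAcyclic_spanningCoe hT.isAcyclic).dist_ne_of_adj h1
        (reachable_spanningCoe hT hz (T.edge_vert h1))
    unfold edgeRole depth at *
    split_ifs with h2
    · simp only [false_iff, not_and, not_lt]
      omega
    · simp only [true_iff]
      exact ⟨h1, by omega⟩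
  · simp [edgeRole, h1]

variable [Fintype V]

open Classical in
/-- The children of `v`. -/
noncomputable def children (T : G.Subgraph) (z v : V) : Finset V :=
  Finset.univ.filter fun c => par T z c = v ∧ c ≠ v

theorem mem_children {v c : V} : c ∈ children T z v ↔ par T z c = v ∧ c ≠ v := by
  simp [children]

theorem mem_children_iff_adj (hT : T.coe.IsTree) (hz : z ∈ T.verts) {v c : V} :
    c ∈ children T z v ↔ T.Adj v c ∧ depth T z v < depth T z c := by
  rw [mem_children]
  constructor
  · rintro ⟨rfl, hne⟩
    obtain ⟨hc, hcz⟩ := (par_ne hT hz).1 hne.symm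
    obtain ⟨h1, h2⟩ := par_spec hT hz hc hcz
    exact ⟨h1.symm, by omega⟩
  · rintro ⟨h1, h2⟩
    exact ⟨(eq_par hT hz h1.symm h2).symm, h1.adj_sub.ne'⟩

theorem of_mem_children (hT : T.coe.IsTree) (hz : z ∈ T.verts) {v c : V}
    (h : c ∈ children T z v) : c ∈ T.verts ∧ c ≠ z ∧ par T z c = v ∧ v ∈ T.verts := by
  obtain ⟨h1, h2⟩ := mem_children.1 h
  obtain ⟨hc, hcz⟩ := (par_ne hT hz).1 (fun h' => h2 (h'.symm.trans h1))
  exact ⟨hc, hcz, h1, h1 ▸ par_mem hT hz hc⟩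

theorem mem_children_par (hT : T.coe.IsTree) (hz : z ∈ T.verts) {v : V} (hv : v ∈ T.verts)
    (hne : v ≠ z) : v ∈ children T z (par T z v) :=
  mem_children.2 ⟨rfl, fun h => (par_ne hT hz).2 ⟨hv, hne⟩ h.symm⟩

variable [DecidableRel G.Adj] (P : PortNumbering G) (name : V → ℕ)

/-! ### The tree in the local input -/

open Classical in
/-- The port that leads to the parent. -/
noncomputable def parentPort (I : LocalInput) : ℕ :=
  if h : ∃ i a : ℕ, I.ports[i]? = some (a, EdgeRole.toParent) then h.choose else 0

open Classical in
/-- The ports that lead to the children. -/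
noncomputable def childPorts (I : LocalInput) : Finset ℕ :=
  (Finset.range I.ports.length).filter fun i => ∃ a : ℕ, I.ports[i]? = some (a, EdgeRole.toChild)

/-- The vertex is the root of the tree. -/
def LocalInput.IsRoot (I : LocalInput) : Prop :=
  I.inTree = true ∧ ¬ ∃ i a : ℕ, I.ports[i]? = some (a, EdgeRole.toParent)

/-- The port of the parent of `c` that leads to `c`. -/
noncomputable def childPort (T : G.Subgraph) (z c : V) : ℕ :=
  open Classical in if h : G.Adj (par T z c) c then P.port (par T z c) c h else 0

theorem childPort_eq {v c : V} (hT : T.coe.IsTree) (hz : z ∈ T.verts) (hc : c ∈ children T z v) :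
    ∃ h : G.Adj v c, childPort P T z c = P.port v c h := by
  have hadj := ((mem_children_iff_adj hT hz).1 hc).1.adj_sub
  obtain ⟨rfl, -⟩ := mem_children.1 hc
  exact ⟨hadj, by rw [childPort, dif_pos hadj]⟩

theorem getElem?_ports (v : V) (i : ℕ) (q : ℕ × EdgeRole) :
    (localInput P name T z v).ports[i]? = some q ↔ ∃ (u : V) (h : G.Adj v u),
      i = P.port v u h ∧ q = (name u, edgeRole T z v u) := by
  simp only [localInput, List.getElem?_ofFn]
  constructor
  · intro h
    split_ifs at h with hi
    refine ⟨P.nbr v ⟨i, hi⟩, (P.nbr v ⟨i, hi⟩).2, ?_, (Option.some_inj.1 h).symm⟩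
    simp [PortNumbering.port]
  · rintro ⟨u, h, rfl, rfl⟩
    rw [dif_pos (P.port v u h).2]
    simp [PortNumbering.port]

theorem length_ports (v : V) : (localInput P name T z v).ports.length = G.degree v := by
  simp [localInput]

theorem parentPort_eq (hT : T.coe.IsTree) (hz : z ∈ T.verts) {v : V} (hv : v ∈ T.verts)
    (hne : v ≠ z) : ∃ h : G.Adj v (par T z v),
      parentPort (localInput P name T z v) = P.port v (par T z v) h := by
  obtain ⟨h1, h2⟩ := par_spec hT hz hv hne
  have hex : ∃ i a : ℕ, (localInput P name T z v).ports[i]? = some (a, EdgeRole.toParent) :=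
    ⟨_, _, (getElem?_ports P name v _ _).2 ⟨_, h1.adj_sub, rfl, by
      rw [Prod.mk.injEq]
      exact ⟨rfl, (edgeRole_eq_toParent.2 ⟨h1, by omega⟩).symm⟩⟩⟩
  refine ⟨h1.adj_sub, ?_⟩
  unfold parentPort
  rw [dif_pos hex]
  obtain ⟨a, ha⟩ := hex.choose_spec
  obtain ⟨u, hu, hi, hq⟩ := (getElem?_ports P name v _ _).1 ha
  obtain ⟨h3, h4⟩ := edgeRole_eq_toParent.1 (Prod.mk.inj hq).2.symm
  obtain rfl := eq_par hT hz h3 h4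
  exact hi

theorem isRoot_iff (hT : T.coe.IsTree) (hz : z ∈ T.verts) {v : V} :
    (localInput P name T z v).IsRoot ↔ v = z := by
  constructor
  · rintro ⟨h1, h2⟩
    have hv : v ∈ T.verts := by simpa [localInput] using h1
    by_contra hne
    obtain ⟨h3, h4⟩ := par_spec hT hz hv hne
    exact h2 ⟨_, _, (getElem?_ports P name v _ _).2 ⟨_, h3.adj_sub, rfl, by
      rw [Prod.mk.injEq]
      exact ⟨rfl, (edgeRole_eq_toParent.2 ⟨h3, by omega⟩).symm⟩⟩⟩
  · rintro rfl
    refine ⟨by simpa [localInput] using hz, ?_⟩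
    rintro ⟨i, a, h⟩
    obtain ⟨u, hu, hi, hq⟩ := (getElem?_ports P name v _ _).1 h
    have := (edgeRole_eq_toParent.1 (Prod.mk.inj hq).2.symm).2
    simp [depth] at this

theorem childPorts_eq (hT : T.coe.IsTree) (hz : z ∈ T.verts) (v : V) :
    childPorts (localInput P name T z v) = (children T z v).image (childPort P T z) := by
  ext i
  simp only [childPorts, Finset.mem_filter, Finset.mem_image, Finset.mem_range]
  constructor
  · rintro ⟨-, a, h⟩
    obtain ⟨u, hu, hi, hq⟩ := (getElem?_ports P name v _ _).1 h
    have hc := (mem_children_iff_adj hT hz).2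
      ((edgeRole_eq_toChild hT hz).1 (Prod.mk.inj hq).2.symm)
    obtain ⟨h', he⟩ := childPort_eq P hT hz hc
    exact ⟨u, hc, by rw [he, hi]⟩
  · rintro ⟨c, hc, rfl⟩
    obtain ⟨h', he⟩ := childPort_eq P hT hz hc
    rw [he, length_ports]
    refine ⟨(P.port v c h').2, name c, (getElem?_ports P name v _ _).2 ⟨c, h', rfl, ?_⟩⟩
    rw [(edgeRole_eq_toChild hT hz).2 ((mem_children_iff_adj hT hz).1 hc)]

theorem port_inj {v u u' : V} {h : G.Adj v u} {h' : G.Adj v u'}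
    (he : (P.port v u h : ℕ) = P.port v u' h') : u = u' := by
  have := (P.nbr v).symm.injective (Fin.ext he)
  exact congrArg Subtype.val this

theorem childPort_injOn (hT : T.coe.IsTree) (hz : z ∈ T.verts) (v : V) :
    Set.InjOn (childPort P T z) (children T z v) := by
  intro c hc c' hc' he
  obtain ⟨h, h1⟩ := childPort_eq P hT hz hc
  obtain ⟨h', h2⟩ := childPort_eq P hT hz hc'
  rw [h1, h2] at he
  exact port_inj P he

theorem sum_childPorts (hT : T.coe.IsTree) (hz : z ∈ T.verts) (v : V) (g : ℕ → ℕ) :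
    ∑ i ∈ childPorts (localInput P name T z v), g i =
      ∑ c ∈ children T z v, g (childPort P T z c) := by
  rw [childPorts_eq P name hT hz, Finset.sum_image (childPort_injOn P hT hz v)]

theorem recvd_parentPort (hT : T.coe.IsTree) (hz : z ∈ T.verts) (f : ℕ → ℕ) (m : ℕ)
    (out : V → ℕ → List ℕ) {v : V} (hv : v ∈ T.verts) (hne : v ≠ z) :
    recvd P f m out v (parentPort (localInput P name T z v)) =
      ((out (par T z v) (childPort P T z v)).take m).map f := by
  obtain ⟨h, he⟩ := parentPort_eq P name hT hz hv hne
  have hc : v ∈ children T z (par T z v) := mem_children.2 ⟨rfl, h.ne⟩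
  obtain ⟨h', he'⟩ := childPort_eq P hT hz hc
  rw [he, he', recvd_port]

theorem recvd_childPort (hT : T.coe.IsTree) (hz : z ∈ T.verts) (f : ℕ → ℕ) (m : ℕ)
    (out : V → ℕ → List ℕ) {v c : V} (hc : c ∈ children T z v) :
    recvd P f m out v (childPort P T z c) =
      ((out c (parentPort (localInput P name T z c))).take m).map f := by
  obtain ⟨h, he⟩ := childPort_eq P hT hz hc
  obtain ⟨h1, h2, rfl, h4⟩ := of_mem_children hT hz hc
  obtain ⟨h', he'⟩ := parentPort_eq P name hT hz h1 h2
  rw [he, he', recvd_port]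

end RootedTree

/-! ### Addresses -/

/-- A way to describe a path down a tree: `none` stands for a step to the heavy child, and `some p`
for a step to another child, through port `p`. -/
abbrev Address := List (Option ℕ)

/-- The number of steps to children that are not heavy. -/
def lightCount (a : Address) : ℕ := a.countP Option.isSome

/-- Run-length encoding of the address that starts with `h` heavy steps. -/
def encodeAux : ℕ → Address → List ℕ
  | h, [] => [h]
  | h, none :: a => encodeAux (h + 1) a
  | h, some p :: a => h :: p :: encodeAux 0 a

/-- Run-length encoding of an address. -/
def encode (a : Address) : List ℕ := encodeAux 0 a

/-- The inverse of `encode`. -/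
def decode : List ℕ → Address
  | h :: p :: l => List.replicate h none ++ some p :: decode l
  | [h] => List.replicate h none
  | [] => []

theorem decode_encodeAux (h : ℕ) (a : Address) :
    decode (encodeAux h a) = List.replicate h none ++ a := by
  induction a generalizing h with
  | nil => simp [encodeAux, decode]
  | cons x a ih =>
    cases x with
    | none =>
      rw [encodeAux, ih, List.replicate_succ', List.append_assoc]
      rfl
    | some p => simp [encodeAux, decode, ih]

@[simp]
theorem decode_encode (a : Address) : decode (encode a) = a := by
  simp [encode, decode_encodeAux]

theorem length_encodeAux (h : ℕ) (a : Address) :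
    (encodeAux h a).length = 2 * lightCount a + 1 := by
  induction a generalizing h with
  | nil => simp [encodeAux, lightCount]
  | cons x a ih =>
    cases x with
    | none => rw [encodeAux, ih]; simp [lightCount]
    | some p => rw [encodeAux, List.length_cons, List.length_cons, ih]; simp [lightCount]; omega

theorem length_encode (a : Address) : (encode a).length = 2 * lightCount a + 1 :=
  length_encodeAux 0 a

theorem mem_encodeAux {h x : ℕ} {a : Address} (hx : x ∈ encodeAux h a) :
    x ≤ h + a.length ∨ some x ∈ a := by
  induction a generalizing h with
  | nil => left; simp [encodeAux] at hx; omega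
  | cons y a ih =>
    cases y with
    | none =>
      rcases ih hx with h1 | h1
      · left; simp; omega
      · right; exact List.mem_cons_of_mem _ h1
    | some p =>
      rcases List.mem_cons.1 hx with rfl | hx
      · left; omega
      rcases List.mem_cons.1 hx with rfl | hx
      · right; simp
      rcases ih hx with h1 | h1
      · left; simp; omega
      · right; exact List.mem_cons_of_mem _ h1

theorem mem_encode {x : ℕ} {a : Address} (hx : x ∈ encode a) : x ≤ a.length ∨ some x ∈ a := by
  simpa using mem_encodeAux hx

/-! ### Addresses of vertices: the prefix order is the ancestor order. -/

section RootedTree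

variable {V : Type} [Fintype V] {G : SimpleGraph V} [DecidableRel G.Adj] (P : PortNumbering G)
  (T : G.Subgraph) (z : V) (heavy : V → ℕ)

/-- The step from the parent of `c` to `c`, if `heavy v` is the port of `v` to its heavy child. -/
noncomputable def symbol (c : V) : Option ℕ :=
  if childPort P T z c = heavy (par T z c) then none else some (childPort P T z c)

/-- The last `k` steps from the root to `v`. -/
noncomputable def addressAux : ℕ → V → Address
  | 0, _ => []
  | k + 1, v => addressAux k (par T z v) ++ [symbol P T z heavy v]

/-- The path from the root to `v`. -/
noncomputable def address (v : V) : Address := addressAux P T z heavy (depth T z v) v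

variable {P T z heavy}

theorem address_of_ne (hT : T.coe.IsTree) (hz : z ∈ T.verts) {v : V} (hv : v ∈ T.verts)
    (hne : v ≠ z) : address P T z heavy v =
      address P T z heavy (par T z v) ++ [symbol P T z heavy v] := by
  unfold address
  rw [(par_spec hT hz hv hne).2]
  rfl

theorem address_root : address P T z heavy z = [] := by
  unfold address
  rw [show depth T z z = 0 by simp [depth]]
  rfl

theorem length_address (v : V) : (address P T z heavy v).length = depth T z v := by
  unfold address
  induction depth T z v generalizing v with
  | zero => rfl
  | succ k ih => simp [addressAux, ih]

theorem symbol_inj (hT : T.coe.IsTree) (hz : z ∈ T.verts) {v c c' : V} (hc : c ∈ children T z v)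
    (hc' : c' ∈ children T z v) (h : symbol P T z heavy c = symbol P T z heavy c') : c = c' := by
  have h1 := (mem_children.1 hc).1
  have h2 := (mem_children.1 hc').1
  refine childPort_injOn P hT hz v hc hc' ?_
  unfold symbol at h
  rw [h1, h2] at h
  split_ifs at h with h3 h4 h5
  · rw [h3, h4]
  · exact Option.some_inj.1 h

/-- Induct from the last step: equal addresses give equal parents, and siblings have different
symbols because they sit at different ports and only one port is heavy. -/
theorem address_inj (hT : T.coe.IsTree) (hz : z ∈ T.verts) {u v : V} (hu : u ∈ T.verts)
    (hv : v ∈ T.verts) (h : address P T z heavy u = address P T z heavy v) : u = v := by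
  induction hd : depth T z u generalizing u v with
  | zero =>
    have hd' := congrArg List.length h
    rw [length_address, length_address, hd] at hd'
    rw [(depth_eq_zero hT hz hu).1 hd, (depth_eq_zero hT hz hv).1 hd'.symm]
  | succ k ih =>
    have hd' := congrArg List.length h
    rw [length_address, length_address, hd] at hd'
    have hu0 : u ≠ z := fun h' => by
      rw [(depth_eq_zero hT hz hu).2 h'] at hd
      omega
    have hv0 : v ≠ z := fun h' => by
      rw [(depth_eq_zero hT hz hv).2 h'] at hd'
      omega
    rw [address_of_ne hT hz hu hu0, address_of_ne hT hz hv hv0] at h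
    obtain ⟨h1, h2⟩ := List.append_inj' h rfl
    have h3 := ih (par_mem hT hz hu) (par_mem hT hz hv) h1 (by
      have := (par_spec hT hz hu hu0).2
      omega)
    have h4 := mem_children_par hT hz hv hv0
    rw [← h3] at h4
    exact symbol_inj hT hz (mem_children_par hT hz hu hu0) h4 (List.singleton_inj.1 h2)

/-- The witness is the ancestor of `v` at depth `k`. -/
theorem exists_address_eq_take (hT : T.coe.IsTree) (hz : z ∈ T.verts) {v : V} (hv : v ∈ T.verts)
    {k : ℕ} (hk : k ≤ depth T z v) :
    ∃ w ∈ T.verts, address P T z heavy w = (address P T z heavy v).take k := by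
  induction hd : depth T z v - k generalizing v with
  | zero =>
    refine ⟨v, hv, (List.take_of_length_le ?_).symm⟩
    rw [length_address]
    omega
  | succ d ih =>
    have hne : v ≠ z := fun h' => by
      rw [(depth_eq_zero hT hz hv).2 h'] at hd
      omega
    have hp := (par_spec hT hz hv hne).2
    obtain ⟨w, hw, he⟩ := ih (par_mem hT hz hv) (by omega) (by omega)
    refine ⟨w, hw, ?_⟩
    rw [he, address_of_ne hT hz hv hne, List.take_append_of_le_length]
    rw [length_address]
    omega

/-- Take the ancestor of `v` one level below `u`; its parent has the address of `u`, hence is `u` by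
`address_inj`. -/
theorem exists_child_prefix (hT : T.coe.IsTree) (hz : z ∈ T.verts) {u v : V} (hu : u ∈ T.verts)
    (hv : v ∈ T.verts) (h : address P T z heavy u <+: address P T z heavy v) (hne : u ≠ v) :
    ∃ c ∈ children T z u, address P T z heavy c <+: address P T z heavy v := by
  have hlen := h.length_le
  have hlt : (address P T z heavy u).length < (address P T z heavy v).length := by
    refine lt_of_le_of_ne hlen fun he => hne (address_inj hT hz hu hv (h.eq_of_length he))
  rw [length_address, length_address] at hlt
  obtain ⟨c, hc, he⟩ := exists_address_eq_take (P := P) (heavy := heavy) hT hz hv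
    (k := depth T z u + 1) (by omega)
  have hcl := congrArg List.length he
  rw [length_address, List.length_take, length_address] at hcl
  have hcz : c ≠ z := fun h' => by
    rw [(depth_eq_zero hT hz hc).2 h'] at hcl
    omega
  have hpar : par T z c = u := by
    refine address_inj (P := P) (heavy := heavy) hT hz (par_mem hT hz hc) hu ?_
    have h1 : address P T z heavy (par T z c) <+: address P T z heavy v := by
      refine List.IsPrefix.trans ?_ (he ▸ List.take_prefix _ _)
      rw [address_of_ne hT hz hc hcz]
      exact List.prefix_append _ _
    refine (List.prefix_of_prefix_length_le h1 h ?_).eq_of_length ?_ <;>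
    · have := (par_spec hT hz hc hcz).2
      rw [length_address, length_address]
      omega
  exact ⟨c, hpar ▸ mem_children_par hT hz hc hcz, he ▸ List.take_prefix _ _⟩

end RootedTree

/-! ### The decision function -/

/-- A table consists of the port to the parent, the port to the heavy child, and the address of the
vertex; the label is the address of the destination. -/
def mkTable (pp h : ℕ) (a : Address) : List ℕ := pp :: h :: encode a

open Classical in
/-- Go to the parent, unless the destination is a descendant. -/
noncomputable def route (table label : List ℕ) : Option ℕ :=
  if decode (table.drop 2) = decode label then none
  else if decode (table.drop 2) <+: decode label then
    match (decode label)[(decode (table.drop 2)).length]? with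
    | some (some p) => some p
    | _ => table[1]?
  else table[0]?

theorem route_self (pp h : ℕ) (a : Address) : route (mkTable pp h a) (encode a) = none := by
  simp [route, mkTable]

theorem route_up {pp h : ℕ} {a b : Address} (hab : ¬ a <+: b) :
    route (mkTable pp h a) (encode b) = some pp := by
  have hne : a ≠ b := fun he => hab (he ▸ List.prefix_rfl)
  simp [route, mkTable, hab, hne]

theorem route_down {pp h : ℕ} {a b : Address} {x : Option ℕ} (hab : a ++ [x] <+: b) :
    route (mkTable pp h a) (encode b) = some (x.getD h) := by
  obtain ⟨l, rfl⟩ := hab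
  cases x <;> simp [route, mkTable]

/-! ### Correctness of routing -/

section Weights

variable {V : Type} {H : SimpleGraph V}

/-- Removing the detours from any walk leaves the unique path, with a sublist of its edges. -/
theorem walkWeight_le (hH : H.IsAcyclic) (w : Sym2 V → ℕ) {u v : V} {p : H.Walk u v}
    (hp : p.IsPath) (q : H.Walk u v) : walkWeight w p ≤ walkWeight w q := by
  classical
  have he : p = q.bypass :=
    congrArg Subtype.val ((hH.subsingleton_path u v).elim ⟨p, hp⟩ q.toPath)
  rw [he]
  exact (q.edges_bypass_sublist_edges.map w).sum_le_sum fun _ _ => Nat.zero_le _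

theorem walkWeight_le_wdist (hH : H.IsAcyclic) (w : Sym2 V → ℕ) {u v : V} {p : H.Walk u v}
    (hp : p.IsPath) : walkWeight w p ≤ wdist H w u v :=
  haveI : Nonempty (H.Walk u v) := ⟨p⟩
  le_ciInf fun q => walkWeight_le hH w hp q

end Weights

section Correctness

variable {V : Type} [Fintype V] {G : SimpleGraph V} [DecidableRel G.Adj] {P : PortNumbering G}
  {T : G.Subgraph} {z : V} {heavy : V → ℕ} {name : V → ℕ} {table label : V → List ℕ}

/-- The depth bound on the support is carried along to see that the walk never revisits its start.
-/
theorem exists_walk_down (hT : T.coe.IsTree) (hz : z ∈ T.verts)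
    (htable : ∀ v ∈ T.verts, table v =
      mkTable (parentPort (localInput P name T z v)) (heavy v) (address P T z heavy v))
    (hlabel : ∀ v ∈ T.verts, label v = encode (address P T z heavy v)) {u v : V}
    (hu : u ∈ T.verts) (hv : v ∈ T.verts)
    (h : address P T z heavy u <+: address P T z heavy v) :
    ∃ p : T.spanningCoe.Walk u v,
      Follows T.spanningCoe_le P (fun x => route (table x) (label v)) p ∧ p.IsPath ∧
        ∀ x ∈ p.support, address P T z heavy x <+: address P T z heavy v ∧
          depth T z u ≤ depth T z x := by
  induction hd : depth T z v - depth T z u generalizing u with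
  | zero =>
    have hlen := h.length_le
    have he := h.eq_of_length (by rw [length_address, length_address] at hlen ⊢; omega)
    obtain rfl := address_inj hT hz hu hv he
    refine ⟨.nil, ?_, .nil, by simp⟩
    change route (table u) (label u) = none
    rw [htable u hu, hlabel u hu, route_self]
  | succ d ih =>
    have hne : u ≠ v := by
      rintro rfl
      omega
    obtain ⟨c, hc, hpre⟩ := exists_child_prefix hT hz hu hv h hne
    obtain ⟨hcT, hcz, hpar, -⟩ := of_mem_children hT hz hc
    have hdc := (par_spec hT hz hcT hcz).2
    rw [hpar] at hdc
    obtain ⟨p, hp1, hp2, hp3⟩ := ih hcT hpre (by omega)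
    have hadj : T.spanningCoe.Adj u c := ((mem_children_iff_adj hT hz).1 hc).1
    refine ⟨.cons hadj p, ⟨?_, hp1⟩, hp2.cons fun hmem => ?_, ?_⟩
    · obtain ⟨h', hport⟩ := childPort_eq P hT hz hc
      rw [address_of_ne hT hz hcT hcz, hpar] at hpre
      change route (table u) (label v) = _
      rw [htable u hu, hlabel v hv, route_down hpre, ← hport, symbol, hpar]
      split_ifs with hh
      · rw [hh, Option.getD_none]
      · rw [Option.getD_some]
    · have := (hp3 u hmem).2
      omega
    · intro x hx
      rw [SimpleGraph.Walk.support_cons, List.mem_cons] at hx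
      rcases hx with rfl | hx
      · exact ⟨h, le_rfl⟩
      · exact ⟨(hp3 x hx).1, by have := (hp3 x hx).2; omega⟩

/-- The statement about the support makes the induction work: a vertex that forwards upwards is not
an ancestor of `v` and lies deeper than its parent, so the rest of the walk avoids it. -/
theorem exists_walk (hT : T.coe.IsTree) (hz : z ∈ T.verts)
    (htable : ∀ v ∈ T.verts, table v =
      mkTable (parentPort (localInput P name T z v)) (heavy v) (address P T z heavy v))
    (hlabel : ∀ v ∈ T.verts, label v = encode (address P T z heavy v)) {u v : V}
    (hu : u ∈ T.verts) (hv : v ∈ T.verts) :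
    ∃ p : T.spanningCoe.Walk u v,
      Follows T.spanningCoe_le P (fun x => route (table x) (label v)) p ∧ p.IsPath ∧
        ∀ x ∈ p.support, address P T z heavy x <+: address P T z heavy v ∨
          depth T z x ≤ depth T z u := by
  induction hd : depth T z u generalizing u with
  | zero =>
    obtain rfl := (depth_eq_zero hT hz hu).1 hd
    obtain ⟨p, hp1, hp2, hp3⟩ := exists_walk_down hT hz htable hlabel hu hv (by
      rw [address_root]
      exact List.nil_prefix)
    exact ⟨p, hp1, hp2, fun x hx => Or.inl (hp3 x hx).1⟩
  | succ d ih =>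
    by_cases h : address P T z heavy u <+: address P T z heavy v
    · obtain ⟨p, hp1, hp2, hp3⟩ := exists_walk_down hT hz htable hlabel hu hv h
      exact ⟨p, hp1, hp2, fun x hx => Or.inl (hp3 x hx).1⟩
    · have hne : u ≠ z := fun h' => by
        rw [(depth_eq_zero hT hz hu).2 h'] at hd
        omega
      obtain ⟨h1, h2⟩ := par_spec hT hz hu hne
      obtain ⟨p, hp1, hp2, hp3⟩ := ih (par_mem hT hz hu) (by omega)
      refine ⟨.cons h1 p, ⟨?_, hp1⟩, hp2.cons fun hmem => ?_, ?_⟩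
      · obtain ⟨h', hport⟩ := parentPort_eq P name hT hz hu hne
        change route (table u) (label v) = _
        rw [htable u hu, hlabel v hv, route_up h, hport]
      · rcases hp3 u hmem with h3 | h3
        · exact h h3
        · omega
      · intro x hx
        rcases List.mem_cons.1 hx with rfl | hx
        · right; omega
        · exact (hp3 x hx).imp_right fun h3 => by omega

theorem isRoutingScheme_of_address (hT : T.coe.IsTree) (hz : z ∈ T.verts) (w : Sym2 V → ℕ)
    (htable : ∀ v ∈ T.verts, table v =
      mkTable (parentPort (localInput P name T z v)) (heavy v) (address P T z heavy v))
    (hlabel : ∀ v ∈ T.verts, label v = encode (address P T z heavy v)) :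
    IsRoutingScheme P T w route table label 1 := by
  intro u hu v hv
  obtain ⟨p, hp1, hp2, -⟩ := exists_walk hT hz htable hlabel hu hv
  refine ⟨p, hp1, ?_⟩
  rw [one_mul]
  exact_mod_cast walkWeight_le_wdist (isAcyclic_spanningCoe hT.isAcyclic) w hp2

end Correctness

/-! ### Sums over subtrees -/

section Below

theorem rank_iterate_le {V : Type} {f : V → V} {rk : V → ℕ} (hrk : ∀ v, f v ≠ v → rk (f v) < rk v) (i : ℕ)
    (v : V) : rk (f^[i] v) ≤ rk v := by
  induction i with
  | zero => exact le_rfl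
  | succ i ih =>
    rw [Function.iterate_succ_apply']
    by_cases h : f (f^[i] v) = f^[i] v
    · rwa [h]
    · exact (hrk _ h).le.trans ih

variable {V : Type} [Fintype V]

open Classical in
/-- The vertices from which `v` is reached by iterating `f`. -/
noncomputable def below (f : V → V) (v : V) : Finset V :=
  Finset.univ.filter fun u => ∃ i, f^[i] u = v

theorem mem_below {f : V → V} {u v : V} : u ∈ below f v ↔ ∃ i, f^[i] u = v := by
  simp [below]

open Classical in
-- The rank forbids all cycles of `f` except fixed points, so the sets below distinct proper
-- preimages of `v` are disjoint. The lemma is applied to the tree, to the tree of fragments and to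
-- the tree cut at fragment roots.
theorem sum_below {f : V → V} {rk : V → ℕ} (hrk : ∀ v, f v ≠ v → rk (f v) < rk v) (x : V → ℕ)
    (v : V) : ∑ u ∈ below f v, x u =
      x v + ∑ c with f c = v ∧ c ≠ v, ∑ u ∈ below f c, x u := by
  have hrk' : ∀ {c v : V}, f c = v → c ≠ v → rk v < rk c := by
    rintro c _ rfl hne
    exact hrk c hne.symm
  have hdisj : Set.PairwiseDisjoint
      ((Finset.univ.filter fun c => f c = v ∧ c ≠ v : Finset V) : Set V) (below f) := by
    -- An orbit that leaves `c` for a different `c'` must pass through `v`, and from there the rank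
    -- can no longer climb back to `c'`.
    have key : ∀ c c' u i j, f c = v → f c' = v → c' ≠ v → f^[i] u = c → f^[j] u = c' → i ≤ j →
        c = c' := by
      intro c c' u i j hc hc' hne' hi hj hij
      obtain ⟨k, rfl⟩ := Nat.exists_eq_add_of_le hij
      rw [Nat.add_comm, Function.iterate_add_apply, hi] at hj
      cases k with
      | zero => exact hj
      | succ k =>
        rw [Function.iterate_succ_apply, hc] at hj
        have h1 := rank_iterate_le hrk k v
        rw [hj] at h1
        have := hrk' hc' hne'
        omega
    intro c hc c' hc' hne
    refine Finset.disjoint_left.2 fun u hu hu' => hne ?_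
    simp only [Finset.coe_filter, Finset.mem_univ, true_and, Set.mem_ofPred_eq] at hc hc'
    obtain ⟨i, hi⟩ := mem_below.1 hu
    obtain ⟨j, hj⟩ := mem_below.1 hu'
    rcases le_total i j with hij | hij
    · exact key c c' u i j hc.1 hc'.1 hc'.2 hi hj hij
    · exact (key c' c u j i hc'.1 hc.1 hc.2 hj hi hij).symm
  have hunion : below f v = insert v
      ((Finset.univ.filter fun c => f c = v ∧ c ≠ v).biUnion (below f)) := by
    ext u
    rw [Finset.mem_insert, Finset.mem_biUnion, mem_below]
    constructor
    · rintro ⟨i, hi⟩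
      induction i generalizing v with
      | zero => exact Or.inl hi
      | succ i _ =>
        -- At the first visit to `v`, the preceding point of the orbit is a preimage different from
        -- `v`.
        by_cases hex : ∃ k, f^[k] u = v ∧ ∀ l < k, f^[l] u ≠ v
        · obtain ⟨k, hk, hl⟩ := hex
          cases k with
          | zero => exact Or.inl hk
          | succ k =>
            rw [Function.iterate_succ_apply'] at hk
            exact Or.inr ⟨f^[k] u, Finset.mem_filter.2 ⟨Finset.mem_univ _, hk, hl k k.lt_succ_self⟩,
              mem_below.2 ⟨k, rfl⟩⟩
        · exact absurd ⟨Nat.find ⟨_, hi⟩, Nat.find_spec (⟨_, hi⟩ : ∃ k, f^[k] u = v),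
            fun l hl => Nat.find_min (⟨_, hi⟩ : ∃ k, f^[k] u = v) hl⟩ hex
    · rintro (rfl | ⟨c, hc, hu⟩)
      · exact ⟨0, rfl⟩
      · obtain ⟨i, hi⟩ := mem_below.1 hu
        refine ⟨i + 1, ?_⟩
        rw [Function.iterate_succ_apply', hi]
        exact (Finset.mem_filter.1 hc).2.1
  rw [hunion, Finset.sum_insert, Finset.sum_biUnion hdisj]
  intro hmem
  obtain ⟨c, hc, hv⟩ := Finset.mem_biUnion.1 hmem
  obtain ⟨i, hi⟩ := mem_below.1 hv
  obtain ⟨-, h1, h2⟩ := Finset.mem_filter.1 hc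
  have h3 := rank_iterate_le hrk i v
  rw [hi] at h3
  have := hrk' h1 h2
  omega

end Below

/-! ### Fragments -/

section Fragments

variable {V : Type} {G : SimpleGraph V} {T : G.Subgraph} {z : V} {S : V → Prop}

/-- The number of steps from `v` up to the next vertex in `S`. -/
noncomputable def fragDepth (T : G.Subgraph) (z : V) (S : V → Prop) (v : V) : ℕ :=
  sInf {i | S ((par T z)^[i] v)}

/-- The next vertex in `S` on the path from `v` to the root. -/
noncomputable def frag (T : G.Subgraph) (z : V) (S : V → Prop) (v : V) : V :=
  (par T z)^[fragDepth T z S v] v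

theorem iterate_par_mem (hT : T.coe.IsTree) (hz : z ∈ T.verts) {v : V} (hv : v ∈ T.verts)
    (i : ℕ) : (par T z)^[i] v ∈ T.verts := by
  induction i with
  | zero => exact hv
  | succ i ih =>
    rw [Function.iterate_succ_apply']
    exact par_mem hT hz ih

theorem depth_iterate_par (hT : T.coe.IsTree) (hz : z ∈ T.verts) {v : V} (hv : v ∈ T.verts)
    (i : ℕ) : depth T z ((par T z)^[i] v) = depth T z v - i := by
  induction i with
  | zero => rfl
  | succ i ih =>
    rw [Function.iterate_succ_apply']
    by_cases h : (par T z)^[i] v = z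
    · rw [h, (depth_eq_zero hT hz hz).2 rfl] at ih
      rw [h, par_root, (depth_eq_zero hT hz hz).2 rfl]
      omega
    · have := (par_spec hT hz (iterate_par_mem hT hz hv i) h).2
      omega

theorem iterate_par_depth (hT : T.coe.IsTree) (hz : z ∈ T.verts) {v : V} (hv : v ∈ T.verts) :
    (par T z)^[depth T z v] v = z := by
  rw [← depth_eq_zero hT hz (iterate_par_mem hT hz hv _), depth_iterate_par hT hz hv]
  omega

theorem exists_iterate_mem (hT : T.coe.IsTree) (hz : z ∈ T.verts) (hS : S z) {v : V}
    (hv : v ∈ T.verts) : {i | S ((par T z)^[i] v)}.Nonempty :=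
  ⟨depth T z v, by
    rw [Set.mem_ofPred_eq, iterate_par_depth hT hz hv]
    exact hS⟩

theorem frag_prop (hT : T.coe.IsTree) (hz : z ∈ T.verts) (hS : S z) {v : V} (hv : v ∈ T.verts) :
    S (frag T z S v) :=
  Nat.sInf_mem (exists_iterate_mem hT hz hS hv)

theorem fragDepth_of_mem {v : V} (h : S v) : fragDepth T z S v = 0 :=
  Nat.sInf_eq_zero.2 (Or.inl h)

theorem frag_of_mem {v : V} (h : S v) : frag T z S v = v := by
  rw [frag, fragDepth_of_mem h]
  rfl

theorem fragDepth_of_notMem (hT : T.coe.IsTree) (hz : z ∈ T.verts) (hS : S z) {v : V}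
    (hv : v ∈ T.verts) (h : ¬ S v) : fragDepth T z S v = fragDepth T z S (par T z v) + 1 := by
  have h1 := Nat.sInf_mem (exists_iterate_mem hT hz hS hv)
  have h2 := Nat.sInf_mem (exists_iterate_mem hT hz hS (par_mem hT hz hv))
  apply le_antisymm
  · exact Nat.sInf_le h2
  · rcases hk : fragDepth T z S v with _ | k
    · unfold fragDepth at hk
      rw [hk] at h1
      exact absurd h1 h
    · refine Nat.succ_le_succ (Nat.sInf_le ?_)
      unfold fragDepth at hk
      rw [hk] at h1
      exact h1

theorem frag_of_notMem (hT : T.coe.IsTree) (hz : z ∈ T.verts) (hS : S z) {v : V}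
    (hv : v ∈ T.verts) (h : ¬ S v) : frag T z S v = frag T z S (par T z v) := by
  rw [frag, fragDepth_of_notMem hT hz hS hv h]
  rfl

theorem depth_frag_le (hT : T.coe.IsTree) (hz : z ∈ T.verts) {v : V} (hv : v ∈ T.verts) :
    depth T z (frag T z S v) ≤ depth T z v := by
  rw [frag, depth_iterate_par hT hz hv]
  exact Nat.sub_le _ _

open Classical in
/-- The parent in the tree of the fragments. -/
noncomputable def fragPar (T : G.Subgraph) (z : V) (S : V → Prop) (y : V) : V :=
  if S y then frag T z S (par T z y) else y

theorem fragPar_of_mem {y : V} (h : S y) : fragPar T z S y = frag T z S (par T z y) := if_pos h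

theorem fragPar_root (hS : S z) : fragPar T z S z = z := by
  rw [fragPar_of_mem hS, par_root, frag_of_mem hS]

/-- Makes the depth in `T` a rank function for the tree of fragments. -/
theorem depth_fragPar_lt (hT : T.coe.IsTree) (hz : z ∈ T.verts) (hS : S z)
    (hST : ∀ v, S v → v ∈ T.verts) (y : V) (h : fragPar T z S y ≠ y) :
    depth T z (fragPar T z S y) < depth T z y := by
  have hy : S y := by
    by_contra hy
    exact h (if_neg hy)
  have hyz : y ≠ z := by
    rintro rfl
    exact h (fragPar_root hS)
  have h1 := (par_spec hT hz (hST y hy) hyz).2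
  have h2 := depth_frag_le (S := S) hT hz (par_mem hT hz (hST y hy))
  rw [fragPar_of_mem hy]
  omega

theorem depth_par_lt (hT : T.coe.IsTree) (hz : z ∈ T.verts) (v : V) (h : par T z v ≠ v) :
    depth T z (par T z v) < depth T z v := by
  obtain ⟨h1, h2⟩ := (par_ne hT hz).1 h
  have := (par_spec hT hz h1 h2).2
  omega

theorem tree_induction (hT : T.coe.IsTree) (hz : z ∈ T.verts) {p : V → Prop} (h0 : p z)
    (h1 : ∀ v ∈ T.verts, v ≠ z → p (par T z v) → p v) {v : V} (hv : v ∈ T.verts) : p v := by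
  induction hd : depth T z v generalizing v with
  | zero => rwa [(depth_eq_zero hT hz hv).1 hd]
  | succ d ih =>
    by_cases h : v = z
    · rwa [h]
    · have := (par_spec hT hz hv h).2
      exact h1 v hv h (ih (par_mem hT hz hv) (by omega))

variable [Fintype V]

theorem children_induction (hT : T.coe.IsTree) (hz : z ∈ T.verts) {p : V → Prop}
    (h : ∀ v ∈ T.verts, (∀ c ∈ children T z v, p c) → p v) {v : V} (hv : v ∈ T.verts) : p v := by
  have hle : ∀ v, depth T z v ≤ Finset.univ.sup (depth T z) := fun v =>
    Finset.le_sup (Finset.mem_univ v)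
  induction hd : Finset.univ.sup (depth T z) - depth T z v generalizing v with
  | zero =>
    refine h v hv fun c hc => ?_
    have h1 := ((mem_children_iff_adj hT hz).1 hc).2
    have := hle c
    omega
  | succ d ih =>
    refine h v hv fun c hc => ?_
    obtain ⟨h1, h2, rfl, -⟩ := of_mem_children hT hz hc
    have h3 := (par_spec hT hz h1 h2).2
    have := hle c
    exact ih h1 (by omega)

theorem depth_lt_card (hT : T.coe.IsTree) (hz : z ∈ T.verts) {v : V} (hv : v ∈ T.verts) :
    depth T z v < Fintype.card V := by
  obtain ⟨p, hp, hpl⟩ := (reachable_spanningCoe hT hz hv).exists_path_of_dist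
  unfold depth
  rw [← hpl]
  exact hp.length_lt

open Classical in
/-- A potential that is known at the roots of the fragments, and obeys a recursion elsewhere, is
superadditive. -/
theorem one_add_sum_children_le (hT : T.coe.IsTree) (hz : z ∈ T.verts) (hS : S z)
    {M : ℕ} (hM : Fintype.card V ≤ M) {s f : V → ℕ}
    (hs : ∀ y, S y → 1 + ∑ c with fragPar T z S c = y ∧ c ≠ y, s c ≤ s y)
    (hf : ∀ v ∈ T.verts, f v = if S v then M * s v else 1 + ∑ c ∈ children T z v, f c) {v : V}
    (hv : v ∈ T.verts) : 1 + ∑ c ∈ children T z v, f c ≤ f v := by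
  by_cases hSv : S v
  swap
  · rw [hf v hv, if_neg hSv]
  -- Every vertex other than `v` is charged `1`, and the root `u` of a child fragment additionally
  -- `M * s u`; summed over subtrees, these charges dominate `f` below `v`.
  set x : V → ℕ := fun u =>
    (if u = v then 0 else 1) + if fragPar T z S u = v ∧ u ≠ v then M * s u else 0 with hx
  set X : V → ℕ := fun u => ∑ w ∈ below (par T z) u, x w with hX
  have hXrec : ∀ u, X u = x u + ∑ c ∈ children T z u, X c := by
    intro u
    rw [hX]
    change ∑ w ∈ below (par T z) u, x w = _
    rw [sum_below (depth_par_lt hT hz)]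
    rfl
  -- The condition on `u` describes the vertices of the fragment of `v` other than `v`, together
  -- with the roots of its child fragments, where the induction stops.
  have hle : ∀ u ∈ T.verts, u ≠ z → frag T z S (par T z u) = v → f u ≤ X u := by
    intro u hu
    refine children_induction hT hz (p := fun u => u ≠ z → frag T z S (par T z u) = v → f u ≤ X u)
      (fun u hu ih huz hfu => ?_) hu
    rw [hf u hu, hXrec]
    have huv : u ≠ v := by
      rintro rfl
      have h1 := depth_frag_le (S := S) hT hz (par_mem hT hz hu)
      have h2 := (par_spec hT hz hu huz).2
      rw [hfu] at h1
      omega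
    split_ifs with hSu
    · refine le_trans ?_ (Nat.le_add_right _ _)
      simp only [hx]
      rw [if_neg huv, if_pos ⟨(fragPar_of_mem hSu).trans hfu, huv⟩]
      exact Nat.le_add_left _ _
    · refine Nat.add_le_add ?_ (Finset.sum_le_sum fun c hc => ?_)
      · simp only [hx]
        rw [if_neg huv]
        exact Nat.le_add_right _ _
      · obtain ⟨-, h2, h3, -⟩ := of_mem_children hT hz hc
        refine ih c hc h2 ?_
        rw [h3, frag_of_notMem hT hz hS hu hSu, hfu]
  have h1 : ∑ c ∈ children T z v, f c ≤ ∑ c ∈ children T z v, X c := by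
    refine Finset.sum_le_sum fun c hc => ?_
    obtain ⟨h1, h2, h3, -⟩ := of_mem_children hT hz hc
    exact hle c h1 h2 (by rw [h3, frag_of_mem hSv])
  have h2 : ∑ c ∈ children T z v, X c ≤ X v := by
    rw [hXrec v]
    exact Nat.le_add_left _ _
  have h3 : X v ≤ ∑ u, x u := Finset.sum_le_sum_of_subset (Finset.subset_univ _)
  -- The total charge is `n - 1 + M * ∑ s`, while `M * s v` is at least `M + M * ∑ s`; the spare
  -- unit pays for `v` itself.
  have h4 : ∑ u, x u + 1 =
      Fintype.card V + M * ∑ c with fragPar T z S c = v ∧ c ≠ v, s c := by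
    simp only [hx]
    rw [Finset.sum_add_distrib, ← Finset.sum_filter, ← Finset.mul_sum, Nat.add_right_comm]
    congr 1
    have h5 : ∑ u : V, (if u = v then 0 else 1) + ∑ u : V, (if u = v then 1 else 0) =
        Fintype.card V := by
      rw [← Finset.sum_add_distrib, Finset.sum_congr rfl (g := fun _ => 1)]
      · simp
      · intro u _
        split_ifs <;> rfl
    rw [← h5]
    simp
  have h5 := Nat.mul_le_mul_left M (hs v hSv)
  rw [Nat.mul_add, mul_one] at h5
  rw [hf v hv, if_pos hSv]
  omega

variable [DecidableRel G.Adj] {P : PortNumbering G} {heavy : V → ℕ}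

/-- If the heavy children have the largest potential, then the number of light edges on the path to
the root is logarithmic. -/
theorem two_pow_lightCount_mul_le (hT : T.coe.IsTree) (hz : z ∈ T.verts) {f : V → ℕ}
    (hf : ∀ v ∈ T.verts, 1 + ∑ c ∈ children T z v, f c ≤ f v)
    (hheavy : ∀ v ∈ T.verts, ∀ c ∈ children T z v, ∃ c' ∈ children T z v,
      childPort P T z c' = heavy v ∧ f c ≤ f c') {v : V} (hv : v ∈ T.verts) :
    2 ^ lightCount (address P T z heavy v) * f v ≤ f z := by
  refine tree_induction hT hz
    (p := fun v => 2 ^ lightCount (address P T z heavy v) * f v ≤ f z) ?_ ?_ hv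
  · rw [address_root]
    simp [lightCount]
  · intro v hv hne ih
    have hc := mem_children_par hT hz hv hne
    have hp := par_mem hT hz hv
    have h1 := hf _ hp
    rw [address_of_ne hT hz hv hne, lightCount, List.countP_append, List.countP_singleton]
    change _ ≤ _ at ih
    rw [lightCount] at ih
    refine le_trans ?_ ih
    rw [pow_add, mul_assoc]
    refine Nat.mul_le_mul_left _ ?_
    have h2 := Finset.single_le_sum (f := f) (fun _ _ => Nat.zero_le _) hc
    unfold symbol
    split_ifs with h3 h4 h4
    · simp at h4
    · omega
    · obtain ⟨c', hc', h5, h6⟩ := hheavy _ hp v hc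
      have hne' : v ≠ c' := by
        rintro rfl
        exact h3 h5
      -- The heavy sibling `c'` has at least the potential of `v`, so the potential of the parent
      -- exceeds twice that of `v`.
      have h7 : f v + f c' ≤ ∑ c ∈ children T z (par T z v), f c := by
        classical
        rw [← Finset.sum_pair hne']
        refine Finset.sum_le_sum_of_subset fun w hw => ?_
        rcases Finset.mem_insert.1 hw with rfl | hw
        · exact hc
        · rwa [Finset.mem_singleton.1 hw]
      omega
    · simp at h4

end Fragments

/-! ### The algorithm -/

/-- Repeat `N` times: send messages that depend on what was received in the last repetition. -/
def relay (f : ℕ → ℕ) (m : ℕ) (out : Inbox → ℕ → List ℕ) (N : ℕ) : Prog Inbox :=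
  iter f m out (fun _ y => y) N fun _ => []

section LocalComputations

/-- The vertex is the root of the tree, or in the tree and sampled with probability `2 ^ (-j)`. -/
def Selected (I : LocalInput) (b : ℕ → Bool) (j : ℕ) : Prop :=
  I.inTree = true ∧ (I.IsRoot ∨ ∀ i < j, b i = true)

open Classical in
/-- The name of the root of the fragment, according to what the parent says. -/
noncomputable def fragName (I : LocalInput) (sel : Prop) (y : Inbox) : ℕ :=
  if sel then I.name else (y (parentPort I)).headI

open Classical in
/-- The name of the root of the fragment of the parent, according to what the parent says. -/
noncomputable def parentFragName (I : LocalInput) (y : Inbox) : ℕ :=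
  if I.IsRoot then I.name else (y (parentPort I)).headI

open Classical in
/-- The token that describes an edge of the tree of fragments, and carries the message `e`. -/
noncomputable def fragToken (I : LocalInput) (sel : Prop) (y : Inbox) (e : List ℕ) :
    Finset (List ℕ) :=
  if sel then {I.name :: parentFragName I y :: e} else ∅

/-- `s` is superadditive on the tree of fragments described by the tokens in `Q`. -/
def IsFragWeight (Q : Finset (List ℕ)) (s : ℕ → ℕ) : Prop :=
  ∀ q ∈ Q, 1 + ∑ q' ∈ Q with q'.tail.headI = q.headI ∧ q'.headI ≠ q.headI, s q'.headI ≤ s q.headI ∧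
    s q.headI ≤ Q.card

open Classical in
/-- Some superadditive function on the tree of fragments described by the tokens in `Q`. -/
noncomputable def fragWeight (Q : Finset (List ℕ)) : ℕ → ℕ :=
  if h : ∃ s, IsFragWeight Q s then h.choose else fun _ => 0

open Classical in
/-- The potential of a vertex, according to what the children say. -/
noncomputable def potential (I : LocalInput) (sel : Prop) (w : ℕ) (y : Inbox) : ℕ :=
  if sel then w else 1 + ∑ i ∈ childPorts I, (y i).headI

open Classical in
/-- A port to a child of largest potential. -/
noncomputable def heavyPort (I : LocalInput) (y : Inbox) : ℕ :=
  if h : (childPorts I).Nonempty then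
    (Finset.exists_max_image (childPorts I) (fun i => (y i).headI) h).choose
  else 0

open Classical in
/-- The path from the root of the fragment, according to what the parent says. -/
noncomputable def localAddress (I : LocalInput) (sel : Prop) (y : Inbox) : Address :=
  if sel then [] else decode (y (parentPort I))

/-- What to tell about their addresses to the children. -/
noncomputable def childAddress (I : LocalInput) (sel : Prop) (h : ℕ) (y : Inbox) (i : ℕ) :
    List ℕ :=
  encode (localAddress I sel y ++ [if i = h then none else some i])

open Classical in
/-- What the parent says, and nothing at the root. -/
noncomputable def fromParent (I : LocalInput) (y : Inbox) : List ℕ :=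
  if I.IsRoot then [] else y (parentPort I)

/-- `a` describes the addresses of the roots of fragments in accordance with the tokens in `Q`. -/
def IsFragAddress (Q : Finset (List ℕ)) (a : ℕ → Address) : Prop :=
  ∀ q ∈ Q, a q.headI =
    if q.headI = q.tail.headI then [] else a q.tail.headI ++ decode q.tail.tail

open Classical in
/-- The addresses of the roots of fragments. -/
noncomputable def fragAddress (Q : Finset (List ℕ)) : ℕ → Address :=
  if h : ∃ a, IsFragAddress Q a then h.choose else fun _ => []

/-- The address of a vertex. -/
noncomputable def fullAddress (I : LocalInput) (sel : Prop) (y₁ y₃ : Inbox)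
    (Q : Finset (List ℕ)) : Address :=
  fragAddress Q (fragName I sel y₁) ++ localAddress I sel y₃

end LocalComputations

/-- Compute tables and labels, if the vertices with `sel` cut the tree into fragments of depth at
most `K`, and there are at most `K` of them. -/
noncomputable def treePhase (f : ℕ → ℕ) (m M K R : ℕ) (I : LocalInput) (sel : Prop) :
    Prog (List ℕ × List ℕ) :=
  (relay f m (fun y _ => [fragName I sel y]) (K + 2)).bind fun y₁ =>
  (tokenFlood f m I.ports.length (K + R) (fragToken I sel y₁ [])).bind fun Q₁ =>
  (relay f m (fun y _ => [potential I sel (M * fragWeight Q₁ I.name) y]) (K + 2)).bind fun y₂ =>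
  (relay f m (childAddress I sel (heavyPort I y₂)) (K + 2)).bind fun y₃ =>
  (tokenFlood f m I.ports.length (K + R) (fragToken I sel y₁ (fromParent I y₃))).bind fun Q₂ =>
  .ret (mkTable (parentPort I) (heavyPort I y₂) (fullAddress I sel y₁ y₃ Q₂),
    encode (fullAddress I sel y₁ y₃ Q₂))

open Classical in
/-- Check that at most `K` vertices are selected, and compute tables and labels. -/
noncomputable def countPhase (f : ℕ → ℕ) (m M K R : ℕ) (I : LocalInput) (sel : Prop) :
    Prog (Option (List ℕ × List ℕ)) :=
  (tokenFlood f m I.ports.length (K + R) (if sel then {[I.name]} else ∅)).bind fun Q =>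
  if K < Q.card then .ret none else (treePhase f m M K R I sel).bind fun o => .ret (some o)

/-- Keep the last `4 * L` bits. -/
def clip (L x : ℕ) : ℕ := x % 2 ^ (4 * L)

/-- The number of selected vertices, and the depth of the fragments, that is admitted in phase
`j`. -/
def budget (q j L : ℕ) : ℕ := 2 ^ j * (q * L)

open Classical in
/-- Check that `2 ^ (j + 1)` bounds all distances, and continue with `countPhase`. -/
noncomputable def phase (q : ℕ) (I : LocalInput) (b : ℕ → Bool) (j : ℕ) :
    Prog (Option (List ℕ × List ℕ)) :=
  (maxFlood I.ports.length (2 ^ j) I.name).bind fun a =>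
  (xchg id 1 fun _ => [a]).bind fun y =>
  (maxFlood I.ports.length (2 * 2 ^ j)
    (if ∃ i < I.ports.length, y i ≠ [a] then 1 else 0)).bind fun bad =>
  if bad = 0 then
    countPhase (clip (lg (a + 1))) (8 * lg (a + 1)) (2 ^ lg (a + 1)) (budget q j (lg (a + 1)))
      (2 * 2 ^ j) I (Selected I b j)
  else .ret none

/-! ### Running the algorithm -/

section Run

variable {V : Type} [Fintype V] {G : SimpleGraph V} [DecidableRel G.Adj] (P : PortNumbering G)

/-- The results of `relay`. -/
def relayAll (f : ℕ → ℕ) (m : ℕ) (out : V → Inbox → ℕ → List ℕ) (N : ℕ) : V → Inbox :=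
  (stepAll P f m out fun _ _ y => y)^[N] fun _ _ => []

theorem relayAll_succ (f : ℕ → ℕ) (m : ℕ) (out : V → Inbox → ℕ → List ℕ) (N : ℕ) (v : V) :
    relayAll P f m out (N + 1) v = recvd P f m (fun u => out u (relayAll P f m out N u)) v := by
  unfold relayAll
  rw [Function.iterate_succ_apply']
  rfl

variable {C : ℕ}

theorem exec_relay (hC : 1 ≤ C) {f : ℕ → ℕ} (hf : ∀ x, IsWord C (Fintype.card V) (f x)) (m : ℕ)
    (out : V → Inbox → ℕ → List ℕ) (N : ℕ) :
    Exec P C (fun v => relay f m (out v) N) (N * m) (relayAll P f m out N) :=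
  exec_iter hC f m out (fun _ _ y => y) N (fun _ _ => []) fun _ _ _ _ _ => hf _

/-! ### Intermediate results and round counts of the computation of tables and labels. -/

section TreePhase

variable (f : ℕ → ℕ) (m M K R : ℕ) (inp : V → LocalInput) (sel : V → Prop)

/-- What is received last by `relay` in the first step of `treePhase`. -/
noncomputable def inbox₁ (N : ℕ) : V → Inbox :=
  relayAll P f m (fun v y _ => [fragName (inp v) (sel v) y]) N

/-- The tokens known after the second step of `treePhase`. -/
noncomputable def tokens₁ (v : V) : Finset (List ℕ) :=
  (tokenState P f m (fun v => fragToken (inp v) (sel v) (inbox₁ P f m inp sel (K + 2) v) [])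
    (K + R) v).1

/-- What is received last by `relay` in the third step of `treePhase`. -/
noncomputable def inbox₂ (N : ℕ) : V → Inbox :=
  relayAll P f m (fun v y _ => [potential (inp v) (sel v)
    (M * fragWeight (tokens₁ P f m K R inp sel v) (inp v).name) y]) N

/-- The ports to the heavy children. -/
noncomputable def heavyAll (v : V) : ℕ :=
  heavyPort (inp v) (inbox₂ P f m M K R inp sel (K + 2) v)

/-- What is received last by `relay` in the fourth step of `treePhase`. -/
noncomputable def inbox₃ (N : ℕ) : V → Inbox :=
  relayAll P f m (fun v => childAddress (inp v) (sel v) (heavyAll P f m M K R inp sel v)) N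

/-- The tokens known after the last step of `treePhase`. -/
noncomputable def tokens₂ (v : V) : Finset (List ℕ) :=
  (tokenState P f m (fun v => fragToken (inp v) (sel v) (inbox₁ P f m inp sel (K + 2) v)
    (fromParent (inp v) (inbox₃ P f m M K R inp sel (K + 2) v))) (K + R) v).1

/-- The addresses that are the results of `treePhase`. -/
noncomputable def addressAll (v : V) : Address :=
  fullAddress (inp v) (sel v) (inbox₁ P f m inp sel (K + 2) v)
    (inbox₃ P f m M K R inp sel (K + 2) v) (tokens₂ P f m M K R inp sel v)

/-- Timing and message sizes do not depend on the quality of the sample; correctness is treated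
separately under `Suitable`. Hence the bandwidth bound survives unlucky coin tosses. -/
theorem exec_treePhase (hC : 1 ≤ C) (hf : ∀ x, IsWord C (Fintype.card V) (f x))
    (hinp : ∀ v, (inp v).ports.length = G.degree v) :
    Exec P C (fun v => treePhase f m M K R (inp v) (sel v))
      (3 * ((K + 2) * m) + 2 * ((K + R) * m)) fun v =>
        (mkTable (parentPort (inp v)) (heavyAll P f m M K R inp sel v)
          (addressAll P f m M K R inp sel v), encode (addressAll P f m M K R inp sel v)) := by
  have h1 := exec_relay P hC hf m (fun v y _ => [fragName (inp v) (sel v) y]) (K + 2)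
  have h2 := exec_tokenFlood P hC hf m (K + R) fun v =>
    fragToken (inp v) (sel v) (inbox₁ P f m inp sel (K + 2) v) []
  have h3 := exec_relay P hC hf m (fun v y _ => [potential (inp v) (sel v)
    (M * fragWeight (tokens₁ P f m K R inp sel v) (inp v).name) y]) (K + 2)
  have h4 := exec_relay P hC hf m (fun v =>
    childAddress (inp v) (sel v) (heavyAll P f m M K R inp sel v)) (K + 2)
  have h5 := exec_tokenFlood P hC hf m (K + R) fun v =>
    fragToken (inp v) (sel v) (inbox₁ P f m inp sel (K + 2) v)
      (fromParent (inp v) (inbox₃ P f m M K R inp sel (K + 2) v))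
  simp only [← hinp] at h2 h5
  have h := h1.bind (f := fun v y₁ =>
    (tokenFlood f m (inp v).ports.length (K + R) (fragToken (inp v) (sel v) y₁ [])).bind fun Q₁ =>
    (relay f m (fun y _ => [potential (inp v) (sel v) (M * fragWeight Q₁ (inp v).name) y])
      (K + 2)).bind fun y₂ =>
    (relay f m (childAddress (inp v) (sel v) (heavyPort (inp v) y₂)) (K + 2)).bind fun y₃ =>
    (tokenFlood f m (inp v).ports.length (K + R)
      (fragToken (inp v) (sel v) y₁ (fromParent (inp v) y₃))).bind fun Q₂ =>
    .ret (mkTable (parentPort (inp v)) (heavyPort (inp v) y₂)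
      (fullAddress (inp v) (sel v) y₁ y₃ Q₂), encode (fullAddress (inp v) (sel v) y₁ y₃ Q₂)))
    (h2.bind (h3.bind (h4.bind (h5.bind (Exec.ret _)))))
  refine Eq.mp ?_ h
  congr 1
  ring

/-- The verdict is unanimous: nobody ever knows more than `N` tokens, and by `broadcast_complete`
everybody knows either more than `K` of them or all. -/
theorem exec_countPhase (hC : 1 ≤ C) (hf : ∀ x, IsWord C (Fintype.card V) (f x))
    (hinp : ∀ v, (inp v).ports.length = G.degree v) (hG : G.Connected)
    (hR : ∀ u v, G.dist u v ≤ R) (hname : Function.Injective fun v => (inp v).name)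
    (hgood : ∀ v, ([(inp v).name].take m).map f = [(inp v).name]) {N : ℕ}
    (hN : Nat.card {v // sel v} = N) :
    (K < N → Exec P C (fun v => countPhase f m M K R (inp v) (sel v)) ((K + R) * m)
      fun _ => none) ∧
    (N ≤ K → Exec P C (fun v => countPhase f m M K R (inp v) (sel v))
      ((K + R) * m + (3 * ((K + 2) * m) + 2 * ((K + R) * m))) fun v =>
        some (mkTable (parentPort (inp v)) (heavyAll P f m M K R inp sel v)
          (addressAll P f m M K R inp sel v), encode (addressAll P f m M K R inp sel v))) := by
  classical
  set init : V → Finset (List ℕ) := fun v => if sel v then {[(inp v).name]} else ∅ with hinit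
  have hg : GoodTokens f m init := by
    intro v q hq
    simp only [hinit] at hq
    split_ifs at hq
    · rw [Finset.mem_singleton.1 hq]
      exact ⟨by simp, hgood v⟩
    · exact absurd hq (Finset.notMem_empty _)
  have hcard : (Finset.univ.biUnion init).card = N := by
    have : Finset.univ.biUnion init = (Finset.univ.filter sel).image fun v => [(inp v).name] := by
      ext q
      simp only [hinit, Finset.mem_biUnion, Finset.mem_univ, true_and, Finset.mem_image,
        Finset.mem_filter]
      refine exists_congr fun v => ?_
      split_ifs with h <;> simp [h, eq_comm]
    rw [this, Finset.card_image_of_injective _ fun u v h => hname (List.singleton_inj.1 h), ← hN,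
      Nat.card_eq_fintype_card, Fintype.card_subtype]
  have hle : ∀ v, (tokenState P f m init (K + R) v).1.card ≤ N := fun v => by
    rw [← hcard]
    refine Finset.card_le_card fun q hq => ?_
    obtain ⟨u, hu⟩ := (known_subset hg _ v).1 q hq
    exact Finset.mem_biUnion.2 ⟨u, Finset.mem_univ u, hu⟩
  have h1 := exec_tokenFlood P hC hf m (K + R) init
  simp only [← hinp] at h1
  constructor
  · intro hK
    have hlt : ∀ v, K < (tokenState P f m init (K + R) v).1.card := fun v => by
      rcases broadcast_complete (P := P) hG hg hR v with h | h
      · exact h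
      · rwa [h, hcard]
    refine h1.bind (f := fun v Q => if K < Q.card then .ret none else
      (treePhase f m M K R (inp v) (sel v)).bind fun o => .ret (some o)) (T' := 0) ?_
    simp only [if_pos (hlt _)]
    exact Exec.ret _
  · intro hK
    refine h1.bind (f := fun v Q => if K < Q.card then .ret none else
      (treePhase f m M K R (inp v) (sel v)).bind fun o => .ret (some o)) ?_
    simp only [if_neg (not_lt.2 ((hle _).trans hK))]
    exact (exec_treePhase P f m M K R inp sel hC hf hinp).bind (f := fun _ o => .ret (some o))
      (Exec.ret _)

end TreePhase

/-! ### Checking that all distances are small -/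

section BallCheck

variable (name : V → ℕ)

open Classical in
/-- Some neighbour knows a different maximum. -/
noncomputable def disagreement (r : ℕ) (v : V) : ℕ :=
  if ∃ i < G.degree v, recvd P id 1 (fun u _ => [maxAll P r name u]) v i ≠ [maxAll P r name v]
  then 1 else 0

theorem disagreement_eq_zero {r : ℕ} {v : V} :
    disagreement P name r v = 0 ↔ ∀ u, G.Adj v u → maxAll P r name u = maxAll P r name v := by
  unfold disagreement
  constructor
  · intro h u hu
    by_contra hne
    rw [if_pos ⟨P.port v u hu, (P.port v u hu).2, by simpa [recvd_port] using hne⟩] at h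
    omega
  · intro h
    rw [if_neg]
    rintro ⟨i, hi, hne⟩
    have hr := recvd_nbr P id 1 (fun u _ => [maxAll P r name u]) v ⟨i, hi⟩
    refine hne (hr.trans ?_)
    simpa using h _ (P.nbr v ⟨i, hi⟩).2

/-- Every ball of radius `r` is the whole graph, so all vertices hold the global maximum. This is
why the phases eventually get past the check. -/
theorem agreement_of_dist_le (hG : G.Connected) {r : ℕ} (hr : ∀ u v, G.dist u v ≤ r) (v : V) :
    maxAll P (2 * r) (disagreement P name r) v = 0 := by
  obtain ⟨u, -, hu⟩ := maxAll_eq hG P (2 * r) (disagreement P name r) v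
  rw [hu, disagreement_eq_zero]
  have h : ∀ v, maxAll P r name v = Finset.univ.sup name := fun v => by
    refine le_antisymm ?_ (Finset.sup_le fun w _ => le_maxAll hG P r name v w (hr v w))
    obtain ⟨w, -, hw⟩ := maxAll_eq hG P r name v
    rw [hw]
    exact Finset.le_sup (Finset.mem_univ w)
  intro w _
  rw [h, h]

/-- Agreement spreads outwards from `v`. A vertex that agrees with `v` lies within `r` of the vertex
`x` holding the common maximum, hence within `2 * r` of `v`, where no disagreement exists; so its
neighbours agree as well. -/
theorem of_agreement (hG : G.Connected) (hname : Function.Injective name) {r : ℕ} {v : V}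
    (hv : maxAll P (2 * r) (disagreement P name r) v = 0) :
    (∀ u w, G.dist u w ≤ 2 * r) ∧ (∀ u, maxAll P r name u = Finset.univ.sup name) ∧
      ∀ u, maxAll P (2 * r) (disagreement P name r) u = 0 := by
  have h0 : ∀ u, G.dist v u ≤ 2 * r → disagreement P name r u = 0 := fun u hu =>
    Nat.le_zero.1 (hv ▸ le_maxAll hG P (2 * r) (disagreement P name r) v u hu)
  obtain ⟨x, hx, hxe⟩ := maxAll_eq hG P r name v
  -- Names are distinct, so equal maxima come from the same vertex `x`.
  have hnear : ∀ u, maxAll P r name u = maxAll P r name v → G.dist u x ≤ r := by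
    intro u hu
    obtain ⟨y, hy, hye⟩ := maxAll_eq hG P r name u
    rw [hu, hxe] at hye
    rwa [hname hye]
  have key : ∀ k u, G.dist v u ≤ k → maxAll P r name u = maxAll P r name v := by
    intro k
    induction k with
    | zero =>
      intro u hu
      rw [hG.dist_eq_zero_iff.1 (Nat.le_zero.1 hu)]
    | succ k ih =>
      intro u hu
      by_cases hne : u = v
      · rw [hne]
      · rw [SimpleGraph.dist_comm] at hu
        obtain ⟨w, hw, hd⟩ := exists_adj_dist_le hG hu hne
        rw [SimpleGraph.dist_comm] at hd
        have h1 := ih w hd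
        have h2 := hG.dist_triangle (u := v) (v := x) (w := w)
        have h3 := hnear w h1
        rw [SimpleGraph.dist_comm] at h3
        rw [← h1]
        exact (disagreement_eq_zero P name).1 (h0 w (by omega)) u hw.symm
  have hall : ∀ u, maxAll P r name u = maxAll P r name v := fun u => key _ u le_rfl
  refine ⟨fun u w => ?_, fun u => ?_, fun u => ?_⟩
  · have h1 := hnear u (hall u)
    have h2 := hnear w (hall w)
    have h3 := hG.dist_triangle (u := u) (v := x) (w := w)
    rw [SimpleGraph.dist_comm] at h2
    omega
  · refine le_antisymm ?_ (Finset.sup_le fun w _ => ?_)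
    · rw [hall u, hxe]
      exact Finset.le_sup (Finset.mem_univ x)
    · rw [hall u, ← hall w]
      exact le_maxAll hG P r name w w (by simp)
  · obtain ⟨w, -, hw⟩ := maxAll_eq hG P (2 * r) (disagreement P name r) u
    rw [hw, disagreement_eq_zero]
    intro y _
    rw [hall y, hall w]

end BallCheck

end Run

/-! ### Correctness of the computation of tables and labels -/

section Correctness

variable {V : Type} [Fintype V] {G : SimpleGraph V}
  {name : V → ℕ} {T : G.Subgraph} {z : V} {f : ℕ → ℕ} {m M K R L : ℕ} {sel : V → Prop}

/-- The parameters of `treePhase` suit the graph, the tree and the selected vertices. -/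
structure Suitable (name : V → ℕ) (T : G.Subgraph) (z : V) (f : ℕ → ℕ) (m M K R L : ℕ)
    (sel : V → Prop) : Prop where
  connected : G.Connected
  dist_le : ∀ u v, G.dist u v ≤ R
  tree : T.coe.IsTree
  root_mem : z ∈ T.verts
  name_inj : Function.Injective name
  name_lt : ∀ v, name v < M
  card_le : Fintype.card V ≤ M
  eq_pow : M = 2 ^ L
  pos : 1 ≤ L
  length_eq : m = 8 * L
  map_eq : ∀ x < M ^ 4, f x = x
  sel_root : sel z
  mem_of_sel : ∀ v, sel v → v ∈ T.verts
  fragDepth_le : ∀ v ∈ T.verts, fragDepth T z sel v ≤ K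
  card_sel_le : Nat.card {v // sel v} ≤ K

theorem lt_pow_four {x : ℕ} (hx : x < M) : x < M ^ 4 :=
  hx.trans_le (Nat.le_pow (by norm_num))

/-- Neither the cut after `m` words nor the truncation of words loses anything. From here on,
correctness amounts to showing that the intended messages are this small. -/
theorem Suitable.transmit (h : Suitable name T z f m M K R L sel) {l : List ℕ}
    (hl : l.length ≤ m) (hx : ∀ x ∈ l, x < M ^ 4) : (l.take m).map f = l := by
  rw [List.take_of_length_le hl]
  exact (List.map_congr_left fun x hxl => h.map_eq x (hx x hxl)).trans (List.map_id' l)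

theorem Suitable.transmit_singleton (h : Suitable name T z f m M K R L sel) {x : ℕ}
    (hx : x < M ^ 4) : ([x].take m).map f = [x] :=
  h.transmit (by have := h.pos; have := h.length_eq; simp; omega) (by simpa using hx)

open Classical in
/-- The tokens that describe the tree of fragments, with messages `e`. -/
noncomputable def tokenSet (name : V → ℕ) (T : G.Subgraph) (z : V) (sel : V → Prop)
    (e : V → List ℕ) : Finset (List ℕ) :=
  (Finset.univ.filter sel).image fun v => name v :: name (fragPar T z sel v) :: e v

theorem mem_tokenSet {e : V → List ℕ} {q : List ℕ} : q ∈ tokenSet name T z sel e ↔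
    ∃ v, sel v ∧ name v :: name (fragPar T z sel v) :: e v = q := by
  simp [tokenSet]

theorem card_tokenSet_le (e : V → List ℕ) :
    (tokenSet name T z sel e).card ≤ Nat.card {v // sel v} := by
  classical
  refine Finset.card_image_le.trans_eq ?_
  rw [Nat.card_eq_fintype_card, Fintype.card_subtype]

open Classical in
-- Translates `IsFragWeight`, a statement about names in tokens, into one about the tree of
-- fragments.
theorem sum_tokenSet (hname : Function.Injective name) (s : ℕ → ℕ) (y : V) (e : V → List ℕ) :
    ∑ q ∈ tokenSet name T z sel e with q.tail.headI = name y ∧ q.headI ≠ name y, s q.headI =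
      ∑ c with fragPar T z sel c = y ∧ c ≠ y, s (name c) := by
  have hset : (tokenSet name T z sel e).filter
      (fun q => q.tail.headI = name y ∧ q.headI ≠ name y) =
      (Finset.univ.filter fun c => fragPar T z sel c = y ∧ c ≠ y).image
        fun v => name v :: name (fragPar T z sel v) :: e v := by
    ext q
    simp only [Finset.mem_filter, mem_tokenSet, Finset.mem_image, Finset.mem_univ, true_and]
    constructor
    · rintro ⟨⟨v, hv, rfl⟩, h1, h2⟩
      exact ⟨v, ⟨hname h1, fun h' => h2 (congrArg name h')⟩, rfl⟩
    · rintro ⟨v, ⟨h1, h2⟩, rfl⟩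
      refine ⟨⟨v, ?_, rfl⟩, congrArg name h1, fun h' => h2 (hname h')⟩
      by_contra hv
      rw [fragPar, if_neg hv] at h1
      exact h2 h1
  rw [hset, Finset.sum_image]
  · rfl
  · intro u _ v _ huv
    exact hname (List.cons.inj huv).1

open Classical in
-- Only existence has to be shown. Which solution is chosen does not matter, as long as all
-- vertices, having the same tokens, choose the same one.
theorem Suitable.isFragWeight (h : Suitable name T z f m M K R L sel) (e : V → List ℕ) :
    IsFragWeight (tokenSet name T z sel e) (fragWeight (tokenSet name T z sel e)) := by
  have hrk := depth_fragPar_lt h.tree h.root_mem h.sel_root h.mem_of_sel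
  have hex : ∃ s, IsFragWeight (tokenSet name T z sel e) s := by
    -- The number of fragments at or below `y`; `invFun` turns it into a function of names.
    set s : V → ℕ := fun y => ∑ u ∈ below (fragPar T z sel) y, if sel u then 1 else 0 with hs
    refine ⟨fun x => s (@Function.invFun _ _ ⟨z⟩ name x), fun q hq => ?_⟩
    obtain ⟨y, hy, rfl⟩ := mem_tokenSet.1 hq
    have hinv := @Function.leftInverse_invFun _ _ ⟨z⟩ name h.name_inj
    change 1 + ∑ q ∈ tokenSet name T z sel e with
      q.tail.headI = name y ∧ q.headI ≠ name y, s (@Function.invFun _ _ ⟨z⟩ name q.headI) ≤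
        s (@Function.invFun _ _ ⟨z⟩ name (name y)) ∧
          s (@Function.invFun _ _ ⟨z⟩ name (name y)) ≤ _
    rw [sum_tokenSet h.name_inj fun x => s (@Function.invFun _ _ ⟨z⟩ name x)]
    simp only [hinv _]
    constructor
    · rw [hs]
      simp only
      rw [sum_below hrk _ y, if_pos hy]
    · calc s y ≤ ∑ u, if sel u then 1 else 0 :=
            Finset.sum_le_sum_of_subset (Finset.subset_univ _)
        _ = (tokenSet name T z sel e).card := by
          rw [tokenSet, Finset.card_image_of_injective _ fun u v huv =>
            h.name_inj (List.cons.inj huv).1]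
          simp
  unfold fragWeight
  rw [dif_pos hex]
  exact hex.choose_spec

/-! ### The potential -/

open Classical in
/-- The parent, if it is not a root of a fragment. -/
noncomputable def cutPar (T : G.Subgraph) (z : V) (sel : V → Prop) (v : V) : V :=
  if sel (par T z v) then v else par T z v

open Classical in
/-- The potential that has the weights `s` at the roots of fragments, and is additive elsewhere. -/
noncomputable def truePotential (T : G.Subgraph) (z : V) (sel : V → Prop) (s : V → ℕ) (v : V) :
    ℕ :=
  ∑ u ∈ below (cutPar T z sel) v, if sel u then s u else 1

open Classical in
-- With the edges below fragment roots cut, only `v` itself lies below a selected `v`, while any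
-- other vertex keeps all its children. So `truePotential` solves the recursion that the algorithm
-- evaluates.
theorem truePotential_eq (hT : T.coe.IsTree) (hz : z ∈ T.verts) (s : V → ℕ) (v : V) :
    truePotential T z sel s v =
      if sel v then s v else 1 + ∑ c ∈ children T z v, truePotential T z sel s c := by
  have hrk : ∀ v, cutPar T z sel v ≠ v → depth T z (cutPar T z sel v) < depth T z v := by
    intro v hv
    unfold cutPar at hv ⊢
    split_ifs at hv ⊢
    · exact absurd rfl hv
    · exact depth_par_lt hT hz v hv
  unfold truePotential
  rw [sum_below hrk]
  split_ifs with hv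
  · rw [Finset.filter_eq_empty_iff.2, Finset.sum_empty, Nat.add_zero]
    rintro c - ⟨h1, h2⟩
    unfold cutPar at h1
    split_ifs at h1 with h3
    · exact h2 h1
    · exact h3 (h1 ▸ hv)
  · congr 1
    refine Finset.sum_congr ?_ fun _ _ => rfl
    ext c
    simp only [Finset.mem_filter, Finset.mem_univ, true_and, mem_children]
    refine and_congr_left fun hc => ?_
    unfold cutPar
    split_ifs with h1
    · exact ⟨fun h2 => absurd h2 hc, fun h2 => absurd (h2 ▸ h1) hv⟩
    · rfl

/-- The potential used by the algorithm. -/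
noncomputable def treePotential (name : V → ℕ) (T : G.Subgraph) (z : V) (sel : V → Prop) (M : ℕ) :
    V → ℕ :=
  truePotential T z sel fun v => M * fragWeight (tokenSet name T z sel fun _ => []) (name v)

open Classical in
theorem Suitable.treePotential_eq (h : Suitable name T z f m M K R L sel) (v : V) :
    treePotential name T z sel M v =
      if sel v then M * fragWeight (tokenSet name T z sel fun _ => []) (name v)
      else 1 + ∑ c ∈ children T z v, treePotential name T z sel M c :=
  truePotential_eq h.tree h.root_mem _ v

theorem Suitable.one_add_sum_le (h : Suitable name T z f m M K R L sel) {v : V}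
    (hv : v ∈ T.verts) : 1 + ∑ c ∈ children T z v, treePotential name T z sel M c ≤
      treePotential name T z sel M v := by
  classical
  refine one_add_sum_children_le h.tree h.root_mem h.sel_root h.card_le
    (s := fun v => fragWeight (tokenSet name T z sel fun _ => []) (name v)) ?_
    (fun v _ => h.treePotential_eq v) hv
  intro y hy
  have := (h.isFragWeight (fun _ => []) _ (mem_tokenSet.2 ⟨y, hy, rfl⟩)).1
  change 1 + ∑ q ∈ tokenSet name T z sel fun _ => [] with
    q.tail.headI = name y ∧ q.headI ≠ name y, _ ≤ fragWeight _ (name y) at this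
  rwa [sum_tokenSet h.name_inj] at this

theorem Suitable.treePotential_root_le (h : Suitable name T z f m M K R L sel) :
    treePotential name T z sel M z ≤ M ^ 2 := by
  classical
  rw [h.treePotential_eq, if_pos h.sel_root, pow_two]
  refine Nat.mul_le_mul_left _ ?_
  have h1 := (h.isFragWeight (fun _ => []) _ (mem_tokenSet.2 ⟨z, h.sel_root, rfl⟩)).2
  refine h1.trans ((card_tokenSet_le _).trans ?_)
  rw [Nat.card_eq_fintype_card]
  exact (Fintype.card_subtype_le _).trans h.card_le

/-- By superadditivity the potential is largest at the root, so it always fits into a truncated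
word. -/
theorem Suitable.treePotential_lt (h : Suitable name T z f m M K R L sel) {v : V}
    (hv : v ∈ T.verts) : treePotential name T z sel M v < M ^ 4 := by
  have h1 : treePotential name T z sel M v ≤ treePotential name T z sel M z := by
    refine tree_induction h.tree h.root_mem
      (p := fun v => treePotential name T z sel M v ≤ treePotential name T z sel M z) le_rfl ?_ hv
    intro v hv hne ih
    have h1 := h.one_add_sum_le (par_mem h.tree h.root_mem hv)
    have h2 := Finset.single_le_sum (f := treePotential name T z sel M) (fun _ _ => Nat.zero_le _)
      (mem_children_par h.tree h.root_mem hv hne)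
    omega
  refine (h1.trans h.treePotential_root_le).trans_lt (Nat.pow_lt_pow_right ?_ (by norm_num))
  rw [h.eq_pow]
  exact Nat.one_lt_two_pow (by have := h.pos; omega)

variable [DecidableRel G.Adj] {P : PortNumbering G}

/-! ### The names of the roots of the fragments -/

/-- Names descend one level per repetition. Each message is recomputed from the last inbox alone, so
early garbage is flushed out. -/
theorem Suitable.fragName_eq (h : Suitable name T z f m M K R L sel) (t : ℕ) {v : V}
    (hv : v ∈ T.verts) (ht : fragDepth T z sel v ≤ t) :
    fragName (localInput P name T z v) (sel v) (inbox₁ P f m (localInput P name T z) sel t v) =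
      name (frag T z sel v) := by
  induction t generalizing v with
  | zero =>
    by_cases hs : sel v
    · rw [fragName, if_pos hs, frag_of_mem hs]
      rfl
    · rw [fragDepth_of_notMem h.tree h.root_mem h.sel_root hv hs] at ht
      omega
  | succ t ih =>
    by_cases hs : sel v
    · rw [fragName, if_pos hs, frag_of_mem hs]
      rfl
    · have hne : v ≠ z := fun h' => hs (h' ▸ h.sel_root)
      rw [fragDepth_of_notMem h.tree h.root_mem h.sel_root hv hs] at ht
      have h1 := ih (par_mem h.tree h.root_mem hv) (by omega)
      rw [fragName, if_neg hs, frag_of_notMem h.tree h.root_mem h.sel_root hv hs, inbox₁, relayAll_succ,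
        recvd_parentPort P name h.tree h.root_mem _ _ _ hv hne]
      unfold inbox₁ at h1
      rw [h1, h.transmit_singleton (lt_pow_four (h.name_lt _)), List.headI_cons]

theorem Suitable.parentFragName_eq (h : Suitable name T z f m M K R L sel) {v : V}
    (hv : v ∈ T.verts) :
    parentFragName (localInput P name T z v)
      (inbox₁ P f m (localInput P name T z) sel (K + 2) v) = name (frag T z sel (par T z v)) := by
  unfold parentFragName
  by_cases hz : v = z
  · rw [if_pos ((isRoot_iff P name h.tree h.root_mem).2 hz), hz, par_root, frag_of_mem h.sel_root]
    rfl
  · rw [if_neg fun h' => hz ((isRoot_iff P name h.tree h.root_mem).1 h'), inbox₁, relayAll_succ,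
      recvd_parentPort P name h.tree h.root_mem _ _ _ hv hz]
    have hp := par_mem h.tree h.root_mem hv
    -- What arrives in the last repetition was computed by the parent from the inbox of repetition
    -- `K + 1`.
    have h1 := h.fragName_eq (P := P) (K + 1) hp ((h.fragDepth_le _ hp).trans (Nat.le_succ K))
    unfold inbox₁ at h1
    rw [h1, h.transmit_singleton (lt_pow_four (h.name_lt _)), List.headI_cons]

/-! ### Broadcasting the tree of fragments -/

/-- There are at most `K` tokens, which excludes the overflow alternative of `broadcast_complete`.
The lemma serves both broadcasts, with different attachments `e`. -/
theorem Suitable.known_eq (h : Suitable name T z f m M K R L sel) {e : V → List ℕ}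
    (he : ∀ v, sel v → (e v).length + 2 ≤ m ∧ ∀ x ∈ e v, x < M ^ 4) (v : V) :
    (tokenState P f m (fun v => fragToken (localInput P name T z v) (sel v)
      (inbox₁ P f m (localInput P name T z) sel (K + 2) v) (e v)) (K + R) v).1 =
      tokenSet name T z sel e := by
  have hinit : ∀ v, fragToken (localInput P name T z v) (sel v)
      (inbox₁ P f m (localInput P name T z) sel (K + 2) v) (e v) =
      open Classical in
      if sel v then {name v :: name (fragPar T z sel v) :: e v} else ∅ := by
    intro v
    unfold fragToken
    by_cases hs : sel v
    · rw [if_pos hs, if_pos hs, h.parentFragName_eq (h.mem_of_sel v hs), fragPar_of_mem hs]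
      rfl
    · rw [if_neg hs, if_neg hs]
  simp only [hinit]
  set init : V → Finset (List ℕ) := fun v =>
    open Classical in
    if sel v then {name v :: name (fragPar T z sel v) :: e v} else ∅ with hinit'
  have hg : GoodTokens f m init := by
    intro v q hq
    simp only [hinit'] at hq
    by_cases hs : sel v
    · rw [if_pos hs, Finset.mem_singleton] at hq
      subst hq
      refine ⟨by simp, h.transmit (he v hs).1 fun x hx => ?_⟩
      rcases List.mem_cons.1 hx with rfl | hx
      · exact lt_pow_four (h.name_lt _)
      rcases List.mem_cons.1 hx with rfl | hx
      · exact lt_pow_four (h.name_lt _)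
      · exact (he v hs).2 x hx
    · rw [if_neg hs] at hq
      exact absurd hq (Finset.notMem_empty _)
  have hunion : Finset.univ.biUnion init = tokenSet name T z sel e := by
    ext q
    simp only [hinit', Finset.mem_biUnion, Finset.mem_univ, true_and, mem_tokenSet]
    refine exists_congr fun v => ?_
    by_cases hs : sel v
    · simp [hs, eq_comm]
    · simp [hs]
  rcases broadcast_complete (P := P) h.connected hg h.dist_le v (K := K) with h1 | h1
  · exfalso
    have h2 : (tokenState P f m init (K + R) v).1 ⊆ tokenSet name T z sel e := fun q hq => by
      obtain ⟨u, hu⟩ := (known_subset hg _ v).1 q hq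
      rw [← hunion]
      exact Finset.mem_biUnion.2 ⟨u, Finset.mem_univ u, hu⟩
    have h3 := (Finset.card_le_card h2).trans ((card_tokenSet_le e).trans h.card_sel_le)
    omega
  · rw [h1, hunion]

theorem Suitable.tokens₁_eq (h : Suitable name T z f m M K R L sel) (v : V) :
    tokens₁ P f m K R (localInput P name T z) sel v = tokenSet name T z sel fun _ => [] :=
  h.known_eq (e := fun _ => []) (fun _ _ => ⟨by
    have := h.pos
    have := h.length_eq
    simp
    omega, by simp⟩) v

/-! ### The heavy children -/

/-- Correct values climb from the deepest level `K` of the fragments: going to an unselected child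
raises `fragDepth` by one while `t` drops by one. Selected children are correct at any time. -/
theorem Suitable.potential_eq (h : Suitable name T z f m M K R L sel) (t : ℕ) {v : V}
    (hv : v ∈ T.verts) (ht : K < fragDepth T z sel v + t) :
    potential (localInput P name T z v) (sel v)
      (M * fragWeight (tokens₁ P f m K R (localInput P name T z) sel v)
        (localInput P name T z v).name)
      (inbox₂ P f m M K R (localInput P name T z) sel t v) = treePotential name T z sel M v := by
  classical
  induction t generalizing v with
  | zero =>
    have := h.fragDepth_le v hv
    omega
  | succ t ih =>
    rw [h.treePotential_eq v, h.tokens₁_eq]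
    unfold potential
    by_cases hs : sel v
    · rw [if_pos hs, if_pos hs]
      rfl
    · rw [if_neg hs, if_neg hs, sum_childPorts P name h.tree h.root_mem]
      congr 1
      refine Finset.sum_congr rfl fun c hc => ?_
      obtain ⟨h1, h2, h3, -⟩ := of_mem_children h.tree h.root_mem hc
      have key : potential (localInput P name T z c) (sel c)
          (M * fragWeight (tokens₁ P f m K R (localInput P name T z) sel c)
            (localInput P name T z c).name)
          (inbox₂ P f m M K R (localInput P name T z) sel t c) =
          treePotential name T z sel M c := by
        by_cases hsc : sel c
        · unfold potential
          rw [if_pos hsc, h.treePotential_eq, if_pos hsc, h.tokens₁_eq]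
          rfl
        · refine ih h1 ?_
          rw [fragDepth_of_notMem h.tree h.root_mem h.sel_root h1 hsc, h3]
          omega
      rw [inbox₂, relayAll_succ, recvd_childPort P name h.tree h.root_mem _ _ _ hc]
      unfold inbox₂ at key
      rw [key, h.transmit_singleton (h.treePotential_lt h1), List.headI_cons]

theorem Suitable.inbox₂_childPort (h : Suitable name T z f m M K R L sel) {v c : V}
    (hc : c ∈ children T z v) :
    (inbox₂ P f m M K R (localInput P name T z) sel (K + 2) v (childPort P T z c)).headI =
      treePotential name T z sel M c := by
  have h1 := (of_mem_children h.tree h.root_mem hc).1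
  have key := h.potential_eq (P := P) (K + 1) h1 (by omega)
  rw [inbox₂, relayAll_succ, recvd_childPort P name h.tree h.root_mem _ _ _ hc]
  unfold inbox₂ at key
  rw [key, h.transmit_singleton (h.treePotential_lt h1), List.headI_cons]

theorem Suitable.exists_heavy (h : Suitable name T z f m M K R L sel) {v c : V}
    (hc : c ∈ children T z v) : ∃ c' ∈ children T z v,
      childPort P T z c' = heavyAll P f m M K R (localInput P name T z) sel v ∧
        treePotential name T z sel M c ≤ treePotential name T z sel M c' := by
  set y := inbox₂ P f m M K R (localInput P name T z) sel (K + 2) v with hy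
  have hmem : ∀ c ∈ children T z v, childPort P T z c ∈ childPorts (localInput P name T z v) :=
    fun c hc => by
      rw [childPorts_eq P name h.tree h.root_mem]
      exact Finset.mem_image_of_mem _ hc
  have hne : (childPorts (localInput P name T z v)).Nonempty := ⟨_, hmem c hc⟩
  have hspec := (Finset.exists_max_image _ (fun i => (y i).headI) hne).choose_spec
  have hdef : heavyAll P f m M K R (localInput P name T z) sel v =
      (Finset.exists_max_image _ (fun i => (y i).headI) hne).choose := by
    rw [heavyAll, heavyPort, dif_pos hne]
  rw [← hdef] at hspec
  obtain ⟨c', hc', he⟩ := Finset.mem_image.1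
    (childPorts_eq P name h.tree h.root_mem v ▸ hspec.1)
  refine ⟨c', hc', he, ?_⟩
  have := hspec.2 _ (hmem c hc)
  rwa [← he, h.inbox₂_childPort hc, h.inbox₂_childPort hc'] at this

/-- The address of `v` with respect to the heavy children determined by the algorithm. -/
noncomputable def trueAddress (P : PortNumbering G) (name : V → ℕ) (T : G.Subgraph) (z : V)
    (f : ℕ → ℕ) (m M K R : ℕ) (sel : V → Prop) (v : V) : Address :=
  address P T z (heavyAll P f m M K R (localInput P name T z) sel) v

/-- The potential is at least `1` at `v` and at most `M ^ 2 = 2 ^ (2 * L)` at the root, and every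
light step halves it. -/
theorem Suitable.lightCount_le (h : Suitable name T z f m M K R L sel) {v : V}
    (hv : v ∈ T.verts) : lightCount (trueAddress P name T z f m M K R sel v) ≤ 2 * L := by
  have h1 := two_pow_lightCount_mul_le (P := P) h.tree h.root_mem (fun v hv => h.one_add_sum_le hv)
    (fun v _ c hc => h.exists_heavy (P := P) hc) hv
  have h2 := h.one_add_sum_le hv
  have h3 := h.treePotential_root_le
  rw [h.eq_pow, ← pow_mul] at h3
  rw [h.eq_pow] at h1 h2
  rw [trueAddress, h.eq_pow]
  refine (Nat.pow_le_pow_iff_right (a := 2) (by norm_num)).1 ?_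
  rw [Nat.mul_comm 2 L]
  refine le_trans (le_trans ?_ h1) h3
  exact Nat.le_mul_of_pos_right _ (by omega)

theorem lt_card_of_mem_address (hT : T.coe.IsTree) (hz : z ∈ T.verts) {heavy : V → ℕ} {v : V}
    (hv : v ∈ T.verts) {p : ℕ} (hp : some p ∈ address P T z heavy v) : p < Fintype.card V := by
  refine tree_induction hT hz
    (p := fun v => some p ∈ address P T z heavy v → p < Fintype.card V) ?_ ?_ hv hp
  · rw [address_root]
    simp
  · intro v hv hne ih hmem
    rw [address_of_ne hT hz hv hne] at hmem
    rcases List.mem_append.1 hmem with h1 | h1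
    · exact ih h1
    · rw [List.mem_singleton, symbol] at h1
      split_ifs at h1
      obtain ⟨h', he⟩ := childPort_eq P hT hz (mem_children_par hT hz hv hne)
      rw [Option.some_inj.1 h1, he]
      exact (P.port _ _ _).2.trans_le (G.degree_lt_card_verts _).le

/-- Encoded pieces of addresses are short. -/
theorem Suitable.encode_small (h : Suitable name T z f m M K R L sel) {v : V} (hv : v ∈ T.verts)
    {a b : Address} (hab : trueAddress P name T z f m M K R sel v = a ++ b) :
    (encode b).length ≤ 4 * L + 1 ∧ ∀ x ∈ encode b, x < M := by
  have h1 := h.lightCount_le (P := P) hv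
  rw [hab, lightCount, List.countP_append] at h1
  have h3 := h.card_le
  constructor
  · rw [length_encode, lightCount]
    omega
  · intro x hx
    rcases mem_encode hx with h2 | h2
    · have h4 := congrArg List.length hab
      rw [trueAddress, length_address, List.length_append] at h4
      have := depth_lt_card h.tree h.root_mem hv
      omega
    · have h4 : some x ∈ trueAddress P name T z f m M K R sel v :=
        hab ▸ List.mem_append_right _ h2
      exact (lt_card_of_mem_address h.tree h.root_mem hv h4).trans_le h3

/-! ### The addresses -/

/-- The message is known to be short only because it encodes a piece of a true address, which is why
`hpar` is needed at the parent. -/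
theorem Suitable.recvd_childAddress (h : Suitable name T z f m M K R L sel) (t : ℕ) {v : V}
    (hv : v ∈ T.verts) (hne : v ≠ z)
    (hpar : trueAddress P name T z f m M K R sel (par T z v) =
      trueAddress P name T z f m M K R sel (frag T z sel (par T z v)) ++
        localAddress (localInput P name T z (par T z v)) (sel (par T z v))
          (inbox₃ P f m M K R (localInput P name T z) sel t (par T z v))) :
    ∃ w, inbox₃ P f m M K R (localInput P name T z) sel (t + 1) v
        (parentPort (localInput P name T z v)) = encode w ∧
      trueAddress P name T z f m M K R sel v =
        trueAddress P name T z f m M K R sel (frag T z sel (par T z v)) ++ w := by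
  refine ⟨localAddress (localInput P name T z (par T z v)) (sel (par T z v))
    (inbox₃ P f m M K R (localInput P name T z) sel t (par T z v)) ++
    [symbol P T z (heavyAll P f m M K R (localInput P name T z) sel) v], ?_, ?_⟩
  swap
  · rw [trueAddress, address_of_ne h.tree h.root_mem hv hne, ← List.append_assoc, ← hpar]
    rfl
  · rw [inbox₃, relayAll_succ, recvd_parentPort P name h.tree h.root_mem _ _ _ hv hne]
    unfold childAddress
    change List.map f (List.take m (encode (_ ++ [symbol P T z _ v]))) = _
    have hs := h.encode_small (P := P) hv (a := trueAddress P name T z f m M K R sel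
      (frag T z sel (par T z v))) (b := localAddress (localInput P name T z (par T z v))
      (sel (par T z v)) (inbox₃ P f m M K R (localInput P name T z) sel t (par T z v)) ++
      [symbol P T z (heavyAll P f m M K R (localInput P name T z) sel) v]) (by
        rw [← List.append_assoc, ← hpar]
        exact address_of_ne h.tree h.root_mem hv hne)
    have := h.pos
    have := h.length_eq
    refine h.transmit (hs.1.trans ?_) fun x hx => lt_pow_four (hs.2 x hx)
    omega

theorem Suitable.localAddress_eq (h : Suitable name T z f m M K R L sel) (t : ℕ) {v : V}
    (hv : v ∈ T.verts) (ht : fragDepth T z sel v ≤ t) :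
    trueAddress P name T z f m M K R sel v =
      trueAddress P name T z f m M K R sel (frag T z sel v) ++
        localAddress (localInput P name T z v) (sel v)
          (inbox₃ P f m M K R (localInput P name T z) sel t v) := by
  induction t generalizing v with
  | zero =>
    by_cases hs : sel v
    · rw [localAddress, if_pos hs, frag_of_mem hs, List.append_nil]
    · rw [fragDepth_of_notMem h.tree h.root_mem h.sel_root hv hs] at ht
      omega
  | succ t ih =>
    by_cases hs : sel v
    · rw [localAddress, if_pos hs, frag_of_mem hs, List.append_nil]
    · have hne : v ≠ z := fun h' => hs (h' ▸ h.sel_root)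
      rw [fragDepth_of_notMem h.tree h.root_mem h.sel_root hv hs] at ht
      obtain ⟨w, h1, h2⟩ := h.recvd_childAddress t hv hne
        (ih (par_mem h.tree h.root_mem hv) (by omega))
      rw [localAddress, if_neg hs, h1, decode_encode, h2,
        frag_of_notMem h.tree h.root_mem h.sel_root hv hs]

theorem Suitable.fromParent_eq (h : Suitable name T z f m M K R L sel) {v : V}
    (hv : v ∈ T.verts) (hne : v ≠ z) :
    ∃ w, fromParent (localInput P name T z v)
        (inbox₃ P f m M K R (localInput P name T z) sel (K + 2) v) = encode w ∧
      trueAddress P name T z f m M K R sel v =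
        trueAddress P name T z f m M K R sel (frag T z sel (par T z v)) ++ w := by
  have hp := par_mem h.tree h.root_mem hv
  obtain ⟨w, h1, h2⟩ := h.recvd_childAddress (P := P) (K + 1) hv hne
    (h.localAddress_eq (K + 1) hp ((h.fragDepth_le _ hp).trans (Nat.le_succ K)))
  refine ⟨w, ?_, h2⟩
  rw [fromParent, if_neg fun h' => hne ((isRoot_iff P name h.tree h.root_mem).1 h'), h1]

theorem Suitable.tokens₂_eq (h : Suitable name T z f m M K R L sel) (v : V) :
    tokens₂ P f m M K R (localInput P name T z) sel v =
      tokenSet name T z sel fun v => fromParent (localInput P name T z v)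
        (inbox₃ P f m M K R (localInput P name T z) sel (K + 2) v) := by
  refine h.known_eq (fun v hs => ?_) v
  have := h.pos
  have := h.length_eq
  by_cases hne : v = z
  · rw [fromParent, if_pos ((isRoot_iff P name h.tree h.root_mem).2 hne)]
    exact ⟨by simp; omega, by simp⟩
  · have hv := h.mem_of_sel v hs
    obtain ⟨w, h1, h2⟩ := h.fromParent_eq (P := P) hv hne
    obtain ⟨h3, h4⟩ := h.encode_small hv h2
    rw [h1]
    exact ⟨by omega, fun x hx => lt_pow_four (h4 x hx)⟩

/-- The true addresses satisfy the recursion in the tokens, so a solution exists; by induction along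
the tree of fragments any chosen solution agrees with them at fragment roots. -/
theorem Suitable.fragAddress_eq (h : Suitable name T z f m M K R L sel) (v : V) {y : V}
    (hy : sel y) :
    fragAddress (tokens₂ P f m M K R (localInput P name T z) sel v) (name y) =
      trueAddress P name T z f m M K R sel y := by
  classical
  rw [h.tokens₂_eq]
  set e : V → List ℕ := fun v => fromParent (localInput P name T z v)
    (inbox₃ P f m M K R (localInput P name T z) sel (K + 2) v) with he
  have hroot : ∀ y, sel y → fragPar T z sel y = y → y = z := by
    intro y hy hfix
    by_contra hne
    have h1 := (par_spec h.tree h.root_mem (h.mem_of_sel y hy) hne).2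
    have h2 := depth_frag_le (S := sel) h.tree h.root_mem
      (par_mem h.tree h.root_mem (h.mem_of_sel y hy))
    rw [fragPar_of_mem hy] at hfix
    rw [hfix] at h2
    omega
  have hstep : ∀ y, sel y → y ≠ z → trueAddress P name T z f m M K R sel y =
      trueAddress P name T z f m M K R sel (fragPar T z sel y) ++ decode (e y) := by
    intro y hy hne
    obtain ⟨w, h1, h2⟩ := h.fromParent_eq (P := P) (h.mem_of_sel y hy) hne
    rw [h2, fragPar_of_mem hy, he]
    simp only
    rw [h1, decode_encode]
  have hex : ∃ a, IsFragAddress (tokenSet name T z sel e) a := by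
    refine ⟨fun x => trueAddress P name T z f m M K R sel
      (@Function.invFun _ _ ⟨z⟩ name x), fun q hq => ?_⟩
    obtain ⟨y, hy, rfl⟩ := mem_tokenSet.1 hq
    have hinv := @Function.leftInverse_invFun _ _ ⟨z⟩ name h.name_inj
    change trueAddress P name T z f m M K R sel (@Function.invFun _ _ ⟨z⟩ name (name y)) =
      if name y = name (fragPar T z sel y) then [] else
        trueAddress P name T z f m M K R sel
          (@Function.invFun _ _ ⟨z⟩ name (name (fragPar T z sel y))) ++ decode (e y)
    rw [hinv, hinv]
    by_cases hne : y = z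
    · rw [hne, if_pos (by rw [fragPar_root h.sel_root]), trueAddress, address_root]
    · rw [if_neg fun h' => hne (hroot y hy (h.name_inj h').symm)]
      exact hstep y hy hne
  have hspec : IsFragAddress (tokenSet name T z sel e) (fragAddress (tokenSet name T z sel e)) := by
    unfold fragAddress
    rw [dif_pos hex]
    exact hex.choose_spec
  induction hd : depth T z y using Nat.strong_induction_on generalizing y with
  | _ d ih =>
    have h1 : fragAddress (tokenSet name T z sel e) (name y) =
        if name y = name (fragPar T z sel y) then []
        else fragAddress (tokenSet name T z sel e) (name (fragPar T z sel y)) ++ decode (e y) :=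
      hspec _ (mem_tokenSet.2 ⟨y, hy, rfl⟩)
    rw [h1]
    by_cases hne : y = z
    · rw [hne, if_pos (by rw [fragPar_root h.sel_root]), trueAddress, address_root]
    · have hfix : fragPar T z sel y ≠ y := fun h' => hne (hroot y hy h')
      rw [if_neg fun h' => hfix (h.name_inj h').symm, hstep y hy hne]
      have h2 := depth_fragPar_lt h.tree h.root_mem h.sel_root h.mem_of_sel y hfix
      rw [ih _ (hd ▸ h2) ?_ rfl]
      rw [fragPar_of_mem hy]
      exact frag_prop h.tree h.root_mem h.sel_root
        (par_mem h.tree h.root_mem (h.mem_of_sel y hy))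

theorem Suitable.addressAll_eq (h : Suitable name T z f m M K R L sel) {v : V}
    (hv : v ∈ T.verts) : addressAll P f m M K R (localInput P name T z) sel v =
      trueAddress P name T z f m M K R sel v := by
  have h1 : fragDepth T z sel v ≤ K + 2 := (h.fragDepth_le v hv).trans (Nat.le_add_right _ _)
  rw [addressAll, fullAddress, h.fragName_eq _ hv h1,
    h.fragAddress_eq v (frag_prop h.tree h.root_mem h.sel_root hv), ← h.localAddress_eq _ hv h1]

theorem Suitable.heavyAll_lt (h : Suitable name T z f m M K R L sel) (v : V) :
    heavyAll P f m M K R (localInput P name T z) sel v < M := by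
  by_cases hne : (children T z v).Nonempty
  · obtain ⟨c, hc⟩ := hne
    obtain ⟨c', hc', he, -⟩ := h.exists_heavy (P := P) hc
    obtain ⟨h', he'⟩ := childPort_eq P h.tree h.root_mem hc'
    rw [← he, he']
    exact (P.port _ _ _).2.trans_le ((G.degree_lt_card_verts _).le.trans h.card_le)
  · rw [heavyAll, heavyPort, dif_neg, h.eq_pow]
    · positivity
    · rw [childPorts_eq P name h.tree h.root_mem]
      simpa using hne

theorem parentPort_lt (v : V) : parentPort (localInput P name T z v) < Fintype.card V := by
  have hpos : 0 < Fintype.card V := Fintype.card_pos_iff.2 ⟨v⟩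
  unfold parentPort
  split_ifs with hex
  · obtain ⟨a, ha⟩ := hex.choose_spec
    obtain ⟨u, hu, hi, -⟩ := (getElem?_ports P name v _ _).1 ha
    rw [hi]
    exact (P.port v u hu).2.trans (G.degree_lt_card_verts v)
  · exact hpos

/-- The results of `treePhase` form a routing scheme, and are small. -/
theorem Suitable.correct (h : Suitable name T z f m M K R L sel) (w : Sym2 V → ℕ) :
    let table := fun v => mkTable (parentPort (localInput P name T z v))
      (heavyAll P f m M K R (localInput P name T z) sel v)
      (addressAll P f m M K R (localInput P name T z) sel v)
    let label := fun v => encode (addressAll P f m M K R (localInput P name T z) sel v)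
    IsRoutingScheme P T w route table label 1 ∧ ∀ v ∈ T.verts,
      ((table v).length ≤ 8 * L ∧ ∀ x ∈ table v, x < M) ∧
        (label v).length ≤ 8 * L ∧ ∀ x ∈ label v, x < M := by
  intro table label
  constructor
  · refine isRoutingScheme_of_address (name := name)
      (heavy := heavyAll P f m M K R (localInput P name T z) sel) h.tree h.root_mem w ?_ ?_
    · intro v hv
      simp only [table]
      rw [h.addressAll_eq hv]
      rfl
    · intro v hv
      simp only [label]
      rw [h.addressAll_eq hv]
      rfl
  · intro v hv
    obtain ⟨h1, h2⟩ := h.encode_small (P := P) hv (a := [])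
      (b := addressAll P f m M K R (localInput P name T z) sel v) (h.addressAll_eq hv).symm
    have h0 := h.pos
    refine ⟨⟨?_, fun x hx => ?_⟩, by simp only [label]; omega, h2⟩
    · simp only [table, mkTable, List.length_cons]
      omega
    · rcases List.mem_cons.1 hx with rfl | hx
      · exact (parentPort_lt v).trans_le h.card_le
      rcases List.mem_cons.1 hx with rfl | hx
      · exact h.heavyAll_lt v
      · exact h2 x hx

end Correctness

/-! ### Probability -/

section Probability

instance : IsProbabilityMeasure coin := by
  unfold coin
  infer_instance

/-- The tapes of the vertices that are sampled in phase `j`. -/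
def hits (j : ℕ) : Set (ℕ → Bool) := {b | ∀ i < j, b i = true}

theorem hits_eq (j : ℕ) : hits j = Set.pi (Finset.range j : Set ℕ) fun _ => {true} := by
  ext b
  simp [hits]

theorem measurableSet_hits (j : ℕ) : MeasurableSet (hits j) := by
  rw [hits_eq]
  exact MeasurableSet.pi (Finset.range j).countable_toSet fun _ _ => measurableSet_singleton _

theorem coin_true : coin {true} = ENNReal.ofReal (1 / 2) := by
  rw [coin, PMF.toMeasure_apply_singleton _ _ (measurableSet_singleton _),
    PMF.uniformOfFintype_apply, Fintype.card_bool]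
  rw [ENNReal.ofReal_div_of_pos (by norm_num)]
  simp

theorem measure_hits (j : ℕ) :
    (Measure.infinitePi fun _ : ℕ => coin) (hits j) = ENNReal.ofReal ((1 / 2) ^ j) := by
  rw [hits_eq, Measure.infinitePi_pi _ fun _ _ => measurableSet_singleton _, coin_true,
    Finset.prod_const, Finset.card_range, ENNReal.ofReal_pow (by norm_num)]

theorem measure_hits_compl (j : ℕ) :
    (Measure.infinitePi fun _ : ℕ => coin) (hits j)ᶜ = ENNReal.ofReal (1 - (1 / 2) ^ j) := by
  rw [prob_compl_eq_one_sub (measurableSet_hits j), measure_hits,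
    ENNReal.ofReal_sub _ (by positivity), ENNReal.ofReal_one]

variable {V : Type} [Fintype V]

open Classical in
-- Independence of the tapes: the event is a box.
theorem tapes_forall_mem (A : Finset V) (s : Set (ℕ → Bool)) :
    tapes V {ω | ∀ v ∈ A, ω v ∈ s} = (Measure.infinitePi fun _ : ℕ => coin) s ^ A.card := by
  have : {ω : V → ℕ → Bool | ∀ v ∈ A, ω v ∈ s} =
      Set.pi Set.univ fun v => if v ∈ A then s else Set.univ := by
    ext ω
    simp only [Set.mem_ofPred_eq, Set.mem_pi, Set.mem_univ, true_imp_iff]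
    refine forall_congr' fun v => ?_
    split_ifs with h <;> simp [h]
  rw [this, tapes, Measure.pi_pi, ← Finset.prod_const, ← Finset.prod_subset (Finset.subset_univ A)]
  · exact Finset.prod_congr rfl fun v hv => by rw [if_pos hv]
  · intro v _ hv
    rw [if_neg hv, measure_univ]

/-- From `1 - x ≤ exp (-x)` and `2 ≤ e`. -/
theorem one_sub_pow_le (j a : ℕ) : (1 - (1 / 2 : ℝ) ^ j) ^ (2 ^ j * a) ≤ (1 / 2) ^ a := by
  rw [pow_mul]
  have h0 : (0 : ℝ) ≤ 1 - (1 / 2) ^ j := sub_nonneg.2 (pow_le_one₀ (by norm_num) (by norm_num))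
  refine pow_le_pow_left₀ (pow_nonneg h0 _) ?_ a
  have h1 : 1 - (1 / 2 : ℝ) ^ j ≤ Real.exp (-(1 / 2) ^ j) := by
    have := Real.add_one_le_exp (-(1 / 2 : ℝ) ^ j)
    linarith
  refine (pow_le_pow_left₀ h0 h1 _).trans ?_
  rw [← Real.exp_nat_mul]
  have h2 : ((2 ^ j : ℕ) : ℝ) * -(1 / 2) ^ j = -1 := by
    push_cast
    rw [mul_neg, ← mul_pow]
    norm_num
  rw [h2, Real.exp_neg, ← one_div]
  refine one_div_le_one_div_of_le (by norm_num) ?_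
  have := Real.add_one_le_exp (1 : ℝ)
  linarith

theorem ofReal_half_pow (a : ℕ) : ENNReal.ofReal ((1 / 2) ^ a) = (2 ^ a)⁻¹ := by
  rw [one_div, inv_pow, ENNReal.ofReal_inv_of_pos (by positivity),
    ENNReal.ofReal_pow (by norm_num), ENNReal.ofReal_ofNat]

theorem tapes_none_hit (j a : ℕ) (A : Finset V) (hA : A.card = 2 ^ j * a) :
    tapes V {ω | ∀ v ∈ A, ω v ∈ (hits j)ᶜ} ≤ (2 ^ a)⁻¹ := by
  rw [tapes_forall_mem, hA, measure_hits_compl,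
    ← ENNReal.ofReal_pow (sub_nonneg.2 (pow_le_one₀ (by norm_num) (by norm_num))),
    ← ofReal_half_pow]
  exact ENNReal.ofReal_le_ofReal (one_sub_pow_le j a)

/-- From `1 + x ≤ exp x`, `n / 2 ^ j ≤ 2 ^ j` and `e ≤ 4`. -/
theorem one_add_pow_le {n j : ℕ} (hn : n ≤ 4 ^ j) :
    (1 + (1 / 2 : ℝ) ^ j) ^ n ≤ 2 ^ (2 * 2 ^ j) := by
  have h1 : 1 + (1 / 2 : ℝ) ^ j ≤ Real.exp ((1 / 2) ^ j) := by
    rw [add_comm]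
    exact Real.add_one_le_exp _
  refine (pow_le_pow_left₀ (by positivity) h1 n).trans ?_
  rw [← Real.exp_nat_mul, pow_mul]
  have h2 : (n : ℝ) * (1 / 2) ^ j ≤ (2 ^ j : ℕ) * 1 := by
    have h3 : (n : ℝ) ≤ 4 ^ j := by exact_mod_cast hn
    calc (n : ℝ) * (1 / 2) ^ j ≤ 4 ^ j * (1 / 2) ^ j := by gcongr
      _ = (2 ^ j : ℕ) * 1 := by
        rw [← mul_pow]
        push_cast
        norm_num
  refine (Real.exp_le_exp.2 h2).trans ?_
  rw [Real.exp_nat_mul]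
  refine pow_le_pow_left₀ (Real.exp_pos _).le ?_ _
  have := Real.exp_one_lt_d9
  linarith

open Classical in
-- Markov's inequality for `2 ^ |X|`. This counts the subsets of `X`, so by independence its mean is
-- `∑ p ^ |A| = (1 + p) ^ n` over all sets `A` of vertices, with `p = 2 ^ (-j)`.
theorem tapes_many_hits {j : ℕ} (hn : Fintype.card V ≤ 4 ^ j) (k : ℕ) :
    tapes V {ω | 2 * 2 ^ j + k ≤ (Finset.univ.filter fun v => ω v ∈ hits j).card} ≤
      (2 ^ k)⁻¹ := by
  set X : (V → ℕ → Bool) → Finset V := fun ω => Finset.univ.filter fun v => ω v ∈ hits j with hX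
  have hmeas : ∀ A : Finset V, MeasurableSet {ω : V → ℕ → Bool | ∀ v ∈ A, ω v ∈ hits j} := by
    intro A
    have : {ω : V → ℕ → Bool | ∀ v ∈ A, ω v ∈ hits j} =
        ⋂ v ∈ A, (fun ω => ω v) ⁻¹' hits j := by
      ext ω
      simp
    rw [this]
    exact Finset.measurableSet_biInter A fun v _ => measurable_pi_apply v (measurableSet_hits j)
  set F : (V → ℕ → Bool) → ℝ≥0∞ := fun ω => ∑ A : Finset V,
    Set.indicator {ω : V → ℕ → Bool | ∀ v ∈ A, ω v ∈ hits j} 1 ω with hF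
  have hFm : Measurable F :=
    Finset.measurable_fun_sum _ fun A _ => measurable_one.indicator (hmeas A)
  have hF2 : ∀ ω, F ω = 2 ^ (X ω).card := by
    intro ω
    simp only [hF, Set.indicator_apply, Set.mem_ofPred_eq, Pi.one_apply]
    rw [Finset.sum_boole]
    have : (Finset.univ.filter fun A : Finset V => ∀ v ∈ A, ω v ∈ hits j) = (X ω).powerset := by
      ext A
      simp [hX, Finset.subset_iff]
    rw [this, Finset.card_powerset]
    push_cast
    rfl
  have hint : ∫⁻ ω, F ω ∂tapes V ≤ 2 ^ (2 * 2 ^ j) := by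
    rw [hF, lintegral_finsetSum _ fun A _ => measurable_one.indicator (hmeas A)]
    have h1 : ∀ A : Finset V, ∫⁻ ω, Set.indicator {ω : V → ℕ → Bool | ∀ v ∈ A, ω v ∈ hits j} 1 ω
        ∂tapes V = ENNReal.ofReal (((1 / 2) ^ j) ^ A.card) := by
      intro A
      rw [lintegral_indicator_one (hmeas A), tapes_forall_mem, measure_hits]
      exact (ENNReal.ofReal_pow (by positivity) _).symm
    simp only [h1]
    rw [← ENNReal.ofReal_sum_of_nonneg fun A _ => by positivity]
    have h2 : ∑ A : Finset V, ((1 / 2 : ℝ) ^ j) ^ A.card =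
        (1 + (1 / 2) ^ j) ^ Fintype.card V := by
      have := Finset.sum_pow_mul_eq_add_pow ((1 / 2 : ℝ) ^ j) 1 (Finset.univ : Finset V)
      simp only [one_pow, mul_one, Finset.powerset_univ, Finset.card_univ] at this
      rw [this, add_comm]
    rw [h2]
    refine (ENNReal.ofReal_le_ofReal (one_add_pow_le hn)).trans_eq ?_
    rw [ENNReal.ofReal_pow (by norm_num), ENNReal.ofReal_ofNat]
  have hsub : {ω | 2 * 2 ^ j + k ≤ (X ω).card} ⊆ {ω | (2 : ℝ≥0∞) ^ (2 * 2 ^ j + k) ≤ F ω} := by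
    intro ω hω
    rw [Set.mem_ofPred_eq, hF2]
    exact pow_le_pow_right₀ (by norm_num) hω
  refine (measure_mono hsub).trans ((meas_ge_le_lintegral_div hFm.aemeasurable (by positivity)
    (by finiteness)).trans ?_)
  refine (ENNReal.div_le_div_right hint _).trans ?_
  rw [pow_add, ← one_div]
  refine (ENNReal.div_le_iff (by positivity) (by finiteness)).2 ?_
  rw [mul_comm (2 ^ (2 * 2 ^ j)), ← mul_assoc, one_div, ENNReal.inv_mul_cancel (by positivity)
    (by finiteness), one_mul]

variable {G : SimpleGraph V} {T : G.Subgraph} {z : V}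

/-- The roots of the fragments in phase `j`. -/
def fragRoots (T : G.Subgraph) (z : V) (ω : V → ℕ → Bool) (j : ℕ) (v : V) : Prop :=
  v ∈ T.verts ∧ (v = z ∨ ω v ∈ hits j)

/-- If the root is not reached within `2 ^ j * a` steps, then that many distinct ancestors, counted
from `v` itself, must all be missed by the sampling. -/
theorem tapes_fragDepth (hT : T.coe.IsTree) (hz : z ∈ T.verts) (j a : ℕ) {v : V}
    (hv : v ∈ T.verts) :
    tapes V {ω | 2 ^ j * a < fragDepth T z (fragRoots T z ω j) v} ≤ (2 ^ a)⁻¹ := by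
  classical
  have hle : ∀ ω i, fragRoots T z ω j ((par T z)^[i] v) →
      fragDepth T z (fragRoots T z ω j) v ≤ i := fun ω i hi => Nat.sInf_le hi
  by_cases hex : ∃ i ≤ 2 ^ j * a, (par T z)^[i] v = z
  · obtain ⟨i, hi, he⟩ := hex
    refine le_trans (le_of_eq (measure_mono_null (fun ω hω => ?_) measure_empty)) zero_le
    have := hle ω i (he.symm ▸ ⟨hz, Or.inl rfl⟩)
    rw [Set.mem_ofPred_eq] at hω
    omega
  · push Not at hex
    have hcard : ((Finset.range (2 ^ j * a)).image fun i => (par T z)^[i] v).card = 2 ^ j * a := by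
      rw [Finset.card_image_of_injOn, Finset.card_range]
      have hpos : ∀ i ≤ 2 ^ j * a, 0 < depth T z v - i := by
        intro i hi
        rw [← depth_iterate_par hT hz hv]
        exact Nat.pos_of_ne_zero fun h0 =>
          hex i hi ((depth_eq_zero hT hz (iterate_par_mem hT hz hv i)).1 h0)
      intro i hi k hk hik
      have h1 := congrArg (depth T z) hik
      simp only [depth_iterate_par hT hz hv] at h1
      have h2 := hpos i (Finset.mem_range.1 hi).le
      have h3 := hpos k (Finset.mem_range.1 hk).le
      omega
    refine le_trans (measure_mono fun ω hω => ?_) (tapes_none_hit j a _ hcard)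
    rw [Set.mem_ofPred_eq] at hω ⊢
    intro u hu hhit
    obtain ⟨i, hi, rfl⟩ := Finset.mem_image.1 hu
    have := hle ω i ⟨iterate_par_mem hT hz hv i, Or.inr hhit⟩
    have := Finset.mem_range.1 hi
    omega

/-- The strict inequality absorbs the root, which is selected without being sampled. -/
theorem tapes_card_fragRoots {j : ℕ} (hn : Fintype.card V ≤ 4 ^ j) {k N : ℕ}
    (hN : 2 * 2 ^ j + k ≤ N) :
    tapes V {ω | N < Nat.card {v // fragRoots T z ω j v}} ≤ (2 ^ k)⁻¹ := by
  classical
  refine le_trans (measure_mono fun ω hω => ?_) (tapes_many_hits hn k)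
  rw [Set.mem_ofPred_eq] at hω ⊢
  rw [Nat.subtype_card (Finset.univ.filter (fragRoots T z ω j)) (by simp)] at hω
  have h1 : (Finset.univ.filter (fragRoots T z ω j)).card ≤
      (insert z (Finset.univ.filter fun v => ω v ∈ hits j)).card := by
    refine Finset.card_le_card fun v hv => ?_
    rcases (Finset.mem_filter.1 hv).2.2 with rfl | h
    · exact Finset.mem_insert_self _ _
    · exact Finset.mem_insert_of_mem (Finset.mem_filter.2 ⟨Finset.mem_univ v, h⟩)
  have h2 := Finset.card_insert_le z (Finset.univ.filter fun v => ω v ∈ hits j)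
  omega

/-- With high probability, in all the first phases the fragments have small depth, and in the last
of them there are few fragments. -/
theorem tapes_bad_le (hT : T.coe.IsTree) (hz : z ∈ T.verts) {c L J : ℕ} (hL : 1 ≤ L)
    (hn : Fintype.card V ≤ 2 ^ L) (hJ : J + 1 ≤ 2 ^ (L + 2)) (hnJ : Fintype.card V ≤ 4 ^ J) :
    tapes V {ω | (∃ j ≤ J, ∃ v ∈ T.verts,
        budget (c + 6) j L < fragDepth T z (fragRoots T z ω j) v) ∨
      budget (c + 6) J L < Nat.card {v // fragRoots T z ω J v}} ≤
      ((Fintype.card V : ℝ≥0∞) ^ c)⁻¹ := by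
  classical
  have hsub : {ω | (∃ j ≤ J, ∃ v ∈ T.verts,
        budget (c + 6) j L < fragDepth T z (fragRoots T z ω j) v) ∨
      budget (c + 6) J L < Nat.card {v // fragRoots T z ω J v}} ⊆
      (⋃ j ∈ Finset.range (J + 1), ⋃ v ∈ Finset.univ.filter (· ∈ T.verts),
        {ω | 2 ^ j * ((c + 6) * L) < fragDepth T z (fragRoots T z ω j) v}) ∪
      {ω | budget (c + 6) J L < Nat.card {v // fragRoots T z ω J v}} := by
    rintro ω (⟨j, hj, v, hv, h⟩ | h)
    · left
      simp only [Set.mem_iUnion]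
      exact ⟨j, Finset.mem_range.2 (by omega), v, by simpa using hv, h⟩
    · exact Or.inr h
  -- Each of the two kinds of failure may take half of `2 ^ (-c * L)`. The union bound over phases
  -- and vertices costs `2 * L + 2` in the exponent, which the extra `6 * L` in the budget covers.
  -- Phases may reuse coins, since no independence between them is used.
  have hbound : ∀ {a : ℕ}, c * L + 1 ≤ a → ((2 : ℝ≥0∞) ^ a)⁻¹ ≤ (2 ^ (c * L + 1))⁻¹ := fun h =>
    ENNReal.inv_le_inv.2 (pow_le_pow_right₀ (by norm_num) h)
  have h1 : tapes V (⋃ j ∈ Finset.range (J + 1), ⋃ v ∈ Finset.univ.filter (· ∈ T.verts),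
      {ω | 2 ^ j * ((c + 6) * L) < fragDepth T z (fragRoots T z ω j) v}) ≤
      (2 ^ (c * L + 1))⁻¹ := by
    calc _ ≤ ∑ j ∈ Finset.range (J + 1), ∑ v ∈ Finset.univ.filter (· ∈ T.verts),
          ((2 : ℝ≥0∞) ^ ((c + 6) * L))⁻¹ := by
          refine (measure_biUnion_finset_le _ _).trans (Finset.sum_le_sum fun j _ => ?_)
          refine (measure_biUnion_finset_le _ _).trans (Finset.sum_le_sum fun v hv => ?_)
          exact tapes_fragDepth hT hz j _ (Finset.mem_filter.1 hv).2
      _ ≤ (2 ^ (L + 2) * 2 ^ L : ℕ) * ((2 : ℝ≥0∞) ^ ((c + 6) * L))⁻¹ := by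
          rw [Finset.sum_const, Finset.sum_const, Finset.card_range, smul_smul, nsmul_eq_mul]
          gcongr
          exact (Finset.card_le_univ _).trans hn
      _ = ((2 : ℝ≥0∞) ^ ((c + 6) * L - (2 * L + 2)))⁻¹ := by
          have he : (c + 6) * L = ((c + 6) * L - (2 * L + 2)) + (L + 2 + L) := by
            have : (c + 6) * L = c * L + 6 * L := by ring
            omega
          conv_lhs => rw [he]
          rw [pow_add _ _ (L + 2 + L), ENNReal.mul_inv (by simp) (by simp), ← pow_add]
          push_cast
          rw [mul_comm, mul_assoc, ENNReal.inv_mul_cancel (by positivity) (by finiteness), mul_one]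
      _ ≤ _ := hbound (by
          have : (c + 6) * L = c * L + 6 * L := by ring
          omega)
  have h2 : tapes V {ω | budget (c + 6) J L < Nat.card {v // fragRoots T z ω J v}} ≤
      (2 ^ (c * L + 1))⁻¹ := by
    refine tapes_card_fragRoots hnJ ?_
    unfold budget
    have h3 : 1 ≤ 2 ^ J := Nat.one_le_two_pow
    have h4 : 2 + (c * L + 1) ≤ (c + 6) * L := by
      have : (c + 6) * L = c * L + 6 * L := by ring
      omega
    calc 2 * 2 ^ J + (c * L + 1) ≤ 2 ^ J * 2 + 2 ^ J * (c * L + 1) := by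
          have := Nat.le_mul_of_pos_left (c * L + 1) h3
          omega
      _ = 2 ^ J * (2 + (c * L + 1)) := by ring
      _ ≤ _ := Nat.mul_le_mul_left _ h4
  refine (measure_mono hsub).trans ((measure_union_le _ _).trans ((add_le_add h1 h2).trans ?_))
  rw [← two_mul, pow_succ, ENNReal.mul_inv (by simp) (by simp), mul_comm, mul_assoc,
    ENNReal.inv_mul_cancel (by norm_num) (by norm_num), mul_one, Nat.mul_comm, pow_mul]
  refine ENNReal.inv_le_inv.2 (pow_le_pow_left₀ zero_le ?_ c)
  exact_mod_cast hn

end Probability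

/-! ### Running the phases -/

section Phases

theorem lt_two_pow_lg (n : ℕ) : n < 2 ^ lg n := Nat.lt_pow_succ_log_self (by norm_num) n

theorem lg_pos (n : ℕ) : 1 ≤ lg n := Nat.succ_pos _

theorem IsWord.mono {C C' n x : ℕ} (h : IsWord C n x) (hC : C ≤ C') : IsWord C' n x :=
  lt_of_lt_of_le h (Nat.pow_le_pow_right (by norm_num) (Nat.mul_le_mul_right _ hC))

theorem dist_le_diam {V : Type} [Finite V] {G : SimpleGraph V} (hG : G.Connected) (u v : V) : G.dist u v ≤ G.diam := by
  have : Nonempty V := ⟨u⟩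
  exact SimpleGraph.dist_le_diam (SimpleGraph.connected_iff_ediam_ne_top.1 hG)

variable {V : Type} [Fintype V]

/-- The number of digits of the largest name. -/
def nameLength (name : V → ℕ) : ℕ := lg (Finset.univ.sup name + 1)

theorem one_le_nameLength (name : V → ℕ) : 1 ≤ nameLength name := lg_pos _

theorem name_lt_two_pow (name : V → ℕ) (v : V) : name v < 2 ^ nameLength name := by
  have h1 := Finset.le_sup (f := name) (Finset.mem_univ v)
  have h2 := lt_two_pow_lg (Finset.univ.sup name + 1)
  unfold nameLength
  omega

/-- Distinct names force the largest one to be at least `n - 1`, so it yields an upper bound for the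
unknown `n`. -/
theorem card_lt_two_pow {name : V → ℕ} (hname : Function.Injective name) :
    Fintype.card V < 2 ^ nameLength name := by
  have h1 : Fintype.card V ≤ Finset.univ.sup name + 1 := by
    rw [← Finset.card_range (Finset.univ.sup name + 1), ← Finset.card_univ,
      ← Finset.card_image_of_injective _ hname]
    refine Finset.card_le_card fun x hx => ?_
    obtain ⟨v, -, rfl⟩ := Finset.mem_image.1 hx
    exact Finset.mem_range.2 (Nat.lt_succ_of_le (Finset.le_sup (Finset.mem_univ v)))
  exact h1.trans_lt (lt_two_pow_lg _)

theorem nameLength_le [Nonempty V] {name : V → ℕ} {κ : ℕ}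
    (hκ : ∀ v, IsWord κ (Fintype.card V) (name v)) :
    nameLength name ≤ (κ + 1) * lg (Fintype.card V) := by
  obtain ⟨v, -, hv⟩ := Finset.exists_mem_eq_sup Finset.univ Finset.univ_nonempty name
  have h1 : Finset.univ.sup name + 1 ≤ 2 ^ (κ * lg (Fintype.card V)) := by
    rw [hv]
    exact hκ v
  have h2 := Nat.log_mono_right (b := 2) h1
  rw [Nat.log_pow (by norm_num)] at h2
  have h3 := lg_pos (Fintype.card V)
  unfold nameLength
  rw [lg, Nat.add_mul, one_mul]
  omega

variable {G : SimpleGraph V} [DecidableRel G.Adj] (P : PortNumbering G) (name : V → ℕ)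
  (T : G.Subgraph) (z : V) {C κ : ℕ}

/-- All vertices agree on the largest name. -/
def Agreement (j : ℕ) : Prop :=
  ∀ v, maxAll P (2 * 2 ^ j) (disagreement P name (2 ^ j)) v = 0

/-- Phase `j` produces an output. -/
def Passes (q : ℕ) (ω : V → ℕ → Bool) (j : ℕ) : Prop :=
  Agreement P name j ∧ Nat.card {v // fragRoots T z ω j v} ≤ budget q j (nameLength name)

/-- A bound for the number of rounds of phase `j`. -/
def phaseLength (q j L : ℕ) : ℕ := 2 ^ j * ((48 * q + 101) * L ^ 2)

/-- With `s = 2 ^ j`: the budget occurs in six floods of `8 * L` words, giving `48 * q`; the radius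
`2 * s` occurs in three, giving `48`; the additive `2` of the three relays gives `48`; and `3 * s +
2 ≤ 5 * s` rounds remain. -/
theorem length_le_phaseLength (q j : ℕ) {L : ℕ} (hL : 1 ≤ L) :
    2 ^ j + (1 + (2 * 2 ^ j + ((budget q j L + 2 * 2 ^ j) * (8 * L) +
      (3 * ((budget q j L + 2) * (8 * L)) +
        2 * ((budget q j L + 2 * 2 ^ j) * (8 * L)))))) + 1 ≤ phaseLength q j L := by
  unfold budget phaseLength
  have hs : 1 ≤ 2 ^ j := Nat.one_le_two_pow
  generalize 2 ^ j = s at hs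
  have h1 : L ≤ L ^ 2 := Nat.le_self_pow (by norm_num) L
  have h2 : s ≤ s * L ^ 2 := Nat.le_mul_of_pos_right _ (by positivity)
  have h3 : s * L ≤ s * L ^ 2 := Nat.mul_le_mul_left _ h1
  have h4 : L ≤ s * L := Nat.le_mul_of_pos_left _ hs
  nlinarith

variable {P name T z}

theorem selected_iff (hT : T.coe.IsTree) (hz : z ∈ T.verts) (ω : V → ℕ → Bool) (j : ℕ) (v : V) :
    Selected (localInput P name T z v) (ω v) j ↔ fragRoots T z ω j v := by
  unfold Selected fragRoots
  rw [isRoot_iff P name hT hz]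
  simp [localInput, hits]

/-- The tables and labels that are the result of phase `j`. -/
noncomputable def phaseResult (P : PortNumbering G) (name : V → ℕ) (T : G.Subgraph) (z : V)
    (q : ℕ) (ω : V → ℕ → Bool) (j : ℕ) (v : V) : List ℕ × List ℕ :=
  let h := heavyAll P (clip (nameLength name)) (8 * nameLength name) (2 ^ nameLength name)
    (budget q j (nameLength name)) (2 * 2 ^ j) (localInput P name T z) (fragRoots T z ω j)
  let a := addressAll P (clip (nameLength name)) (8 * nameLength name) (2 ^ nameLength name)
    (budget q j (nameLength name)) (2 * 2 ^ j) (localInput P name T z) (fragRoots T z ω j)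
  (mkTable (parentPort (localInput P name T z v)) (h v) (a v), encode (a v))

/-- Before agreement is established the vertices may hold different maxima, so the parameters of
`countPhase` are written with the local ones. -/
theorem exec_phase_of (hG : G.Connected) (hC : 1 ≤ C)
    (hw : ∀ v, IsWord C (Fintype.card V) (name v)) (hT : T.coe.IsTree) (hz : z ∈ T.verts)
    {q j : ℕ} {ω : V → ℕ → Bool} {T' : ℕ} {b : V → Option (List ℕ × List ℕ)}
    (h : Exec P C (fun v =>
      if maxAll P (2 * 2 ^ j) (disagreement P name (2 ^ j)) v = 0 then
        countPhase (clip (lg (maxAll P (2 ^ j) name v + 1))) (8 * lg (maxAll P (2 ^ j) name v + 1))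
          (2 ^ lg (maxAll P (2 ^ j) name v + 1)) (budget q j (lg (maxAll P (2 ^ j) name v + 1)))
          (2 * 2 ^ j) (localInput P name T z v) (fragRoots T z ω j v)
      else .ret none) T' b) :
    Exec P C (fun v => phase q (localInput P name T z v) (ω v) j)
      (2 ^ j + (1 + (2 * 2 ^ j + T'))) b := by
  have h1 := exec_maxFlood hG P hC (2 ^ j) name hw
  have h2 := exec_xchg (P := P) hC id 1 (fun v _ => [maxAll P (2 ^ j) name v]) fun v i x hx => by
    obtain ⟨u, -, hu⟩ := maxAll_eq hG P (2 ^ j) name v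
    rw [List.mem_singleton.1 hx, hu]
    exact hw u
  have h3 := exec_maxFlood hG P hC (2 * 2 ^ j) (disagreement P name (2 ^ j)) fun v => by
    have h5 : 1 < 2 ^ (C * lg (Fintype.card V)) := Nat.one_lt_two_pow
      (Nat.mul_pos hC (lg_pos _)).ne'
    unfold disagreement IsWord
    split_ifs <;> omega
  simp only [← selected_iff (P := P) (name := name) hT hz] at h
  have h4 := h1.bind (f := fun v a =>
    (xchg id 1 fun _ => [a]).bind fun y =>
    (maxFlood (G.degree v) (2 * 2 ^ j)
      (open Classical in if ∃ i < G.degree v, y i ≠ [a] then 1 else 0)).bind fun bad =>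
    if bad = 0 then
      countPhase (clip (lg (a + 1))) (8 * lg (a + 1)) (2 ^ lg (a + 1)) (budget q j (lg (a + 1)))
        (2 * 2 ^ j) (localInput P name T z v) (Selected (localInput P name T z v) (ω v) j)
    else .ret none) (h2.bind (f := fun v y =>
    (maxFlood (G.degree v) (2 * 2 ^ j)
      (open Classical in if ∃ i < G.degree v, y i ≠ [maxAll P (2 ^ j) name v] then 1
        else 0)).bind fun bad =>
    if bad = 0 then
      countPhase (clip (lg (maxAll P (2 ^ j) name v + 1))) (8 * lg (maxAll P (2 ^ j) name v + 1))
        (2 ^ lg (maxAll P (2 ^ j) name v + 1)) (budget q j (lg (maxAll P (2 ^ j) name v + 1)))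
        (2 * 2 ^ j) (localInput P name T z v) (Selected (localInput P name T z v) (ω v) j)
    else .ret none) (h3.bind h))
  simp only [← length_ports P name (T := T) (z := z)] at h4
  exact h4

theorem isWord_clip {L : ℕ} (hL : 4 * L ≤ C * lg (Fintype.card V)) (x : ℕ) :
    IsWord C (Fintype.card V) (clip L x) :=
  (Nat.mod_lt _ (by positivity)).trans_le (Nat.pow_le_pow_right (by norm_num) hL)

theorem exec_phase (hG : G.Connected) (hT : T.coe.IsTree) (hz : z ∈ T.verts)
    (hname : Function.Injective name) (hκ : ∀ v, IsWord κ (Fintype.card V) (name v))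
    (hC : 4 * (κ + 1) ≤ C) (q j : ℕ) (ω : V → ℕ → Bool) :
    (¬ Passes P name T z q ω j → ∃ t, t + 1 ≤ phaseLength q j (nameLength name) ∧
      Exec P C (fun v => phase q (localInput P name T z v) (ω v) j) t fun _ => none) ∧
    (Passes P name T z q ω j → ∃ t, t + 1 ≤ phaseLength q j (nameLength name) ∧
      Exec P C (fun v => phase q (localInput P name T z v) (ω v) j) t fun v =>
        some (phaseResult P name T z q ω j v)) := by
  have : Nonempty V := ⟨z⟩
  have hC1 : 1 ≤ C := by omega
  have hw : ∀ v, IsWord C (Fintype.card V) (name v) := fun v => (hκ v).mono (by omega)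
  have hlen := length_le_phaseLength q j (one_le_nameLength name)
  by_cases hag : Agreement P name j
  · obtain ⟨v₀⟩ := ‹Nonempty V›
    obtain ⟨h1, h2, h3⟩ := of_agreement P name hG hname (hag v₀)
    have hL := nameLength_le hκ
    have hclip : ∀ x, IsWord C (Fintype.card V) (clip (nameLength name) x) := isWord_clip (by
      refine (Nat.mul_le_mul_left 4 hL).trans ?_
      rw [← Nat.mul_assoc]
      exact Nat.mul_le_mul_right _ hC)
    have hexec := exec_countPhase P (clip (nameLength name)) (8 * nameLength name)
      (2 ^ nameLength name) (budget q j (nameLength name)) (2 * 2 ^ j) (localInput P name T z)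
      (fragRoots T z ω j) hC1 hclip (length_ports P name) hG h1 hname (fun v => by
        have h4 : 1 ≤ 8 * nameLength name := by have := one_le_nameLength name; omega
        rw [List.take_of_length_le (by simpa using h4), List.map_singleton, clip,
          Nat.mod_eq_of_lt]
        exact (name_lt_two_pow name v).trans_le (Nat.pow_le_pow_right (by norm_num) (by omega)))
      rfl
    have hstep : ∀ {t b}, Exec P C (fun v => countPhase (clip (nameLength name))
        (8 * nameLength name) (2 ^ nameLength name) (budget q j (nameLength name)) (2 * 2 ^ j)
        (localInput P name T z v) (fragRoots T z ω j v)) t b →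
        Exec P C (fun v => phase q (localInput P name T z v) (ω v) j)
          (2 ^ j + (1 + (2 * 2 ^ j + t))) b := by
      intro t b h
      refine exec_phase_of hG hC1 hw hT hz ?_
      -- Agreement turns every local maximum into the global one, and all vertices use the same
      -- parameters.
      simp only [h2, h3, if_true]
      exact h
    constructor
    · intro hnot
      refine ⟨_, ?_, hstep (hexec.1 ?_)⟩
      · omega
      · by_contra h
        exact hnot ⟨hag, not_lt.1 h⟩
    · intro hpass
      exact ⟨_, hlen, hstep (hexec.2 hpass.2)⟩
  · constructor
    · intro _
      -- One vertex without an alarm would force agreement everywhere, so all vertices abort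
      -- together.
      have hne : ∀ v, maxAll P (2 * 2 ^ j) (disagreement P name (2 ^ j)) v ≠ 0 := fun v hv =>
        hag (of_agreement P name hG hname hv).2.2
      refine ⟨_, ?_, exec_phase_of hG hC1 hw hT hz (T' := 0) ?_⟩
      · omega
      · simp only [if_neg (hne _)]
        exact Exec.ret _
    · intro hpass
      exact absurd hpass.1 hag

theorem sum_phaseLength_le (q J L : ℕ) :
    ∑ j ∈ Finset.range (J + 1), phaseLength q j L ≤ 2 * phaseLength q J L := by
  unfold phaseLength
  rw [← Finset.sum_mul, ← Nat.mul_assoc 2]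
  refine Nat.mul_le_mul_right _ ?_
  rw [Nat.geomSum_eq le_rfl, pow_succ]
  omega

/-- The algorithm. -/
noncomputable def treeRoutingAlg (q : ℕ) : Algorithm LocalInput (List ℕ × List ℕ) :=
  loopAlg (phase q)

theorem run_treeRoutingAlg (hG : G.Connected) (hT : T.coe.IsTree) (hz : z ∈ T.verts)
    (hname : Function.Injective name) (hκ : ∀ v, IsWord κ (Fintype.card V) (name v))
    (hC : 4 * (κ + 1) ≤ C) {q J : ℕ} {ω : V → ℕ → Bool} (hJ : Passes P name T z q ω J)
    (hJ' : ∀ j < J, ¬ Passes P name T z q ω j) :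
    (∀ t, 2 * phaseLength q J (nameLength name) ≤ t → ∀ v,
      (treeRoutingAlg q).output ((treeRoutingAlg q).run P (localInput P name T z) ω t v) =
        some (phaseResult P name T z q ω J v)) ∧
      ∀ t, SmallAt (treeRoutingAlg q) P (localInput P name T z) ω C t := by
  classical
  have hex : ∀ j, ∃ t, t + 1 ≤ phaseLength q j (nameLength name) ∧
      (j < J → Exec P C (fun v => phase q (localInput P name T z v) (ω v) j) t fun _ => none) ∧
      (j = J → Exec P C (fun v => phase q (localInput P name T z v) (ω v) j) t fun v =>
        some (phaseResult P name T z q ω j v)) := by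
    intro j
    obtain ⟨h1, h2⟩ := exec_phase hG hT hz hname hκ hC q j ω
    by_cases hp : Passes P name T z q ω j
    · obtain ⟨t, ht, he⟩ := h2 hp
      exact ⟨t, ht, fun hj => absurd hp (hJ' j hj), fun _ => he⟩
    · obtain ⟨t, ht, he⟩ := h1 hp
      exact ⟨t, ht, fun _ => he, fun hj => absurd (hj ▸ hJ) hp⟩
  choose t ht h1 h2 using hex
  obtain ⟨h3, h4⟩ := loopAlg_spec (body := phase q) (P := P) (inp := localInput P name T z) (ω := ω)
    (J := J) (T := t) (fun j hj => h1 j hj) (h2 J rfl)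
  refine ⟨fun s hs v => h3 s (le_trans ?_ hs) v, h4⟩
  exact (Finset.sum_le_sum fun j _ => ht j).trans (sum_phaseLength_le q J _)

theorem passes_of_le (hG : G.Connected) {q : ℕ} {ω : V → ℕ → Bool} {j : ℕ} (hj : G.diam ≤ 2 ^ j)
    (hcard : Nat.card {v // fragRoots T z ω j v} ≤ budget q j (nameLength name)) :
    Passes P name T z q ω j :=
  ⟨agreement_of_dist_le P name hG fun u v => (dist_le_diam hG u v).trans hj, hcard⟩

/-- Once `2 ^ j` exceeds both `D` and `n`, both checks pass however many vertices are sampled; so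
termination is certain, not just likely. -/
theorem exists_first_pass (hG : G.Connected) {q : ℕ} (hq : 1 ≤ q) (ω : V → ℕ → Bool) :
    ∃ J, Passes P name T z q ω J ∧ ∀ j < J, ¬ Passes P name T z q ω j := by
  classical
  have hex : ∃ J, Passes P name T z q ω J := by
    refine ⟨G.diam + Fintype.card V, passes_of_le hG ?_ ?_⟩
    · exact (Nat.le_add_right _ _).trans Nat.lt_two_pow_self.le
    · rw [Nat.card_eq_fintype_card]
      refine (Fintype.card_subtype_le _).trans ((Nat.le_add_left _ G.diam).trans
        (Nat.lt_two_pow_self.le.trans (Nat.le_mul_of_pos_right _ ?_)))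
      exact Nat.mul_pos hq (one_le_nameLength name)
  exact ⟨Nat.find hex, Nat.find_spec hex, fun j hj => Nat.find_min hex hj⟩

/-- If the sampling is good, the algorithm succeeds. -/
theorem succeeds_of_good (hG : G.Connected) (hT : T.coe.IsTree) (hz : z ∈ T.verts)
    (hname : Function.Injective name) (hκ : ∀ v, IsWord κ (Fintype.card V) (name v))
    (hC : 8 * (κ + 1) ≤ C) (w : Sym2 V → ℕ) {q : ℕ} (hq : 1 ≤ q) {ω : V → ℕ → Bool} {J t : ℕ}
    (hJ : G.diam ≤ 2 ^ J)
    (hgood : ¬ ((∃ j ≤ J, ∃ v ∈ T.verts,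
        budget q j (nameLength name) < fragDepth T z (fragRoots T z ω j) v) ∨
      budget q J (nameLength name) < Nat.card {v // fragRoots T z ω J v}))
    (ht : 2 * phaseLength q J (nameLength name) ≤ t) :
    Succeeds (treeRoutingAlg q) route P name T z w 1 C t ω := by
  have : Nonempty V := ⟨z⟩
  push Not at hgood
  obtain ⟨hdepth, hcard⟩ := hgood
  obtain ⟨I, hI, hI'⟩ := exists_first_pass (P := P) (name := name) (T := T) (z := z) hG hq ω
  -- The passing phase `I` may precede `J`; this is why the fragment depths must be good in all
  -- phases up to `J`, although few fragments are needed only in phase `J`.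
  have hIJ : I ≤ J := by
    by_contra h
    exact hI' J (by omega) (passes_of_le hG hJ hcard)
  have hrun := (run_treeRoutingAlg hG hT hz hname hκ (by omega : 4 * (κ + 1) ≤ C) hI hI').1 t
    (le_trans (Nat.mul_le_mul_left 2 (Nat.mul_le_mul_right _
      (Nat.pow_le_pow_right (by norm_num) hIJ))) ht)
  have hsuit : Suitable name T z (clip (nameLength name)) (8 * nameLength name)
      (2 ^ nameLength name) (budget q I (nameLength name)) (2 * 2 ^ I) (nameLength name)
      (fragRoots T z ω I) :=
    { connected := hG
      dist_le := (of_agreement P name hG hname (hI.1 z)).1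
      tree := hT
      root_mem := hz
      name_inj := hname
      name_lt := name_lt_two_pow name
      card_le := (card_lt_two_pow hname).le
      eq_pow := rfl
      pos := one_le_nameLength name
      length_eq := rfl
      map_eq := fun x hx => Nat.mod_eq_of_lt (by rwa [← pow_mul, Nat.mul_comm] at hx)
      sel_root := ⟨hz, Or.inl rfl⟩
      mem_of_sel := fun v hv => hv.1
      -- This is the one requirement that depends on the coins and is not checked by the algorithm.
      fragDepth_le := hdepth I hIJ
      card_sel_le := hI.2 }
  obtain ⟨h1, h2⟩ := hsuit.correct (P := P) w
  have hL : 8 * nameLength name ≤ C * lg (Fintype.card V) := by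
    refine (Nat.mul_le_mul_left 8 (nameLength_le hκ)).trans ?_
    rw [← Nat.mul_assoc]
    exact Nat.mul_le_mul_right _ hC
  have hword : ∀ x < 2 ^ nameLength name, IsWord C (Fintype.card V) x := fun x hx =>
    lt_of_lt_of_le hx (Nat.pow_le_pow_right (by norm_num) (by omega))
  refine ⟨_, _, fun v hv => ⟨hrun v, ?_, ?_⟩, h1⟩
  · obtain ⟨⟨h3, h4⟩, -⟩ := h2 v hv
    exact ⟨h3.trans hL, fun x hx => hword x (h4 x hx)⟩
  · obtain ⟨-, h3, h4⟩ := h2 v hv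
    refine ⟨h3.trans (hL.trans (Nat.mul_le_mul_left C ?_)), fun x hx => hword x (h4 x hx)⟩
    exact Nat.le_self_pow (by norm_num) _

end Phases

/-! ### The running time -/

section Time

/-- The index of the first phase whose radius is at least `√n + D`. -/
def goodPhase (n D : ℕ) : ℕ := Nat.clog 2 (D + Nat.sqrt n + 1)

theorem diam_le_two_pow_goodPhase (n D : ℕ) : D ≤ 2 ^ goodPhase n D :=
  le_trans (by omega) (Nat.le_pow_clog (by norm_num) (D + Nat.sqrt n + 1))

theorem card_le_four_pow_goodPhase (n D : ℕ) : n ≤ 4 ^ goodPhase n D := by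
  have h1 : Nat.sqrt n + 1 ≤ 2 ^ goodPhase n D :=
    le_trans (by omega) (Nat.le_pow_clog (by norm_num) (D + Nat.sqrt n + 1))
  calc n ≤ (Nat.sqrt n + 1) * (Nat.sqrt n + 1) := (Nat.lt_succ_sqrt n).le
    _ ≤ 2 ^ goodPhase n D * 2 ^ goodPhase n D := Nat.mul_le_mul h1 h1
    _ = 4 ^ goodPhase n D := (mul_pow 2 2 _).symm

theorem two_pow_goodPhase_le {n : ℕ} (hn : 1 ≤ n) (D : ℕ) :
    2 ^ goodPhase n D ≤ 2 * (D + Nat.sqrt n) := by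
  have hs : 1 ≤ Nat.sqrt n := Nat.sqrt_pos.2 hn
  have h1 : 1 < D + Nat.sqrt n + 1 := by omega
  have h2 := Nat.pow_pred_clog_lt_self (b := 2) (by norm_num) h1
  have h3 : 0 < Nat.clog 2 (D + Nat.sqrt n + 1) := Nat.clog_pos (by norm_num) (by omega)
  unfold goodPhase
  obtain ⟨m, hm⟩ : ∃ m, Nat.clog 2 (D + Nat.sqrt n + 1) = m + 1 := ⟨_, (Nat.succ_pred h3.ne').symm⟩
  rw [hm] at h2 ⊢
  rw [Nat.pred_succ] at h2
  rw [pow_succ]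
  omega

theorem phaseLength_goodPhase_le {n : ℕ} (hn : 1 ≤ n) (D : ℕ) {q κ L : ℕ}
    (hL : L ≤ (κ + 1) * lg n) :
    2 * phaseLength q (goodPhase n D) L ≤
      ⌈((8 * (48 * q + 101) * (κ + 1) ^ 2 : ℕ) : ℝ) * (√(n : ℝ) + (D : ℝ)) * (lg n : ℝ) ^ 2⌉₊ := by
  have h1 : 2 * phaseLength q (goodPhase n D) L ≤
      8 * (48 * q + 101) * (κ + 1) ^ 2 * (Nat.sqrt n + D) * lg n ^ 2 := by
    calc 2 * phaseLength q (goodPhase n D) L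
        = 2 * (2 ^ goodPhase n D * ((48 * q + 101) * L ^ 2)) := rfl
      _ ≤ 2 * (2 * (D + Nat.sqrt n) * ((48 * q + 101) * ((κ + 1) * lg n) ^ 2)) := by
        gcongr
        exact two_pow_goodPhase_le hn D
      _ = 4 * (48 * q + 101) * (κ + 1) ^ 2 * (Nat.sqrt n + D) * lg n ^ 2 := by ring
      _ ≤ _ := by gcongr; norm_num
  have h2 : ((8 * (48 * q + 101) * (κ + 1) ^ 2 * (Nat.sqrt n + D) * lg n ^ 2 : ℕ) : ℝ) ≤
      ((8 * (48 * q + 101) * (κ + 1) ^ 2 : ℕ) : ℝ) * (√(n : ℝ) + (D : ℝ)) * (lg n : ℝ) ^ 2 := by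
    rw [Nat.cast_mul, Nat.cast_mul, Nat.cast_add, Nat.cast_pow]
    gcongr
    exact Real.nat_sqrt_le_real_sqrt
  exact h1.trans (Nat.cast_le.1 (h2.trans (Nat.le_ceil _)))

theorem diam_lt_card {V : Type} [Fintype V] {G : SimpleGraph V} (hG : G.Connected) :
    G.diam < Fintype.card V := by
  have : Nonempty V := hG.nonempty
  obtain ⟨u, v, huv⟩ := G.exists_dist_eq_diam
  obtain ⟨p, hp, hlen⟩ := hG.exists_path_of_dist u v
  rw [← huv, ← hlen]
  exact hp.length_lt

/-- A crude bound on the number of phases suffices for the union bound: `J < 2 ^ J ≤ 2 * (D + √n) ≤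
4 * n`. -/
theorem goodPhase_lt {V : Type} [Fintype V] {G : SimpleGraph V} (hG : G.Connected) {L : ℕ}
    (hL : Fintype.card V ≤ 2 ^ L) : goodPhase (Fintype.card V) G.diam + 1 ≤ 2 ^ (L + 2) := by
  have h0 : 1 ≤ Fintype.card V := (Nat.zero_le _).trans_lt (diam_lt_card hG)
  have h1 := two_pow_goodPhase_le h0 G.diam
  have h2 := diam_lt_card hG
  have h3 := Nat.sqrt_le_self (Fintype.card V)
  have h4 : goodPhase (Fintype.card V) G.diam < 2 ^ goodPhase (Fintype.card V) G.diam :=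
    Nat.lt_two_pow_self
  rw [pow_add]
  omega

end Time

end TreeRouting

/-- Exact routing in a rooted tree `T ⊆ G` is computed, with high probability, in
`O((√n + D) * (log n) ^ k)` rounds of the CONGEST model, with tables of `O(log n)` words and labels
of `O(log² n)` words.  Names of vertices have `κ * lg n` bits, and the probability of failure
is at most `1 / n ^ c`. -/
theorem mainTheorem4 :
    ∃ k : ℕ, ∀ κ c : ℕ,
      ∃ (A : TreeRouting.Algorithm TreeRouting.LocalInput (List ℕ × List ℕ))
        (route : List ℕ → List ℕ → Option ℕ) (C : ℕ),
        ∀ (V : Type) [Fintype V] (G : SimpleGraph V) [DecidableRel G.Adj],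
          G.Connected →
          ∀ (P : TreeRouting.PortNumbering G) (name : V → ℕ),
            Function.Injective name →
            (∀ v, TreeRouting.IsWord κ (Fintype.card V) (name v)) →
            ∀ T : G.Subgraph, T.coe.IsTree →
            ∀ z ∈ T.verts, ∀ w : Sym2 V → ℕ, (∀ e ∈ G.edgeSet, 0 < w e) →
              A.SmallMessages P (TreeRouting.localInput P name T z) C ∧
              TreeRouting.tapes V
                  {ω | ¬ TreeRouting.Succeeds A route P name T z w 1 C
                    ⌈(C : ℝ) * (√(Fintype.card V : ℝ) + (G.diam : ℝ)) *
                      (TreeRouting.lg (Fintype.card V) : ℝ) ^ k⌉₊ ω} ≤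
                ((Fintype.card V : ℝ≥0∞) ^ c)⁻¹ := by
  -- One logarithmic factor comes from the budget of fragments and one from messages of `8 * L`
  -- words. The choice `c + 6` is what `tapes_bad_le` needs, and `C` comes from
  -- `phaseLength_goodPhase_le`.
  refine ⟨2, fun κ c => ⟨TreeRouting.treeRoutingAlg (c + 6), TreeRouting.route,
    8 * (48 * (c + 6) + 101) * (κ + 1) ^ 2, ?_⟩⟩
  intro V _ G _ hG P name hname hκ T hT z hz w _
  have hC : 8 * (κ + 1) ≤ 8 * (48 * (c + 6) + 101) * (κ + 1) ^ 2 :=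
    Nat.mul_le_mul (Nat.le_mul_of_pos_right _ (by omega)) (Nat.le_self_pow (by norm_num) _)
  have hn := TreeRouting.card_lt_two_pow hname
  have : Nonempty V := ⟨z⟩
  refine ⟨fun ω t v i => ?_, ?_⟩
  · obtain ⟨J, hJ, hJ'⟩ := TreeRouting.exists_first_pass (P := P) (name := name) (T := T) (z := z)
      hG (by omega : 1 ≤ c + 6) ω
    exact (TreeRouting.run_treeRoutingAlg hG hT hz hname hκ (by omega) hJ hJ').2 t v i
  · refine le_trans (measure_mono ?_) (TreeRouting.tapes_bad_le hT hz
      (TreeRouting.one_le_nameLength name) hn.le (TreeRouting.goodPhase_lt hG hn.le)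
      (TreeRouting.card_le_four_pow_goodPhase (Fintype.card V) G.diam))
    intro ω hω
    by_contra hgood
    exact hω (TreeRouting.succeeds_of_good hG hT hz hname hκ hC w (by omega)
      (TreeRouting.diam_le_two_pow_goodPhase _ _) hgood
      (TreeRouting.phaseLength_goodPhase_le Fintype.card_pos G.diam
        (TreeRouting.nameLength_le hκ)))
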